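/- Let $\mathbb T^2=\mathbb R^2/\mathbb Z^2$ with Lebesgue measure, let $\epsilon\in(0,1)$ and $\Lambda=(-\Delta)^{1/2}$. Let $G$ be the Green function of $\Lambda^{1+\epsilon}$ on mean-zero functions on $\mathbb T^2$, i.e. the convolution kernel of $\Lambda^{-1-\epsilon}$ (with the constant mode removed), \[ G(x)=\frac1{\Gamma(s)}\int_0^\infty t^{s-1}\bigl(p_t(x)-1\bigr)\,dt,\qquad s=\tfrac{1+\epsilon}{2},\qquad p_t(x)=\sum_{n\in\mathbb Z^2}e^{-4\pi^2|n|^2t}e^{2\pi i n\cdot x}, \] which is the integrable function with Fourier coefficients $|2\pi n|^{-1-\epsilon}$ for $n\neq0$ and $0$ for $n=0$. Let $K=\nabla^\perp G=(-\partial_2G,\partial_1G)$ on $\mathbb T^2\setminus\{0\}$ and $K(0)=0$. For $N\in\mathbb N$ and intensities $\xi_1,\dots,\xi_N\in\mathbb R$ consider the modified surface quasi-geostrophic (mSQG) point vortex system \[ \frac{dx_i(t)}{dt}=\frac1{\sqrt N}\sum_{j=1}^N\xi_j\,K\bigl(x_i(t)-x_j(t)\bigr),\qquad i=1,\dots,N,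 \] on $(\mathbb T^2)^N$, and put $\Delta_N=\{(x_1,\dots,x_N)\in(\mathbb T^2)^N:\ x_i=x_j\text{ for some }i\ne j\}$. Then, for every $N$ and all $\xi_1,\dots,\xi_N\in\mathbb R$, for Lebesgue-almost every initial condition $x^0\in\Delta_N^c$ there is a global solution $x:[0,\infty)\to(\mathbb T^2)^N$ of the system with $x(0)=x^0$; it has no collision, i.e. $x(t)\in\Delta_N^c$ for all $t\ge0$; and it is unique: for every $T>0$, every differentiable $y:[0,T)\to(\mathbb T^2)^N$ that solves the system on $[0,T)$ with $y(0)=x^0$ coincides with $x$ on $[0,T)$. -/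

import Mathlib

open MeasureTheory Set

noncomputable section

namespace MSQG

/-- The unit torus `𝕋² = ℝ²/ℤ²`; its `volume` is Lebesgue measure, of total mass one. -/
abbrev Torus : Type := UnitAddTorus (Fin 2)

/-- The squared Euclidean length `|n|²` of a frequency `n ∈ ℤ²`. -/
def freqSq (n : Fin 2 → ℤ) : ℝ := ∑ i, (n i : ℝ) ^ 2

/-- The kernel of the heat semigroup `e^{tΔ}` on the torus, at the points `t > 0`:
`p_t(x) = ∑_{n ∈ ℤ²} exp(-4π²|n|²t) e^{2πi n·x}` (the sum is real, by the symmetry `n ↦ -n`). -/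
def heatKernel (t : ℝ) (x : Torus) : ℝ :=
  ∑' n : Fin 2 → ℤ, Real.exp (-(4 * Real.pi ^ 2 * freqSq n * t)) * (UnitAddTorus.mFourier n x).re

/-- The Green function `G` of `Λ^{1+ε}`, `Λ = (-Δ)^{1/2}`, on mean-zero functions on the torus: the
convolution kernel of `Λ^{-1-ε} = Γ(s)⁻¹ ∫₀^∞ t^{s-1} e^{tΔ} dt`, `s = (1+ε)/2`, where the constant
mode is removed. Its Fourier coefficients are computed in `greenFunction_fourier`. -/
def greenFunction (ε : ℝ) (x : Torus) : ℝ :=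
  (Real.Gamma ((1 + ε) / 2))⁻¹ *
    ∫ t in Ioi (0 : ℝ), t ^ ((1 + ε) / 2 - 1) * (heatKernel t x - 1)

/-- The partial derivative of a function on the torus in the `i`-th coordinate direction. -/
def partialDeriv (f : Torus → ℝ) (i : Fin 2) (x : Torus) : ℝ :=
  deriv (fun h : ℝ => f (x + Pi.single i (h : UnitAddCircle))) 0

open Classical in
/-- The kernel `K = ∇^⊥ G`, `∇^⊥ = (-∂₂, ∂₁)`, with the convention `K(0) = 0`. -/
def kernel (ε : ℝ) (x : Torus) : Fin 2 → ℝ :=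
  if x = 0 then 0
  else ![-partialDeriv (greenFunction ε) 1 x, partialDeriv (greenFunction ε) 0 x]

/-- The set `Δ_N` of configurations in which two of the `N` points coincide. -/
def collisionSet (N : ℕ) : Set (Fin N → Torus) := {x | ∃ i j, i ≠ j ∧ x i = x j}

/-- `X` solves the point vortex system with intensities `ξ` on the time set `S`: it has a lift `x` to
`ℝ²` that is differentiable on `S` (one-sidedly at an end point of `S`) with
`dx_i/dt = N^{-1/2} ∑_j ξ_j K(X_i - X_j)`. Collisions are not excluded. -/
def IsVortexSolution (ε : ℝ) {N : ℕ} (ξ : Fin N → ℝ) (S : Set ℝ) (X : ℝ → Fin N → Torus) : Prop :=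
  ∃ x : ℝ → Fin N → Fin 2 → ℝ,
    (∀ t ∈ S, ∀ i k, ((x t i k : ℝ) : UnitAddCircle) = X t i k) ∧
    ∀ t ∈ S, ∀ i, HasDerivWithinAt (fun τ => x τ i)
      ((Real.sqrt N)⁻¹ • ∑ j, ξ j • kernel ε (X t i - X t j)) S t


open HurwitzZeta in
theorem hasSum_cosKernel (y : UnitAddCircle) {t : ℝ} (ht : 0 < t) :
    HasSum (fun n : ℤ => fourier n y * ((Real.exp (-Real.pi * n ^ 2 * t) : ℝ) : ℂ))
      (cosKernel y t : ℂ) := by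
  obtain ⟨a, rfl⟩ := QuotientAddGroup.mk_surjective y
  have h := hasSum_int_cosKernel a ht
  have e : (fun n : ℤ => Complex.exp (2 * Real.pi * Complex.I * a * n) *
      ((Real.exp (-Real.pi * n ^ 2 * t) : ℝ) : ℂ)) =
      fun n : ℤ => fourier n (a : UnitAddCircle) *
        ((Real.exp (-Real.pi * n ^ 2 * t) : ℝ) : ℂ) := by
    funext n
    rw [fourier_coe_apply]
    congr 2
    push_cast
    ring
  rw [e] at h
  exact h

open HurwitzZeta in
theorem hasSum_heat {t : ℝ} (ht : 0 < t) (x : Torus) :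
    HasSum (fun n : Fin 2 → ℤ =>
      ((Real.exp (-(4 * Real.pi ^ 2 * freqSq n * t)) : ℝ) : ℂ) * UnitAddTorus.mFourier n x)
      ((cosKernel (x 0) (4 * Real.pi * t) * cosKernel (x 1) (4 * Real.pi * t) : ℝ) : ℂ) := by
  have ht' : 0 < 4 * Real.pi * t := by positivity
  have h0 := hasSum_cosKernel (x 0) ht'
  have h1 := hasSum_cosKernel (x 1) ht'
  have hs := summable_mul_of_summable_norm h0.summable.norm h1.summable.norm
  have h := h0.mul h1 hs
  have h' := (Equiv.hasSum_iff (finTwoArrowEquiv ℤ)).2 h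
  clear h hs h0 h1
  rw [Complex.ofReal_mul]
  have e : ((fun p : ℤ × ℤ => fourier p.1 (x 0) *
        ((Real.exp (-Real.pi * p.1 ^ 2 * (4 * Real.pi * t)) : ℝ) : ℂ) * (fourier p.2 (x 1) *
        ((Real.exp (-Real.pi * p.2 ^ 2 * (4 * Real.pi * t)) : ℝ) : ℂ))) ∘ finTwoArrowEquiv ℤ) =
      fun n : Fin 2 → ℤ => ((Real.exp (-(4 * Real.pi ^ 2 * freqSq n * t)) : ℝ) : ℂ) *
        UnitAddTorus.mFourier n x := by
    funext n
    have e1 : Real.exp (-(4 * Real.pi ^ 2 * freqSq n * t)) =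
        Real.exp (-Real.pi * (n 0 : ℝ) ^ 2 * (4 * Real.pi * t)) *
          Real.exp (-Real.pi * (n 1 : ℝ) ^ 2 * (4 * Real.pi * t)) := by
      rw [← Real.exp_add, freqSq, Fin.sum_univ_two]
      congr 1
      ring
    have e2 : UnitAddTorus.mFourier n x = fourier (n 0) (x 0) * fourier (n 1) (x 1) := by
      simp [UnitAddTorus.mFourier]
    rw [e1, e2, Complex.ofReal_mul]
    have e3 : finTwoArrowEquiv ℤ n = (n 0, n 1) := rfl
    simp only [Function.comp, e3]
    ring
  rw [e] at h'
  exact h'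

open HurwitzZeta in
theorem heatKernel_eq {t : ℝ} (ht : 0 < t) (x : Torus) :
    heatKernel t x = cosKernel (x 0) (4 * Real.pi * t) * cosKernel (x 1) (4 * Real.pi * t) := by
  have h := Complex.hasSum_re (hasSum_heat ht x)
  simp only [Complex.re_ofReal_mul, Complex.ofReal_re] at h
  exact h.tsum_eq

open HurwitzZeta in
theorem cosKernel_nonneg (a : UnitAddCircle) {t : ℝ} (ht : 0 < t) : 0 ≤ cosKernel a t := by
  have h := evenKernel_functional_equation a (1 / t)
  have h0 : 0 ≤ evenKernel a (1 / t) := by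
    obtain ⟨b, rfl⟩ := QuotientAddGroup.mk_surjective a
    exact (hasSum_int_evenKernel b (one_div_pos.2 ht)).nonneg fun n => (Real.exp_pos _).le
  rw [h, one_div_one_div] at h0
  exact nonneg_of_mul_nonneg_right h0 (by positivity)

theorem heatKernel_nonneg {t : ℝ} (ht : 0 < t) (x : Torus) : 0 ≤ heatKernel t x := by
  rw [heatKernel_eq ht]
  exact mul_nonneg (cosKernel_nonneg _ (by positivity)) (cosKernel_nonneg _ (by positivity))

theorem norm_mFourier_apply (n : Fin 2 → ℤ) (x : Torus) : ‖UnitAddTorus.mFourier n x‖ = 1 := by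
  simp [UnitAddTorus.mFourier, Circle.norm_coe, fourier_apply]

theorem summable_heat {t : ℝ} (ht : 0 < t) :
    Summable fun n : Fin 2 → ℤ => Real.exp (-(4 * Real.pi ^ 2 * freqSq n * t)) := by
  have h := (hasSum_heat ht 0).summable.norm
  refine h.congr fun n => ?_
  rw [norm_mul, norm_mFourier_apply, Complex.norm_real, Real.norm_eq_abs, Real.abs_exp, mul_one]

theorem hasSum_heatKernel {t : ℝ} (ht : 0 < t) (x : Torus) :
    HasSum (fun n : Fin 2 → ℤ =>
      ((Real.exp (-(4 * Real.pi ^ 2 * freqSq n * t)) : ℝ) : ℂ) * UnitAddTorus.mFourier n x)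
      (heatKernel t x : ℂ) := by
  rw [heatKernel_eq ht]; exact hasSum_heat ht x

theorem continuousOn_heatKernel :
    ContinuousOn (fun p : ℝ × Torus => heatKernel p.1 p.2) (Ioi 0 ×ˢ univ) := by
  have key : ∀ a : ℝ, 0 < a →
      ContinuousOn (fun p : ℝ × Torus => heatKernel p.1 p.2) (Ioi a ×ˢ univ) := by
    intro a ha
    refine continuousOn_tsum (fun n => ?_) (summable_heat ha) ?_
    · have : Continuous fun p : ℝ × Torus => UnitAddTorus.mFourier n p.2 := by fun_prop
      fun_prop
    · rintro n ⟨t, x⟩ ⟨h, -⟩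
      have h : a < t := h
      have h1 := (Complex.abs_re_le_norm (UnitAddTorus.mFourier n x)).trans_eq (norm_mFourier_apply n x)
      have h2 : 0 ≤ freqSq n := by unfold freqSq; positivity
      rw [norm_mul, Real.norm_eq_abs, Real.norm_eq_abs, Real.abs_exp]
      refine (mul_le_of_le_one_right (Real.exp_pos _).le h1).trans ?_
      gcongr
  rintro ⟨t, x⟩ ⟨ht, -⟩
  have ht : 0 < t := ht
  refine ((key (t / 2) (by positivity)).continuousAt ?_).continuousWithinAt
  exact (isOpen_Ioi.prod isOpen_univ).mem_nhds ⟨by simp only [mem_Ioi]; linarith, trivial⟩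

theorem continuous_heatKernel {t : ℝ} (ht : 0 < t) : Continuous (heatKernel t) := by
  have := continuousOn_heatKernel.comp_continuous (f := fun x : Torus => (t, x)) (by fun_prop)
    fun x => ⟨ht, trivial⟩
  exact this

theorem integral_mFourier (n : Fin 2 → ℤ) :
    ∫ x : Torus, UnitAddTorus.mFourier n x = if n = 0 then 1 else 0 := by
  have h1 (k : ℤ) : ∫ y : UnitAddCircle, fourier k y = if k = 0 then 1 else 0 := by
    have := congrFun (fourierCoeff_fourier (T := 1) k) 0
    rw [fourierCoeff] at this
    simp only [neg_zero, fourier_zero, one_smul, AddCircle.volume_eq_smul_haarAddCircle,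
      ENNReal.ofReal_one] at this ⊢
    rw [this]
    simp [Pi.single_apply, eq_comm]
  have h := integral_fintype_prod_volume_eq_prod (𝕜 := ℂ) (E := fun _ : Fin 2 => UnitAddCircle)
    (fun i y => fourier (n i) y)
  simp only [UnitAddTorus.mFourier, ContinuousMap.coe_mk]
  refine h.trans ?_
  simp only [h1, Fin.prod_univ_two]
  by_cases h0 : n 0 = 0 <;> by_cases h2 : n 1 = 0 <;> simp [h0, h2, funext_iff]

theorem integral_heatKernel_mul {t : ℝ} (ht : 0 < t) (m : Fin 2 → ℤ) :
    ∫ x : Torus, UnitAddTorus.mFourier (-m) x * (heatKernel t x : ℂ) =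
      (Real.exp (-(4 * Real.pi ^ 2 * freqSq m * t)) : ℝ) := by
  have e : ∀ x : Torus, UnitAddTorus.mFourier (-m) x * (heatKernel t x : ℂ) =
      ∑' n : Fin 2 → ℤ, ((Real.exp (-(4 * Real.pi ^ 2 * freqSq n * t)) : ℝ) : ℂ) *
        UnitAddTorus.mFourier (-m + n) x := by
    intro x
    rw [← (hasSum_heatKernel ht x).tsum_eq, ← tsum_mul_left]
    refine tsum_congr fun n => ?_
    rw [UnitAddTorus.mFourier_add]; ring
  simp only [e]
  have h := hasSum_integral_of_summable_integral_norm (μ := (volume : Measure Torus))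
    (F := fun (n : Fin 2 → ℤ) (x : Torus) =>
      ((Real.exp (-(4 * Real.pi ^ 2 * freqSq n * t)) : ℝ) : ℂ) *
        UnitAddTorus.mFourier (-m + n) x) ?_ ?_
  · rw [← h.tsum_eq, tsum_eq_single m]
    · rw [integral_const_mul, integral_mFourier]; simp
    · intro n hn
      rw [integral_const_mul, integral_mFourier, if_neg, mul_zero]
      rintro h0
      exact hn (by rw [neg_add_eq_zero] at h0; exact h0.symm)
  · intro n
    exact (Continuous.integrable_of_hasCompactSupport (by fun_prop)
      (HasCompactSupport.of_compactSpace _))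
  · refine (summable_heat ht).congr fun n => ?_
    simp only [norm_mul, norm_mFourier_apply, Complex.norm_real, Real.norm_eq_abs, Real.abs_exp,
      mul_one, integral_const]
    simp [volume_pi, measureReal_def, Measure.pi_univ]

theorem integral_heatKernel {t : ℝ} (ht : 0 < t) : ∫ x : Torus, heatKernel t x = 1 := by
  have h := integral_heatKernel_mul ht 0
  simp only [neg_zero, UnitAddTorus.mFourier_zero, ContinuousMap.one_apply, one_mul] at h
  rw [integral_complex_ofReal] at h
  rw [Complex.ofReal_inj.1 h]
  simp [freqSq]

theorem one_le_freqSq {n : Fin 2 → ℤ} (hn : n ≠ 0) : 1 ≤ freqSq n := by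
  have h : ∃ i, n i ≠ 0 := by
    by_contra! h
    exact hn (funext h)
  obtain ⟨i, hi⟩ := h
  have h1 : (1 : ℤ) ≤ n i ^ 2 := by have := pow_pos (abs_pos.2 hi) 2; rw [sq_abs] at this; omega
  have h2 : (1 : ℝ) ≤ (n i : ℝ) ^ 2 := by exact_mod_cast h1
  exact h2.trans (Finset.single_le_sum (f := fun i => (n i : ℝ) ^ 2)
    (fun _ _ => sq_nonneg _) (Finset.mem_univ i))

theorem abs_heatKernel_sub_one_le {t : ℝ} (ht : 1 ≤ t) (x : Torus) :
    |heatKernel t x - 1| ≤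
      (∑' n : Fin 2 → ℤ, Real.exp (-(4 * Real.pi ^ 2 * freqSq n * 1)) * Real.exp 1) *
        Real.exp (-t) := by
  have h := (hasSum_heatKernel (by linarith : 0 < t) x)
  have h1 := h.sub (hasSum_ite_eq (0 : Fin 2 → ℤ) (1 : ℂ))
  rw [← Real.norm_eq_abs, ← Complex.norm_real, Complex.ofReal_sub, Complex.ofReal_one,
    ← h1.tsum_eq, ← tsum_mul_right]
  have hs := ((summable_heat one_pos).mul_right (Real.exp 1)).mul_right (Real.exp (-t))
  refine tsum_of_norm_bounded hs.hasSum fun n => ?_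
  split_ifs with hn
  · subst hn
    simp only [freqSq, Pi.zero_apply, UnitAddTorus.mFourier_zero]
    simp
    positivity
  · rw [sub_zero, norm_mul, norm_mFourier_apply, mul_one, Complex.norm_real, Real.norm_eq_abs,
      Real.abs_exp, ← Real.exp_add, ← Real.exp_add]
    have h3 := one_le_freqSq hn
    have hpi : 1 ≤ 4 * Real.pi ^ 2 := by nlinarith [Real.pi_gt_three]
    gcongr
    have : 1 * 1 ≤ 4 * Real.pi ^ 2 * freqSq n := by gcongr
    nlinarith

theorem integral_abs_le : ∃ D : ℝ, ∀ t : ℝ, 0 < t →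
    ∫ x : Torus, |heatKernel t x - 1| ≤ D * Real.exp (-t) := by
  set C := ∑' n : Fin 2 → ℤ, Real.exp (-(4 * Real.pi ^ 2 * freqSq n * 1)) * Real.exp 1 with hC
  have hC0 : 0 ≤ C := tsum_nonneg fun n => by positivity
  have hint : ∀ f : Torus → ℝ, Continuous f → Integrable f := fun f hf =>
    hf.integrable_of_hasCompactSupport (HasCompactSupport.of_compactSpace _)
  have hone : ∫ _ : Torus, (1 : ℝ) = 1 := by
    simp [volume_pi, measureReal_def, Measure.pi_univ]
  refine ⟨C + 2 * Real.exp 1, fun t ht => ?_⟩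
  have hc := continuous_heatKernel ht
  rcases le_total t 1 with h | h
  · have h1 : ∫ x : Torus, |heatKernel t x - 1| ≤ ∫ x : Torus, (heatKernel t x + 1) := by
      refine integral_mono (hint _ (by fun_prop)) (hint _ (by fun_prop)) fun x => ?_
      have := heatKernel_nonneg ht x
      simp only [abs_le]
      constructor <;> linarith
    rw [integral_add (hint _ hc) (hint _ (by fun_prop)), integral_heatKernel ht, hone] at h1
    have h2 : 1 ≤ Real.exp 1 * Real.exp (-t) := by
      rw [← Real.exp_add]; exact Real.one_le_exp (by linarith)
    nlinarith [Real.exp_pos (-t), mul_nonneg hC0 (Real.exp_pos (-t)).le]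
  · have h1 : ∫ x : Torus, |heatKernel t x - 1| ≤ ∫ _ : Torus, C * Real.exp (-t) * 1 :=
      integral_mono (hint _ (by fun_prop)) (hint _ (by fun_prop)) fun x => by
        rw [mul_one]; exact abs_heatKernel_sub_one_le h x
    rw [integral_const_mul, hone] at h1
    nlinarith [mul_pos (Real.exp_pos 1) (Real.exp_pos (-t))]

theorem integrable_green_aux {s : ℝ} (hs : 0 < s) :
    Integrable (fun p : ℝ × Torus => p.1 ^ (s - 1) * (heatKernel p.1 p.2 - 1))
      ((volume.restrict (Ioi 0)).prod volume) := by
  have hm : AEStronglyMeasurable (fun p : ℝ × Torus => p.1 ^ (s - 1) * (heatKernel p.1 p.2 - 1))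
      ((volume.restrict (Ioi 0)).prod volume) := by
    have hc : ContinuousOn (fun p : ℝ × Torus => p.1 ^ (s - 1) * (heatKernel p.1 p.2 - 1))
        (Ioi 0 ×ˢ univ) := by
      refine ContinuousOn.mul ?_ (continuousOn_heatKernel.sub continuousOn_const)
      exact continuousOn_fst.rpow_const fun p hp => Or.inl (ne_of_gt hp.1)
    have := hc.aestronglyMeasurable (μ := (volume : Measure ℝ).prod (volume : Measure Torus))
      (measurableSet_Ioi.prod MeasurableSet.univ)
    rwa [← Measure.prod_restrict, Measure.restrict_univ] at this
  obtain ⟨D, hD⟩ := integral_abs_le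
  refine (integrable_prod_iff hm).2 ⟨?_, ?_⟩
  · refine (ae_restrict_mem measurableSet_Ioi).mono fun t ht => ?_
    have hc := continuous_heatKernel ht
    have hc' : Continuous fun x : Torus => t ^ (s - 1) * (heatKernel t x - 1) :=
      continuous_const.mul (hc.sub continuous_const)
    exact hc'.integrable_of_hasCompactSupport (HasCompactSupport.of_compactSpace _)
  · have hg : Integrable (fun t : ℝ => D * (Real.exp (-t) * t ^ (s - 1)))
        (volume.restrict (Ioi 0)) := (Real.GammaIntegral_convergent hs).const_mul D
    refine hg.mono' hm.norm.integral_prod_right' ?_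
    refine (ae_restrict_mem measurableSet_Ioi).mono fun t ht => ?_
    have ht : 0 < t := ht
    have hp : 0 ≤ t ^ (s - 1) := Real.rpow_nonneg ht.le _
    have h1 : ∀ x : Torus, ‖t ^ (s - 1) * (heatKernel t x - 1)‖ =
        t ^ (s - 1) * |heatKernel t x - 1| := fun x => by
      rw [norm_mul, Real.norm_eq_abs, Real.norm_eq_abs, abs_of_nonneg hp]
    simp only [h1]
    rw [integral_const_mul, Real.norm_eq_abs, abs_of_nonneg
      (mul_nonneg hp (integral_nonneg fun _ => abs_nonneg _))]
    nlinarith [mul_le_mul_of_nonneg_left (hD t ht) hp]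

/-- `greenFunction ε` is the integrable function on the torus whose Fourier coefficients are the
symbol `|2πn|^{-1-ε}` of `Λ^{-1-ε}` at `n ≠ 0`, and `0` at `n = 0`. -/
theorem greenFunction_fourier {ε : ℝ} (hε : -1 < ε) :
    Integrable (greenFunction ε) ∧ ∀ n : Fin 2 → ℤ,
      ∫ x : Torus, UnitAddTorus.mFourier (-n) x * (greenFunction ε x : ℂ) =
        if n = 0 then 0 else (((2 * Real.pi * Real.sqrt (freqSq n)) ^ (-(1 + ε)) : ℝ) : ℂ) := by
  have hs : 0 < (1 + ε) / 2 := by linarith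
  have hF := integrable_green_aux hs
  refine ⟨hF.integral_prod_right.const_mul _, fun n => ?_⟩
  set s := (1 + ε) / 2 with hsdef
  have hG : ∀ x : Torus, UnitAddTorus.mFourier (-n) x * (greenFunction ε x : ℂ) =
      ((Real.Gamma s)⁻¹ : ℝ) * ∫ t in Ioi (0 : ℝ),
        UnitAddTorus.mFourier (-n) x * ((t ^ (s - 1) * (heatKernel t x - 1) : ℝ) : ℂ) := by
    intro x
    rw [integral_const_mul, integral_complex_ofReal, greenFunction, ← hsdef, Complex.ofReal_mul]
    ring
  simp only [hG]
  rw [integral_const_mul]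
  have hFc : Integrable (fun p : ℝ × Torus => UnitAddTorus.mFourier (-n) p.2 *
      ((p.1 ^ (s - 1) * (heatKernel p.1 p.2 - 1) : ℝ) : ℂ))
      ((volume.restrict (Ioi 0)).prod volume) := by
    refine hF.ofReal.bdd_mul (c := 1) ?_ ?_
    · exact Continuous.aestronglyMeasurable (by fun_prop)
    · exact Filter.Eventually.of_forall fun p => (norm_mFourier_apply _ _).le
  rw [← integral_integral_swap (f := fun (t : ℝ) (x : Torus) => UnitAddTorus.mFourier (-n) x *
      ((t ^ (s - 1) * (heatKernel t x - 1) : ℝ) : ℂ)) hFc]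
  have hin : ∀ t ∈ Ioi (0 : ℝ), (∫ x : Torus, UnitAddTorus.mFourier (-n) x *
      ((t ^ (s - 1) * (heatKernel t x - 1) : ℝ) : ℂ)) =
      ((if n = 0 then 0 else
        t ^ (s - 1) * Real.exp (-((4 * Real.pi ^ 2 * freqSq n) * t)) : ℝ) : ℂ) := by
    intro t ht
    have hc := continuous_heatKernel ht
    have e : ∀ x : Torus, UnitAddTorus.mFourier (-n) x *
        ((t ^ (s - 1) * (heatKernel t x - 1) : ℝ) : ℂ) = ((t ^ (s - 1) : ℝ) : ℂ) *
        (UnitAddTorus.mFourier (-n) x * (heatKernel t x : ℂ) -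
          UnitAddTorus.mFourier (-n) x) := fun x => by push_cast; ring
    simp only [e]
    rw [integral_const_mul, integral_sub
      (Continuous.integrable_of_hasCompactSupport (by fun_prop)
        (HasCompactSupport.of_compactSpace _))
      (Continuous.integrable_of_hasCompactSupport (by fun_prop)
        (HasCompactSupport.of_compactSpace _)), integral_heatKernel_mul ht, integral_mFourier]
    split_ifs with h1 h2 h2
    · subst h2; simp [freqSq]
    · exact absurd (neg_eq_zero.1 h1) h2
    · exact absurd (neg_eq_zero.2 h2) h1
    · push_cast; ring
  rw [setIntegral_congr_fun measurableSet_Ioi hin, integral_complex_ofReal]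
  split_ifs with hn
  · simp
  · have h1 := one_le_freqSq hn
    have hb : 0 < 4 * Real.pi ^ 2 * freqSq n := by positivity
    rw [Real.integral_rpow_mul_exp_neg_mul_Ioi hs hb, ← Complex.ofReal_mul]
    congr 1
    have hq : 4 * Real.pi ^ 2 * freqSq n = (2 * Real.pi * Real.sqrt (freqSq n)) ^ (2 : ℝ) := by
      rw [Real.rpow_two, mul_pow, Real.sq_sqrt (by linarith)]; ring
    have hΓ := (Real.Gamma_pos_of_pos hs).ne'
    rw [one_div, Real.inv_rpow hb.le, hq, ← Real.rpow_mul (by positivity), Real.rpow_neg (by positivity),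
      show 2 * s = 1 + ε by rw [hsdef]; ring]
    field_simp

end MSQG
end

noncomputable section

namespace MSQG

open Filter Topology NNReal

/-! ### Forward flows of bounded Lipschitz vector fields -/

section Semiflow

variable {E : Type*} [NormedAddCommGroup E] [NormedSpace ℝ E]

/-! The intensities may have any signs, so the conserved Hamiltonian gives no bound on close pairs.
The proof instead follows the unweighted energy, the sum of `G(x_i - x_j)` over pairs shifted to be
nonnegative. It is not conserved, but its rate of change is integrable. The motion that two vortices
induce on each other is along `∇^⊥G(x_i - x_j)`, orthogonal to `∇G(x_i - x_j)`. Only triples of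
distinct vortices contribute, through products such as `|∇G(x_i - x_j)| |∇G(x_i - x_l)|`. For
uniform points on the torus the two differences are independent, so integrability of `∇G` is enough;
square integrability, which fails here, is not needed.

To make this rigorous, `G` is smoothly cut off at level `M`, and the system is lifted to `(ℝ²)^N`.
The truncated field is bounded, Lipschitz, periodic and divergence free, so it has a global flow. By
Liouville's theorem (`IsSemiflow.setIntegral_comp`) this flow preserves the integrals of bounded
Lipschitz periodic functions over a fundamental cell. Hence the initial energy plus the time
integral of the rate has an integral bounded uniformly in `M`, and it dominates the energy at all
times in `[0, T]`. Markov's inequality gives measure at most `A / M` to the initial data for which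
some pair reaches level `M` before `T` (`exists_measure_truncate_ge_le`).

As `M → ∞`, almost every initial configuration has, for each time horizon, a level that is never
reached. There the truncated and the true kernel agree, so the truncated trajectory solves the true
system without collision. A competing solution starts in the same open low-energy region, where the
field is Lipschitz, and a continuation argument (`eqOn_of_lowEnergy`) keeps it on the known
trajectory.

What remains is `IsGreenLike (greenFunction ε)`. The heat integral is split at time 1: periodised
Gaussians describe short times, plane waves long ones. With `s = (1+ε)/2`, the gradient is
integrable because `t^(s-3/2)` is integrable at 0, which uses `ε > 0`; `G → ∞` at the origin because
`s < 1`, which uses `ε < 1`. -/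

theorem exists_glue {v : E → E} (α : ℕ → ℝ → E)
    (hd : ∀ n : ℕ, ∀ t ∈ Icc (0 : ℝ) n, HasDerivWithinAt (α n) (v (α n t)) (Icc 0 n) t)
    (hag : ∀ m n : ℕ, m ≤ n → ∀ t ∈ Icc (0 : ℝ) m, α m t = α n t) :
    ∃ β : ℝ → E, (∀ n : ℕ, ∀ t ∈ Icc (0 : ℝ) n, β t = α n t) ∧
      ∀ t, 0 ≤ t → HasDerivWithinAt β (v (β t)) (Ici 0) t := by
  have hβ : ∀ n : ℕ, ∀ t ∈ Icc (0 : ℝ) n, α ⌈t⌉₊ t = α n t := fun n t ht =>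
    hag _ n (Nat.ceil_le.2 ht.2) t ⟨ht.1, Nat.le_ceil t⟩
  refine ⟨fun t => α ⌈t⌉₊ t, hβ, fun t ht => ?_⟩
  -- Strictness matters: `[0, n]` must be a neighbourhood of `t` within `[0, ∞)`.
  obtain ⟨n, hn⟩ := exists_nat_gt t
  have htn : t ∈ Icc (0 : ℝ) n := ⟨ht, hn.le⟩
  have h1 := (hd n t htn).congr (f₁ := fun t => α ⌈t⌉₊ t) (hβ n) (hβ n t htn)
  rw [← hβ n t htn] at h1
  refine h1.mono_of_mem_nhdsWithin ?_
  filter_upwards [self_mem_nhdsWithin, mem_nhdsWithin_of_mem_nhds (Iio_mem_nhds hn)] with τ h2 h3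
  exact ⟨h2, le_of_lt h3⟩

/-- `φ` is the forward flow of the autonomous field `b`. -/
structure IsSemiflow (b : E → E) (φ : ℝ → E → E) : Prop where
  zero : ∀ x, φ 0 x = x
  deriv : ∀ x t, 0 ≤ t → HasDerivWithinAt (fun τ => φ τ x) (b (φ t x)) (Ici 0) t

theorem eqOn_of_solutions {b : E → E} {K : ℝ≥0} (hb : LipschitzWith K b) {T : ℝ} {α β : ℝ → E}
    (hα : ∀ t ∈ Icc 0 T, HasDerivWithinAt α (b (α t)) (Icc 0 T) t)
    (hβ : ∀ t ∈ Icc 0 T, HasDerivWithinAt β (b (β t)) (Icc 0 T) t)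
    (h0 : α 0 = β 0) : EqOn α β (Icc 0 T) := by
  have aux : ∀ γ : ℝ → E, (∀ t ∈ Icc 0 T, HasDerivWithinAt γ (b (γ t)) (Icc 0 T) t) →
      ∀ t ∈ Ico 0 T, HasDerivWithinAt γ (b (γ t)) (Ici t) t := by
    intro γ hγ t ht
    refine (hγ t (Ico_subset_Icc_self ht)).mono_of_mem_nhdsWithin ?_
    filter_upwards [self_mem_nhdsWithin, mem_nhdsWithin_of_mem_nhds (Iio_mem_nhds ht.2)]
      with τ h2 h3
    exact ⟨ht.1.trans h2, le_of_lt h3⟩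
  exact ODE_solution_unique_of_mem_Icc_right (v := fun _ => b) (s := fun _ => univ)
    (fun _ _ => hb.lipschitzOnWith) (fun t ht => (hα t ht).continuousWithinAt) (aux α hα)
    (fun _ _ => trivial) (fun t ht => (hβ t ht).continuousWithinAt) (aux β hβ)
    (fun _ _ => trivial) h0

theorem exists_isSemiflow [CompleteSpace E] {b : E → E} {K C : ℝ≥0} (hb : LipschitzWith K b)
    (hC : ∀ x, ‖b x‖ ≤ C) : ∃ φ, IsSemiflow b φ := by
  have h1 : ∀ (x : E) (n : ℕ), ∃ α : ℝ → E, α 0 = x ∧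
      ∀ t ∈ Icc (0 : ℝ) n, HasDerivWithinAt α (b (α t)) (Icc 0 n) t := by
    intro x n
    -- Speed at most `C` cannot leave the ball of radius `C * n` during `[0, n]`, so one application
    -- of Picard–Lindelöf covers the whole interval.
    have h := IsPicardLindelof.of_time_independent (f := b) (tmin := 0) (tmax := n)
      (t₀ := ⟨0, le_rfl, Nat.cast_nonneg n⟩) (x₀ := x) (a := C * n) (r := 0) (L := C) (K := K)
      (fun y _ => hC y) hb.lipschitzOnWith (by simp)
    exact h.exists_eq_forall_mem_Icc_hasDerivWithinAt₀
  choose α hα0 hα using h1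
  have h2 : ∀ x, ∃ β : ℝ → E, (∀ n : ℕ, ∀ t ∈ Icc (0 : ℝ) n, β t = α x n t) ∧
      ∀ t, 0 ≤ t → HasDerivWithinAt β (b (β t)) (Ici 0) t := by
    intro x
    refine exists_glue (α x) (hα x) fun m n hmn => ?_
    have hsub : Icc (0 : ℝ) m ⊆ Icc 0 n := Icc_subset_Icc_right (by exact_mod_cast hmn)
    exact eqOn_of_solutions hb (hα x m) (fun t ht => (hα x n t (hsub ht)).mono hsub)
      ((hα0 x m).trans (hα0 x n).symm)
  choose β hβ hβ' using h2
  exact ⟨fun t x => β x t, fun x => by rw [hβ x 0 0 (by simp), hα0], hβ'⟩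

namespace IsSemiflow

variable {b : E → E} {φ : ℝ → E → E} {K C : ℝ≥0}

theorem hasDerivWithinAt_Icc (hφ : IsSemiflow b φ) (x : E) (T t : ℝ) (ht : t ∈ Icc 0 T) :
    HasDerivWithinAt (fun τ => φ τ x) (b (φ t x)) (Icc 0 T) t :=
  (hφ.deriv x t ht.1).mono Icc_subset_Ici_self

theorem continuousOn (hφ : IsSemiflow b φ) (x : E) : ContinuousOn (fun τ => φ τ x) (Ici 0) :=
  fun t ht => (hφ.deriv x t ht).continuousWithinAt

theorem deriv_right (hφ : IsSemiflow b φ) (x : E) {t : ℝ} (ht : 0 ≤ t) :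
    HasDerivWithinAt (fun τ => φ τ x) (b (φ t x)) (Ici t) t :=
  (hφ.deriv x t ht).mono (Ici_subset_Ici.2 ht)

theorem dist_le (hφ : IsSemiflow b φ) (hb : LipschitzWith K b) {t : ℝ} (ht : 0 ≤ t) (x y : E) :
    dist (φ t x) (φ t y) ≤ dist x y * Real.exp (K * t) := by
  have h := dist_le_of_trajectories_ODE (v := fun _ => b) (a := 0) (b := t) (δ := dist x y)
    (fun _ => hb) ((hφ.continuousOn x).mono Icc_subset_Ici_self)
    (fun s hs => hφ.deriv_right x hs.1) ((hφ.continuousOn y).mono Icc_subset_Ici_self)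
    (fun s hs => hφ.deriv_right y hs.1) (by rw [hφ.zero, hφ.zero]) t ⟨ht, le_rfl⟩
  simpa using h

theorem norm_sub_le (hφ : IsSemiflow b φ) (hC : ∀ x, ‖b x‖ ≤ C) (x : E) {s t : ℝ} (hs : 0 ≤ s)
    (ht : 0 ≤ t) : ‖φ t x - φ s x‖ ≤ C * |t - s| :=
  (convex_Ici (0 : ℝ)).norm_image_sub_le_of_norm_hasDerivWithin_le
    (fun r hr => hφ.deriv x r hr) (fun _ _ => hC _) hs ht

/-- Along the trajectory up to time `h` the velocity differs from `b x` by at most `K * (C * h)`;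
integrating gives a second-order local error. -/
theorem norm_sub_euler_le (hφ : IsSemiflow b φ) (hb : LipschitzWith K b) (hC : ∀ x, ‖b x‖ ≤ C)
    (x : E) {h : ℝ} (hh : 0 ≤ h) : ‖φ h x - (x + h • b x)‖ ≤ K * C * h ^ 2 := by
  have key := (convex_Icc (0 : ℝ) h).norm_image_sub_le_of_norm_hasDerivWithin_le
    (f := fun t => φ t x - t • b x) (f' := fun t => b (φ t x) - (1 : ℝ) • b x)
    (C := K * (C * h)) (x := 0) (y := h)
    (fun t ht => (hφ.hasDerivWithinAt_Icc x h t ht).sub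
      ((hasDerivWithinAt_id t _).smul_const (b x)))
    (fun t ht => ?_) ⟨le_rfl, hh⟩ ⟨hh, le_rfl⟩
  · simp only [hφ.zero, zero_smul, sub_zero, Real.norm_eq_abs, abs_of_nonneg hh] at key
    calc ‖φ h x - (x + h • b x)‖ = ‖φ h x - h • b x - x‖ := by congr 1; abel
      _ ≤ K * (C * h) * h := key
      _ = K * C * h ^ 2 := by ring
  · rw [one_smul, ← dist_eq_norm]
    refine (hb.dist_le_mul _ _).trans ?_
    gcongr
    have h1 := hφ.norm_sub_le hC x le_rfl ht.1
    rw [hφ.zero, sub_zero, abs_of_nonneg ht.1] at h1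
    rw [dist_eq_norm]
    exact h1.trans (by gcongr; exact ht.2)

theorem comp_add_const (hφ : IsSemiflow b φ) (y : E) (s : ℝ) (hs : 0 ≤ s) (t : ℝ) (ht : 0 ≤ t) :
    HasDerivWithinAt (fun τ => φ (τ + s) y) (b (φ (t + s) y)) (Ici 0) t := by
  have h := (hφ.deriv y (t + s) (by positivity)).scomp t
    (((hasDerivWithinAt_id t (Ici 0)).add_const s)) (fun τ hτ => by
      have : (0 : ℝ) ≤ τ := hτ
      simp only [mem_Ici, id]; linarith)
  simpa [Function.comp_def] using h

theorem add (hφ : IsSemiflow b φ) (hb : LipschitzWith K b) (x : E) {s t : ℝ} (hs : 0 ≤ s)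
    (ht : 0 ≤ t) : φ (t + s) x = φ t (φ s x) := by
  have h := eqOn_of_solutions hb (T := t) (α := fun τ => φ (τ + s) x)
    (β := fun τ => φ τ (φ s x))
    (fun τ hτ => (hφ.comp_add_const x s hs τ hτ.1).mono Icc_subset_Ici_self)
    (fun τ hτ => hφ.hasDerivWithinAt_Icc _ t τ hτ) (by simp [hφ.zero])
  exact h ⟨ht, le_rfl⟩

theorem add_period (hφ : IsSemiflow b φ) (hb : LipschitzWith K b) {l : E}
    (hl : ∀ x, b (x + l) = b x) (x : E) {t : ℝ} (ht : 0 ≤ t) : φ t (x + l) = φ t x + l := by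
  have h := eqOn_of_solutions hb (T := t) (α := fun τ => φ τ (x + l))
    (β := fun τ => φ τ x + l) (fun τ hτ => hφ.hasDerivWithinAt_Icc _ t τ hτ)
    (fun τ hτ => by rw [hl]; exact (hφ.hasDerivWithinAt_Icc x t τ hτ).add_const l)
    (by simp [hφ.zero])
  exact h ⟨ht, le_rfl⟩

theorem continuousOn_uncurry (hφ : IsSemiflow b φ) (hb : LipschitzWith K b) (hC : ∀ x, ‖b x‖ ≤ C) :
    ContinuousOn (fun p : ℝ × E => φ p.1 p.2) (Ici 0 ×ˢ univ) := by
  rintro ⟨t, x⟩ ⟨ht, -⟩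
  have ht : (0 : ℝ) ≤ t := ht
  rw [ContinuousWithinAt, tendsto_iff_dist_tendsto_zero]
  have hb0 : Tendsto (fun p : ℝ × E => C * |p.1 - t| + dist p.2 x * Real.exp (K * t))
      (𝓝[Ici 0 ×ˢ univ] (t, x)) (𝓝 0) := by
    have hc : Continuous (fun p : ℝ × E => C * |p.1 - t| + dist p.2 x * Real.exp (K * t)) := by
      fun_prop
    have := hc.tendsto (t, x)
    simp only [sub_self, abs_zero, mul_zero, dist_self, zero_mul, add_zero] at this
    exact this.mono_left nhdsWithin_le_nhds
  refine squeeze_zero' (Eventually.of_forall fun _ => dist_nonneg) ?_ hb0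
  filter_upwards [self_mem_nhdsWithin] with p hp
  refine (dist_triangle _ (φ t p.2) _).trans ?_
  gcongr
  · rw [dist_eq_norm]; exact hφ.norm_sub_le hC _ ht hp.1
  · exact hφ.dist_le hb ht _ _

end IsSemiflow

end Semiflow

/-! ### Liouville's theorem for periodic divergence-free fields -/

section Liouville

/-- The expression is polynomial in the entries, hence differentiable. Along each line `r • M`,
`Matrix.det_one_add_smul` leaves `r²` times a polynomial, so the derivative at 0 vanishes. -/
theorem hasFDerivAt_matrix_det_one_add {ι : Type*} [Fintype ι] [DecidableEq ι] :
    (fun M : ι → ι → ℝ => Matrix.det (1 + Matrix.of M) - 1 - Matrix.trace (Matrix.of M)) =o[𝓝 0]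
      fun M => M := by
  have hdiff : Differentiable ℝ fun M : ι → ι → ℝ =>
      Matrix.det (1 + Matrix.of M) - 1 - Matrix.trace (Matrix.of M) := by
    simp only [Matrix.det_apply, Matrix.trace, Matrix.add_apply, Matrix.of_apply, Matrix.diag]
    fun_prop
  have h0 := (hdiff 0).hasFDerivAt
  have hz : fderiv ℝ (fun M : ι → ι → ℝ =>
      Matrix.det (1 + Matrix.of M) - 1 - Matrix.trace (Matrix.of M)) 0 = 0 := by
    ext M
    have h1 : HasDerivAt (fun r : ℝ => r • M) M 0 := by
      simpa using (hasDerivAt_id (0 : ℝ)).smul_const M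
    have h2 := HasFDerivAt.comp_hasDerivAt (0 : ℝ) (by simpa using h0) h1
    have h3 : HasDerivAt (fun r : ℝ =>
        (Matrix.det (1 + (Polynomial.X : Polynomial ℝ) • (Matrix.of M).map Polynomial.C)).divX.divX.eval r
          * r ^ 2) 0 0 := by
      have := (Polynomial.hasDerivAt (Matrix.det
        (1 + (Polynomial.X : Polynomial ℝ) • (Matrix.of M).map Polynomial.C)).divX.divX (0 : ℝ)).fun_mul
        (hasDerivAt_pow 2 (0 : ℝ))
      simpa using this
    refine h2.unique (h3.congr_of_eventuallyEq (Eventually.of_forall fun r => ?_))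
    have h4 := Matrix.det_one_add_smul r (Matrix.of M)
    have h5 : Matrix.of (r • M) = r • Matrix.of M := rfl
    simp only [Function.comp, h5, h4, Matrix.trace_smul, smul_eq_mul]
    ring
  rw [hz] at h0
  have := h0.isLittleO
  simpa using this

variable {E : Type*} [NormedAddCommGroup E] [NormedSpace ℝ E] [FiniteDimensional ℝ E]

theorem det_one_add_isLittleO :
    (fun A : E →L[ℝ] E => (1 + A).det - 1 - LinearMap.trace ℝ E A) =o[𝓝 0] fun A => A := by
  classical
  let B := Module.finBasis ℝ E
  let m : (E →L[ℝ] E) →ₗ[ℝ] (Fin (Module.finrank ℝ E) → Fin (Module.finrank ℝ E) → ℝ) :=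
    (LinearMap.toMatrix B B).toLinearMap ∘ₗ ContinuousLinearMap.coeLM ℝ
  have hm : Continuous m := m.continuous_of_finiteDimensional
  have h := (hasFDerivAt_matrix_det_one_add
    (ι := Fin (Module.finrank ℝ E))).comp_tendsto (show Tendsto m (𝓝 0) (𝓝 0) by
      have := hm.tendsto 0
      rwa [map_zero] at this)
  have hO : (fun A : E →L[ℝ] E => m A) =O[𝓝 0] fun A => A :=
    (m.toContinuousLinearMap).isBigO_id _
  refine (h.trans_isBigO hO).congr_left fun A => ?_
  have e1 : (Matrix.of (m A)) = LinearMap.toMatrix B B (A : E →ₗ[ℝ] E) := rfl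
  simp only [Function.comp, e1]
  rw [← LinearMap.trace_eq_matrix_trace ℝ B, ← LinearMap.toMatrix_one B, ← map_add,
    LinearMap.det_toMatrix]
  rfl

/-- The Euler step is a perturbation of the identity with Lipschitz constant below one, so it is a
homeomorphism. -/
theorem exists_homeomorph_id_add_smul {b : E → E} {K : ℝ≥0} (hb : LipschitzWith K b) {h : ℝ}
    (hh : ‖h‖₊ * K < 1) : ∃ f : E ≃ₜ E, ∀ x, f x = x + h • b x := by
  have ha : ApproximatesLinearOn (fun x => x + h • b x)
      ((ContinuousLinearEquiv.refl ℝ E : E ≃L[ℝ] E) : E →L[ℝ] E) univ (‖h‖₊ * K) := by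
    intro x _ y _
    have e : x + h • b x - (y + h • b y) -
        ((ContinuousLinearEquiv.refl ℝ E : E ≃L[ℝ] E) : E →L[ℝ] E) (x - y) = h • (b x - b y) := by
      simp only [ContinuousLinearEquiv.coe_refl, ContinuousLinearMap.coe_id', id, smul_sub]
      abel
    rw [e, norm_smul]
    have := hb.dist_le_mul x y
    rw [dist_eq_norm, dist_eq_norm] at this
    push_cast
    rw [mul_assoc]
    gcongr
  refine ⟨ha.toHomeomorph _ ?_, fun x => rfl⟩
  rcases subsingleton_or_nontrivial E with h1 | h1
  · exact Or.inl h1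
  · right
    have : ‖((ContinuousLinearEquiv.refl ℝ E).symm : E →L[ℝ] E)‖₊ = 1 := by
      apply NNReal.eq
      simp
    rwa [this, inv_one]

variable [MeasurableSpace E] [BorelSpace E] (μ : Measure E) [μ.IsAddHaarMeasure]
  {ι : Type*} [Fintype ι] (B : Module.Basis ι ℝ E)

open Module Submodule in
-- Change of variables turns the left side into the integral of `u` over the image of the cell. The
-- Euler step commutes with lattice translations, so this image is again a fundamental domain, and a
-- periodic function has the same integral over both.
theorem setIntegral_det_mul_comp_id_add_smul {b : E → E} {K : ℝ≥0} (hb : LipschitzWith K b)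
    (hd : Differentiable ℝ b) (hper : ∀ l ∈ span ℤ (range B), ∀ x, b (x + l) = b x) {h : ℝ}
    (hh : ‖h‖₊ * K < 1) {u : E → ℝ} (hu : ∀ l ∈ span ℤ (range B), ∀ x, u (x + l) = u x) :
    ∫ x in ZSpan.fundamentalDomain B, |(1 + h • fderiv ℝ b x).det| • u (x + h • b x) ∂μ =
      ∫ x in ZSpan.fundamentalDomain B, u x ∂μ := by
  obtain ⟨f, hf⟩ := exists_homeomorph_id_add_smul hb hh
  have hfd : ∀ x, HasFDerivAt f (1 + h • fderiv ℝ b x) x := by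
    intro x
    have : (f : E → E) = fun x => x + h • b x := funext hf
    rw [this]
    exact (hasFDerivAt_id x).add ((hd x).hasFDerivAt.const_smul h)
  have h1 := integral_image_eq_integral_abs_det_fderiv_smul μ
    (ZSpan.fundamentalDomain_measurableSet B) (fun x _ => (hfd x).hasFDerivWithinAt)
    f.injective.injOn u
  have hfe : (fun x => x + h • b x) = f := (funext hf).symm
  simp only [hf] at h1
  rw [← h1, hfe]
  have hD := ZSpan.isAddFundamentalDomain' B μ
  have hD' : IsAddFundamentalDomain (span ℤ (range B)).toAddSubgroup (f '' ZSpan.fundamentalDomain B) μ := by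
    -- Two facts are required: `f` sends null sets to null sets, by differentiability, and it is
    -- equivariant under the lattice, by periodicity of `b`.
    refine hD.image_of_equiv f.toEquiv ?_ (Equiv.refl _) ?_
    · refine ⟨f.symm.continuous.measurable, ?_⟩
      refine Measure.AbsolutelyContinuous.mk fun s hs h0 => ?_
      refine (Measure.map_apply f.symm.continuous.measurable hs).trans ?_
      have : (f.symm : E → E) ⁻¹' s = f '' s := (f.toEquiv.image_eq_preimage_symm s).symm
      refine (congrArg μ this).trans ?_
      exact addHaar_image_eq_zero_of_differentiableOn_of_addHaar_eq_zero μ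
        (fun x _ => (hfd x).differentiableAt.differentiableWithinAt) h0
    · rintro ⟨l, hl⟩ x
      have e1 : f (l + x) = l + f x := by
        rw [hf, hf, add_comm l x, hper l hl]; abel
      exact e1
  have : Countable (span ℤ (range B)).toAddSubgroup :=
    inferInstanceAs (Countable (span ℤ (range B) : Submodule ℤ E))
  refine IsAddFundamentalDomain.setIntegral_eq hD' hD (f := u) ?_
  rintro ⟨l, hl⟩ x
  have e1 : u (l + x) = u x := by rw [add_comm, hu l hl]
  exact e1

open Module Submodule Asymptotics in
/-- **Liouville's theorem**: the flow of a divergence free periodic field preserves the integrals of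
periodic Lipschitz functions. -/
theorem IsSemiflow.setIntegral_comp {b : E → E} {φ : ℝ → E → E} {K C : ℝ≥0} (hφ : IsSemiflow b φ)
    (hb : LipschitzWith K b) (hC : ∀ x, ‖b x‖ ≤ C) (hd : Differentiable ℝ b)
    (htr : ∀ x, LinearMap.trace ℝ E (fderiv ℝ b x) = 0)
    (hper : ∀ l ∈ span ℤ (range B), ∀ x, b (x + l) = b x)
    {u : E → ℝ} {Ku Cu : ℝ≥0} (hu : LipschitzWith Ku u) (huC : ∀ x, ‖u x‖ ≤ Cu)
    (huper : ∀ l ∈ span ℤ (range B), ∀ x, u (x + l) = u x) {T : ℝ} (hT : 0 ≤ T) :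
    ∫ x in ZSpan.fundamentalDomain B, u (φ T x) ∂μ = ∫ x in ZSpan.fundamentalDomain B, u x ∂μ := by
  set D := ZSpan.fundamentalDomain B with hDdef
  have hDfin : μ D < ⊤ := (ZSpan.fundamentalDomain_isBounded B).measure_lt_top
  have hint : ∀ w : E → ℝ, Continuous w → ∀ c : ℝ, (∀ x, ‖w x‖ ≤ c) → IntegrableOn w D μ :=
    fun w hw c hc => Measure.integrableOn_of_bounded hDfin.ne hw.aestronglyMeasurable
      (ae_of_all _ hc)
  have hφc : ∀ t, 0 ≤ t → Continuous (φ t) := fun t ht =>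
    (LipschitzWith.of_dist_le_mul (K := Real.toNNReal (Real.exp (K * t))) fun x y => by
      rw [Real.coe_toNNReal _ (Real.exp_pos _).le, mul_comm]; exact hφ.dist_le hb ht x y).continuous
  set F : ℝ → ℝ := fun t => ∫ x in D, u (φ t x) ∂μ with hF
  have hFc : ContinuousOn F (Icc 0 T) := by
    refine LipschitzOnWith.continuousOn (K := Ku * C * (μ.real D).toNNReal) ?_
    refine LipschitzOnWith.of_dist_le_mul fun s hs t ht => ?_
    rw [Real.dist_eq, hF]
    simp only
    have is : IntegrableOn (fun x => u (φ s x)) D μ :=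
      hint _ (hu.continuous.comp (hφc s hs.1)) Cu fun x => huC _
    have it : IntegrableOn (fun x => u (φ t x)) D μ :=
      hint _ (hu.continuous.comp (hφc t ht.1)) Cu fun x => huC _
    rw [← integral_sub is it]
    have := norm_setIntegral_le_of_norm_le_const (C := Ku * (C * |s - t|))
      (f := fun x => u (φ s x) - u (φ t x)) hDfin fun x _ => ?_
    · rw [← Real.norm_eq_abs]
      refine this.trans_eq ?_
      push_cast
      rw [Real.coe_toNNReal _ measureReal_nonneg, Real.dist_eq]
      ring
    · rw [← dist_eq_norm]
      refine (hu.dist_le_mul _ _).trans ?_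
      gcongr
      rw [dist_eq_norm]
      exact hφ.norm_sub_le hC x ht.1 hs.1
  have hFd : ∀ t ∈ Ico 0 T, HasDerivWithinAt F 0 (Ici t) t := by
    intro t ht
    have ht0 : 0 ≤ t := ht.1
    -- The flow is never differentiated in space. By the semigroup property, `F s` integrates `w`
    -- composed with the flow over time `s - t`; replacing that flow by one Euler step costs second
    -- order.
    set w : E → ℝ := fun x => u (φ t x) with hw
    have hwlip : LipschitzWith (Ku * Real.toNNReal (Real.exp (K * t))) w :=
      hu.comp (LipschitzWith.of_dist_le_mul fun x y => by
        rw [Real.coe_toNNReal _ (Real.exp_pos _).le, mul_comm]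
        exact hφ.dist_le hb ht0 x y)
    set Kw := Ku * Real.toNNReal (Real.exp (K * t)) with hKw
    have hwper : ∀ l ∈ span ℤ (range B), ∀ x, w (x + l) = w x := fun l hl x => by
      simp only [hw, hφ.add_period hb (hper l hl) x ht0, huper l hl]
    have hwC : ∀ x, ‖w x‖ ≤ Cu := fun x => huC _
    -- distortion of volume under an Euler step
    have hdet : ∀ η : ℝ, 0 < η → ∀ᶠ h : ℝ in 𝓝 0, ∀ x,
        ‖1 - |(1 + h • fderiv ℝ b x).det|‖ ≤ η * |h| := by
      intro η hη
      have h1 := (det_one_add_isLittleO (E := E)).bound (c := η / (K + 1)) (by positivity)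
      obtain ⟨δ, hδ, h2⟩ := Metric.eventually_nhds_iff.1 h1
      have h3 : ∀ᶠ h : ℝ in 𝓝 0, |h| * (K + 1) < min δ (1 / (1 + η)) := by
        have hc : Continuous fun h : ℝ => |h| * ((K : ℝ) + 1) := by fun_prop
        have := hc.tendsto 0
        simp only [abs_zero, zero_mul] at this
        exact this.eventually_lt_const (by positivity)
      filter_upwards [h3] with h h4 x
      have h5 : ‖h • fderiv ℝ b x‖ ≤ |h| * K := by
        rw [norm_smul, Real.norm_eq_abs]
        gcongr
        exact norm_fderiv_le_of_lipschitz ℝ hb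
      have h5' : |h| * K ≤ |h| * (K + 1) := by gcongr; linarith
      have h6 := h2 (y := h • fderiv ℝ b x) (by
        rw [dist_zero_right]
        exact (h5.trans h5').trans_lt (h4.trans_le (min_le_left _ _)))
      have h7 : LinearMap.trace ℝ E ((h • fderiv ℝ b x : E →L[ℝ] E) : E →ₗ[ℝ] E) = 0 := by
        rw [ContinuousLinearMap.toLinearMap_smul, map_smul, htr, smul_zero]
      rw [h7, sub_zero, Real.norm_eq_abs] at h6
      have h8 : η / (K + 1) * ‖h • fderiv ℝ b x‖ ≤ η * |h| := by
        calc η / (K + 1) * ‖h • fderiv ℝ b x‖ ≤ η / (K + 1) * (|h| * (K + 1)) := by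
              gcongr; exact h5.trans h5'
          _ = η * |h| := by field_simp
      have h9 := h6.trans h8
      rw [Real.norm_eq_abs]
      have h10 : |1 - (1 + h • fderiv ℝ b x).det| ≤ η * |h| := by rwa [abs_sub_comm]
      -- The reverse triangle inequality handles the absolute value without deciding the sign of the
      -- determinant.
      have := abs_abs_sub_abs_le (1 : ℝ) (1 + h • fderiv ℝ b x).det
      rw [abs_one] at this
      exact this.trans h10
    rw [hasDerivWithinAt_iff_isLittleO, isLittleO_iff]
    intro c hc
    set m := μ.real D with hm
    have hm0 : 0 ≤ m := measureReal_nonneg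
    -- Half of the allowance `c` goes to the Jacobian and half to the Euler error; the `+ 1` keeps
    -- the denominator positive.
    have e1 := hdet (c / (2 * (Cu * m + 1))) (by positivity)
    have e2 : ∀ᶠ h : ℝ in 𝓝 0, Kw * (K * C) * |h| * m < c / 2 := by
      have hc' : Continuous fun h : ℝ => Kw * (K * C) * |h| * m := by fun_prop
      have := hc'.tendsto 0
      simp only [abs_zero, zero_mul, mul_zero] at this
      exact this.eventually_lt_const (by positivity)
    have e3 : ∀ᶠ h : ℝ in 𝓝 0, ‖h‖₊ * K < 1 := by
      have hc' : Continuous fun h : ℝ => ‖h‖₊ * K := by fun_prop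
      have := hc'.tendsto 0
      simp only [nnnorm_zero, zero_mul] at this
      exact this.eventually_lt_const one_pos
    have e4 := (e1.and (e2.and e3))
    have e5 : Tendsto (fun s : ℝ => s - t) (𝓝[Ici t] t) (𝓝 0) := by
      have : Tendsto (fun s : ℝ => s - t) (𝓝 t) (𝓝 (t - t)) := by
        exact (continuous_id.sub continuous_const).tendsto t
      rw [sub_self] at this
      exact this.mono_left nhdsWithin_le_nhds
    filter_upwards [e5.eventually e4, self_mem_nhdsWithin] with s hs hst
    obtain ⟨h1, h2, h3⟩ := hs
    have hst : t ≤ s := hst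
    set h := s - t with hh
    have hh0 : 0 ≤ h := by rw [hh]; linarith
    rw [smul_zero, sub_zero]
    have hFs : F s = ∫ x in D, w (φ h x) ∂μ := by
      simp only [hF, hw]
      congr 1 with x
      rw [← hφ.add hb x hh0 ht0]
      congr 2
      rw [hh]; ring
    -- Rewriting `F t` by the change of variables lets both integrals be compared pointwise, at `φ h
    -- x` and at the Euler point.
    have hFt : F t = ∫ x in D, |(1 + h • fderiv ℝ b x).det| • w (x + h • b x) ∂μ :=
      (setIntegral_det_mul_comp_id_add_smul μ B hb hd hper h3 hwper).symm
    have hEc : Continuous fun x => x + h • b x := continuous_id.add (hb.continuous.const_smul h)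
    have i1 : IntegrableOn (fun x => w (φ h x)) D μ :=
      hint _ (hwlip.continuous.comp (hφc h hh0)) Cu fun x => hwC _
    have i2 : IntegrableOn (fun x => w (x + h • b x)) D μ :=
      hint _ (hwlip.continuous.comp hEc) Cu fun x => hwC _
    have hmeas : Measurable fun x => |(1 + h • fderiv ℝ b x).det| := by
      have h1 : Measurable fun x => 1 + h • fderiv ℝ b x :=
        ((measurable_fderiv ℝ b).const_smul h).const_add 1
      exact (ContinuousLinearMap.continuous_det.measurable.comp h1).abs
    have i3 : IntegrableOn (fun x => (1 - |(1 + h • fderiv ℝ b x).det|) * w (x + h • b x)) D μ := by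
      refine i2.bdd_mul (c := c / (2 * (Cu * m + 1)) * |h|)
        (measurable_const.sub hmeas).aestronglyMeasurable (ae_of_all _ h1)
    have i4 : IntegrableOn (fun x => |(1 + h • fderiv ℝ b x).det| • w (x + h • b x)) D μ := by
      refine (i2.sub i3).congr (ae_of_all _ fun x => ?_)
      simp only [Pi.sub_apply, smul_eq_mul]; ring
    have hsplit : F s - F t = ∫ x in D, ((w (φ h x) - w (x + h • b x)) +
        (1 - |(1 + h • fderiv ℝ b x).det|) * w (x + h • b x)) ∂μ := by
      rw [hFs, hFt, ← integral_sub i1 i4]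
      congr 1 with x
      simp only [smul_eq_mul]; ring
    rw [hsplit]
    have hbd := norm_setIntegral_le_of_norm_le_const (μ := μ)
      (C := Kw * (K * C * h ^ 2) + c / (2 * (Cu * m + 1)) * |h| * Cu)
      (f := fun x => (w (φ h x) - w (x + h • b x)) +
        (1 - |(1 + h • fderiv ℝ b x).det|) * w (x + h • b x)) hDfin fun x _ => by
        refine (norm_add_le _ _).trans (add_le_add ?_ ?_)
        · rw [← dist_eq_norm]
          refine (hwlip.dist_le_mul _ _).trans ?_
          gcongr
          rw [dist_eq_norm]
          exact hφ.norm_sub_euler_le hb hC x hh0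
        · rw [norm_mul]
          exact mul_le_mul (h1 x) (hwC _) (norm_nonneg _) (by positivity)
    refine hbd.trans ?_
    rw [← hm, Real.norm_eq_abs, ← sq_abs h]
    have f1 : Kw * (K * C * |h| ^ 2) * m ≤ c / 2 * |h| := by
      calc Kw * (K * C * |h| ^ 2) * m = Kw * (K * C) * |h| * m * |h| := by ring
        _ ≤ _ := by gcongr
    have f2 : c / (2 * (Cu * m + 1)) * |h| * Cu * m ≤ c / 2 * |h| := by
      have : c / (2 * (Cu * m + 1)) * |h| * Cu * m = c / 2 * |h| * (Cu * m / (Cu * m + 1)) := by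
        field_simp
      rw [this]
      refine mul_le_of_le_one_right (by positivity) ?_
      rw [div_le_one (by positivity)]
      linarith
    linarith
  have := constant_of_has_deriv_right_zero hFc hFd T ⟨hT, le_rfl⟩
  rw [hF] at this
  simp only [hφ.zero] at this
  exact this

end Liouville

/-! ### Smooth truncation of the Green function -/

section Truncation

/-- A smooth, nondecreasing, concave function equal to `r` for `r ≤ 0` and constant for `r ≥ 1`. -/
def softMin (r : ℝ) : ℝ := ∫ u in (0 : ℝ)..r, Real.smoothTransition (1 - u)

theorem continuous_smoothTransition_one_sub :
    Continuous fun u : ℝ => Real.smoothTransition (1 - u) :=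
  Real.smoothTransition.continuous.comp (continuous_const.sub continuous_id)

theorem hasDerivAt_softMin (r : ℝ) : HasDerivAt softMin (Real.smoothTransition (1 - r)) r :=
  intervalIntegral.integral_hasDerivAt_right
    (continuous_smoothTransition_one_sub.intervalIntegrable _ _)
    (continuous_smoothTransition_one_sub.stronglyMeasurableAtFilter _ _)
    continuous_smoothTransition_one_sub.continuousAt

theorem contDiff_softMin : ContDiff ℝ 2 softMin := by
  have h : ContDiff ℝ ((1 : ℕ∞) + 1) softMin := by
    refine contDiff_succ_iff_deriv.2 ⟨fun r => (hasDerivAt_softMin r).differentiableAt, by simp, ?_⟩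
    have : deriv softMin = fun r => Real.smoothTransition (1 - r) :=
      funext fun r => (hasDerivAt_softMin r).deriv
    rw [this]
    exact Real.smoothTransition.contDiff.comp (contDiff_const.sub contDiff_id)
  exact h.of_le (by norm_num [one_add_one_eq_two])

theorem softMin_of_nonpos {r : ℝ} (hr : r ≤ 0) : softMin r = r := by
  have h : ∫ u in (0 : ℝ)..r, Real.smoothTransition (1 - u) = ∫ _ in (0 : ℝ)..r, (1 : ℝ) := by
    refine intervalIntegral.integral_congr fun u hu => ?_
    rw [uIcc_of_ge hr] at hu
    exact Real.smoothTransition.one_of_one_le (by linarith [hu.2])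
  rw [softMin, h]; simp

theorem softMin_of_one_le {r : ℝ} (hr : 1 ≤ r) : softMin r = softMin 1 := by
  have h : ∫ u in (1 : ℝ)..r, Real.smoothTransition (1 - u) = 0 := by
    rw [← intervalIntegral.integral_zero (a := (1 : ℝ)) (b := r) (μ := volume)]
    refine intervalIntegral.integral_congr fun u hu => ?_
    rw [uIcc_of_le hr] at hu
    exact Real.smoothTransition.zero_of_nonpos (by linarith [hu.1])
  have h1 := intervalIntegral.integral_add_adjacent_intervals (μ := volume)
    (continuous_smoothTransition_one_sub.intervalIntegrable 0 1)
    (continuous_smoothTransition_one_sub.intervalIntegrable 1 r)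
  rw [softMin, softMin, ← h1, h, add_zero]

theorem monotone_softMin : Monotone softMin :=
  monotone_of_deriv_nonneg (fun r => (hasDerivAt_softMin r).differentiableAt) fun r => by
    rw [(hasDerivAt_softMin r).deriv]; exact Real.smoothTransition.nonneg _

theorem softMin_nonneg {r : ℝ} (hr : 0 ≤ r) : 0 ≤ softMin r := by
  have := monotone_softMin hr
  rwa [softMin_of_nonpos le_rfl] at this

theorem softMin_le (r : ℝ) : softMin r ≤ r := by
  have h : Antitone fun r => softMin r - r :=
    antitone_of_deriv_nonpos
      (fun r => ((hasDerivAt_softMin r).differentiableAt.sub differentiableAt_id)) fun r => by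
        rw [((hasDerivAt_softMin r).fun_sub (hasDerivAt_id' r)).deriv]
        linarith [Real.smoothTransition.le_one (1 - r)]
  rcases le_total r 0 with hr | hr
  · rw [softMin_of_nonpos hr]
  · have := h hr
    simp only [softMin_of_nonpos le_rfl] at this
    linarith

/-- Covering map `ℝ² → 𝕋²`. -/
def toTorus (y : Fin 2 → ℝ) : Torus := fun i => (y i : UnitAddCircle)

theorem continuous_toTorus : Continuous toTorus :=
  continuous_pi fun i => (AddCircle.continuous_mk' 1).comp (continuous_apply i)

theorem toTorus_sub (y z : Fin 2 → ℝ) : toTorus (y - z) = toTorus y - toTorus z := rfl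

theorem toTorus_add (y z : Fin 2 → ℝ) : toTorus (y + z) = toTorus y + toTorus z := rfl

theorem toTorus_neg (y : Fin 2 → ℝ) : toTorus (-y) = -toTorus y := rfl

theorem toTorus_zero : toTorus 0 = 0 := rfl

theorem toTorus_intCast (l : Fin 2 → ℤ) : toTorus (fun i => (l i : ℝ)) = 0 := by
  funext i
  exact (AddCircle.coe_eq_zero_iff (1 : ℝ)).2 ⟨l i, by simp⟩

theorem toTorus_eq_iff {y z : Fin 2 → ℝ} :
    toTorus y = toTorus z ↔ ∃ l : Fin 2 → ℤ, y = z + fun i => (l i : ℝ) := by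
  constructor
  · intro h
    have h1 : ∀ i, ∃ n : ℤ, (n : ℝ) = y i - z i := fun i => by
      have h2 : ((y i - z i : ℝ) : UnitAddCircle) = 0 := by
        have := congrFun h i
        simp only [toTorus] at this
        rw [AddCircle.coe_sub, this, sub_self]
      obtain ⟨n, hn⟩ := (AddCircle.coe_eq_zero_iff (1 : ℝ)).1 h2
      exact ⟨n, by simpa using hn⟩
    choose l hl using h1
    exact ⟨l, funext fun i => by simp [hl]⟩
  · rintro ⟨l, rfl⟩
    rw [toTorus_add, toTorus_intCast, add_zero]

theorem toTorus_surjective : Function.Surjective toTorus := fun x => by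
  choose y hy using fun i => QuotientAddGroup.mk_surjective (x i)
  exact ⟨y, funext hy⟩

theorem partialDeriv_toTorus {G : Torus → ℝ} {y : Fin 2 → ℝ}
    (hG : DifferentiableAt ℝ (fun z => G (toTorus z)) y) (i : Fin 2) :
    partialDeriv G i (toTorus y) = fderiv ℝ (fun z => G (toTorus z)) y (Pi.single i 1) := by
  have h1 : HasDerivAt (fun h : ℝ => y + Pi.single i h) (Pi.single i 1) 0 := by
    have : (fun h : ℝ => y + Pi.single i h) = fun h : ℝ => y + h • Pi.single i (1 : ℝ) := by
      funext h
      rw [← Pi.single_smul]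
      simp
    rw [this]
    simpa using ((hasDerivAt_id (0 : ℝ)).smul_const (Pi.single i (1 : ℝ))).const_add y
  have h2 := HasFDerivAt.comp_hasDerivAt (0 : ℝ)
    (f := fun h : ℝ => y + Pi.single i h) (by simpa using hG.hasFDerivAt) h1
  rw [partialDeriv, ← h2.deriv]
  congr 1
  funext h
  simp only [Function.comp]
  congr 1
  funext j
  by_cases hj : j = i
  · subst hj; simp [toTorus]
  · simp [toTorus, hj]

/-- The properties of the Green function used in the study of the vortex dynamics. -/
structure IsGreenLike (G : Torus → ℝ) : Prop where
  contDiffAt : ∀ y, toTorus y ≠ 0 → ContDiffAt ℝ 2 (fun z => G (toTorus z)) y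
  even : ∀ x, G (-x) = G x
  tendsto : Tendsto G (𝓝[≠] 0) atTop
  bddBelow : ∃ C, ∀ x, -C ≤ G x
  integrable : Integrable G
  integrable_deriv : ∀ i, Integrable (partialDeriv G i)

open Classical in
/-- The function `G` smoothly cut off at the level `M`. -/
def truncate (G : Torus → ℝ) (M : ℝ) (x : Torus) : ℝ :=
  if x = 0 then M + softMin 1 else M + softMin (G x - M)

variable {G : Torus → ℝ} {M : ℝ}

theorem truncate_zero : truncate G M 0 = M + softMin 1 := if_pos rfl

theorem truncate_of_ne {x : Torus} (hx : x ≠ 0) : truncate G M x = M + softMin (G x - M) :=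
  if_neg hx

/-- The cutoff alters `G` only where `G > M`, and there its value is at least `M`. The truncated
function thus detects by itself where it is faithful. -/
theorem truncate_eq_of_lt {x : Torus} (h : truncate G M x < M) : x ≠ 0 ∧ truncate G M x = G x := by
  have hx : x ≠ 0 := by
    rintro rfl
    rw [truncate_zero] at h
    linarith [softMin_nonneg zero_le_one]
  refine ⟨hx, ?_⟩
  rw [truncate_of_ne hx] at h ⊢
  rcases le_total (G x - M) 0 with h1 | h1
  · rw [softMin_of_nonpos h1]; ring
  · linarith [softMin_nonneg h1]

theorem truncate_le {x : Torus} (hx : x ≠ 0) : truncate G M x ≤ G x := by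
  rw [truncate_of_ne hx]; linarith [softMin_le (G x - M)]

theorem le_truncate {x : Torus} {C : ℝ} (hG : -C ≤ G x) (hM : -C ≤ M) : -C ≤ truncate G M x := by
  by_cases hx : x = 0
  · rw [hx, truncate_zero]; linarith [softMin_nonneg zero_le_one]
  · rw [truncate_of_ne hx]
    rcases le_total (G x - M) 0 with h1 | h1
    · rw [softMin_of_nonpos h1]; linarith
    · linarith [softMin_nonneg h1]

theorem IsGreenLike.truncate_even (hG : IsGreenLike G) (x : Torus) :
    truncate G M (-x) = truncate G M x := by
  simp only [truncate, neg_eq_zero, hG.even]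

/-- Since `G → ∞` at the origin, the cutoff saturates nearby; the value prescribed at 0 is this
constant, so the singularity and the arbitrary value `G 0` both disappear. -/
theorem IsGreenLike.truncate_eventuallyEq (hG : IsGreenLike G) :
    ∀ᶠ x in 𝓝 (0 : Torus), truncate G M x = M + softMin 1 := by
  have h := hG.tendsto.eventually_ge_atTop (M + 1)
  rw [eventually_nhdsWithin_iff] at h
  filter_upwards [h] with x hx
  by_cases h0 : x = 0
  · rw [h0, truncate_zero]
  · rw [truncate_of_ne h0, softMin_of_one_le (by linarith [hx h0])]

theorem IsGreenLike.contDiff_truncate (hG : IsGreenLike G) :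
    ContDiff ℝ 2 fun z => truncate G M (toTorus z) := by
  refine contDiff_iff_contDiffAt.2 fun y => ?_
  by_cases hy : toTorus y = 0
  · have h1 : Tendsto toTorus (𝓝 y) (𝓝 0) := hy ▸ continuous_toTorus.tendsto y
    exact contDiffAt_const.congr_of_eventuallyEq (h1.eventually hG.truncate_eventuallyEq)
  · have h1 : ∀ᶠ z in 𝓝 y, toTorus z ≠ 0 :=
      continuous_toTorus.continuousAt.eventually_ne hy
    have h2 : ContDiffAt ℝ 2 (fun z => M + softMin (G (toTorus z) - M)) y :=
      contDiffAt_const.add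
        (contDiff_softMin.contDiffAt.comp y ((hG.contDiffAt y hy).sub contDiffAt_const))
    refine h2.congr_of_eventuallyEq ?_
    filter_upwards [h1] with z hz
    rw [truncate_of_ne hz]

/-- The chain rule multiplies the gradient by the derivative of `softMin`, which lies in `[0, 1]`.
This makes the later estimates uniform in `M`. -/
theorem IsGreenLike.abs_partialDeriv_truncate_le (hG : IsGreenLike G) (i : Fin 2) (x : Torus) :
    |partialDeriv (truncate G M) i x| ≤ |partialDeriv G i x| := by
  obtain ⟨y, rfl⟩ := toTorus_surjective x
  rw [partialDeriv_toTorus (hG.contDiff_truncate.differentiable (by norm_num) y)]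
  by_cases hy : toTorus y = 0
  · have h1 : Tendsto toTorus (𝓝 y) (𝓝 0) := hy ▸ continuous_toTorus.tendsto y
    have h2 : (fun z => truncate G M (toTorus z)) =ᶠ[𝓝 y] fun _ => M + softMin 1 :=
      h1.eventually hG.truncate_eventuallyEq
    rw [h2.fderiv_eq]
    simp
  · have hd := (hG.contDiffAt y hy).differentiableAt (by norm_num)
    rw [partialDeriv_toTorus hd]
    have h1 : ∀ᶠ z in 𝓝 y, toTorus z ≠ 0 :=
      continuous_toTorus.continuousAt.eventually_ne hy
    have h2 : (fun z => truncate G M (toTorus z)) =ᶠ[𝓝 y]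
        fun z => M + softMin (G (toTorus z) - M) := by
      filter_upwards [h1] with z hz
      rw [truncate_of_ne hz]
    have h3 : HasFDerivAt (fun z => M + softMin (G (toTorus z) - M))
        (Real.smoothTransition (1 - (G (toTorus y) - M)) •
          fderiv ℝ (fun z => G (toTorus z)) y) y :=
      ((hasDerivAt_softMin _).comp_hasFDerivAt y (hd.hasFDerivAt.sub_const M)).const_add M
    rw [h2.fderiv_eq, h3.fderiv, _root_.smul_apply, smul_eq_mul, abs_mul,
      abs_of_nonneg (Real.smoothTransition.nonneg _)]
    exact mul_le_of_le_one_left (abs_nonneg _) (Real.smoothTransition.le_one _)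

end Truncation

/-! ### The lifted vortex field: Lipschitz bound, periodicity, zero divergence -/

section Field

theorem toTorus_add_intCast (y : Fin 2 → ℝ) (l : Fin 2 → ℤ) :
    toTorus (y + fun i => (l i : ℝ)) = toTorus y := by
  rw [toTorus_add, toTorus_intCast, add_zero]

theorem exists_mem_Icc_add_intCast (y : Fin 2 → ℝ) :
    ∃ l : Fin 2 → ℤ, (y + fun i => (l i : ℝ)) ∈ Icc (0 : Fin 2 → ℝ) 1 := by
  refine ⟨fun i => -⌊y i⌋, fun i => ?_, fun i => ?_⟩
  · have := Int.floor_le (y i)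
    simp only [Pi.zero_apply, Pi.add_apply, Int.cast_neg]; linarith
  · have := Int.lt_floor_add_one (y i)
    simp only [Pi.one_apply, Pi.add_apply, Int.cast_neg]; linarith

theorem exists_bound_of_periodic {W : Type*} [NormedAddCommGroup W] {f : (Fin 2 → ℝ) → W}
    (hf : Continuous f) (hper : ∀ y (l : Fin 2 → ℤ), f (y + fun i => (l i : ℝ)) = f y) :
    ∃ C : ℝ≥0, ∀ y, ‖f y‖ ≤ C := by
  obtain ⟨C, hC⟩ := (isCompact_Icc (a := (0 : Fin 2 → ℝ)) (b := 1)).exists_bound_of_continuousOn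
    hf.continuousOn
  refine ⟨C.toNNReal, fun y => ?_⟩
  obtain ⟨l, hl⟩ := exists_mem_Icc_add_intCast y
  rw [← hper y l]
  exact (hC _ hl).trans (Real.le_coe_toNNReal C)

theorem exists_lipschitz_of_periodic {W : Type*} [NormedAddCommGroup W] [NormedSpace ℝ W]
    {f : (Fin 2 → ℝ) → W} (hf : ContDiff ℝ 1 f)
    (hper : ∀ y (l : Fin 2 → ℤ), f (y + fun i => (l i : ℝ)) = f y) :
    ∃ K : ℝ≥0, LipschitzWith K f := by
  obtain ⟨K, hK⟩ := exists_bound_of_periodic (hf.continuous_fderiv (by norm_num)) fun y l => by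
    rw [← fderiv_comp_add_right]
    congr 1
    funext z
    exact hper z l
  exact ⟨K, lipschitzWith_of_nnnorm_fderiv_le (hf.differentiable (by norm_num)) hK⟩

/-- The rotated gradient `∇^⊥ Γ`. -/
def perpGrad (Γ : Torus → ℝ) (x : Torus) : Fin 2 → ℝ :=
  ![-partialDeriv Γ 1 x, partialDeriv Γ 0 x]

variable {Γ : Torus → ℝ}

theorem partialDeriv_neg (he : ∀ x, Γ (-x) = Γ x) (i : Fin 2) (x : Torus) :
    partialDeriv Γ i (-x) = -partialDeriv Γ i x := by
  have h : (fun h : ℝ => Γ (-x + Pi.single i (h : UnitAddCircle))) =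
      fun h : ℝ => (fun h : ℝ => Γ (x + Pi.single i (h : UnitAddCircle))) (-h) := by
    funext h
    rw [← he, neg_add, neg_neg, ← Pi.single_neg]
    rfl
  rw [partialDeriv, h]
  refine (deriv_comp_neg (f := fun h : ℝ => Γ (x + Pi.single i (h : UnitAddCircle))) 0).trans ?_
  rw [neg_zero]
  rfl

theorem perpGrad_neg (he : ∀ x, Γ (-x) = Γ x) (x : Torus) :
    perpGrad Γ (-x) = -perpGrad Γ x := by
  funext k
  fin_cases k <;> simp [perpGrad, partialDeriv_neg he]

/-- An odd field vanishes at 0, which makes the self-interaction term agree with the convention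
`K(0) = 0`. -/
theorem perpGrad_zero (he : ∀ x, Γ (-x) = Γ x) : perpGrad Γ 0 = 0 := by
  have h := perpGrad_neg he 0
  rw [neg_zero] at h
  exact self_eq_neg.1 h

theorem partialDeriv_toTorus' (hΓ : ContDiff ℝ 2 fun z => Γ (toTorus z))
    (i : Fin 2) (y : Fin 2 → ℝ) :
    partialDeriv Γ i (toTorus y) = fderiv ℝ (fun z => Γ (toTorus z)) y (Pi.single i 1) :=
  partialDeriv_toTorus (hΓ.differentiable (by norm_num) y) i

theorem contDiff_partialDeriv (hΓ : ContDiff ℝ 2 fun z => Γ (toTorus z))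
    (i : Fin 2) :
    ContDiff ℝ 1 fun z => partialDeriv Γ i (toTorus z) := by
  simp only [partialDeriv_toTorus' hΓ]
  exact (hΓ.fderiv_right (by norm_num [one_add_one_eq_two])).clm_apply contDiff_const

theorem contDiff_perpGrad (hΓ : ContDiff ℝ 2 fun z => Γ (toTorus z)) :
    ContDiff ℝ 1 fun z => perpGrad Γ (toTorus z) := by
  refine contDiff_pi.2 fun k => ?_
  fin_cases k
  · exact (contDiff_partialDeriv hΓ 1).neg
  · exact contDiff_partialDeriv hΓ 0

/-- The two second derivatives cancel by symmetry of the Hessian. -/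
theorem div_perpGrad (hΓ : ContDiff ℝ 2 fun z => Γ (toTorus z))
    (y : Fin 2 → ℝ) :
    ∑ k, fderiv ℝ (fun z => perpGrad Γ (toTorus z)) y (Pi.single k 1) k = 0 := by
  have hs : IsSymmSndFDerivAt ℝ (fun z => Γ (toTorus z)) y :=
    hΓ.contDiffAt.isSymmSndFDerivAt (by simp)
  have hd : DifferentiableAt ℝ (fun z => perpGrad Γ (toTorus z)) y :=
    (contDiff_perpGrad hΓ).differentiable (by norm_num) y
  have h1 : ∀ k v, fderiv ℝ (fun z => perpGrad Γ (toTorus z)) y v k =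
      fderiv ℝ (fun z => perpGrad Γ (toTorus z) k) y v := fun k v => by
    rw [fderiv_apply hd k]; rfl
  have hdd : DifferentiableAt ℝ (fderiv ℝ fun z => Γ (toTorus z)) y :=
    (hΓ.fderiv_right (m := 1) (by norm_num [one_add_one_eq_two])).differentiable (by norm_num) y
  have h2 : ∀ i v, fderiv ℝ (fun z => partialDeriv Γ i (toTorus z)) y v =
      fderiv ℝ (fderiv ℝ fun z => Γ (toTorus z)) y v (Pi.single i 1) := fun i v => by
    simp only [partialDeriv_toTorus' hΓ]
    rw [fderiv_clm_apply hdd (differentiableAt_const _)]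
    simp
  rw [Fin.sum_univ_two, h1, h1]
  have e0 : (fun z => perpGrad Γ (toTorus z) 0) = fun z => -partialDeriv Γ 1 (toTorus z) := rfl
  have e1 : (fun z => perpGrad Γ (toTorus z) 1) = fun z => partialDeriv Γ 0 (toTorus z) := rfl
  rw [e0, e1, fderiv_fun_neg, _root_.neg_apply, h2, h2, hs.eq]
  ring

/-- The velocity field of the vortex system with interaction `∇^⊥ Γ`, on the covering space. -/
def vortexField {N : ℕ} (c : ℝ) (ξ : Fin N → ℝ) (Γ : Torus → ℝ) (x : Fin N → Fin 2 → ℝ) :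
    Fin N → Fin 2 → ℝ :=
  fun i => c • ∑ j, ξ j • perpGrad Γ (toTorus (x i) - toTorus (x j))

variable {N : ℕ}

theorem exists_lipschitz_vortexField (hΓ : ContDiff ℝ 2 fun z => Γ (toTorus z))
    (c : ℝ) (ξ : Fin N → ℝ) : ∃ K : ℝ≥0, LipschitzWith K (vortexField c ξ Γ) := by
  obtain ⟨K, hK⟩ := exists_lipschitz_of_periodic (contDiff_perpGrad hΓ) fun y l => by
    rw [toTorus_add_intCast]
  have h0 : 0 ≤ |c| * ∑ j, |ξ j| * (K * 2) := by positivity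
  refine ⟨⟨_, h0⟩, LipschitzWith.of_dist_le_mul fun x y => ?_⟩
  have hC : 0 ≤ (|c| * ∑ j, |ξ j| * (K * 2)) * dist x y := by positivity
  refine (dist_pi_le_iff hC).2 fun i => ?_
  simp only [vortexField, ← toTorus_sub]
  rw [dist_eq_norm, ← smul_sub, ← Finset.sum_sub_distrib, norm_smul, Real.norm_eq_abs, mul_assoc,
    Finset.sum_mul]
  gcongr
  refine norm_sum_le_of_le _ fun j _ => ?_
  rw [← smul_sub, norm_smul, Real.norm_eq_abs, mul_assoc]
  gcongr
  rw [← dist_eq_norm]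
  refine (hK.dist_le_mul _ _).trans ?_
  rw [mul_assoc]
  gcongr
  refine (dist_sub_sub_le _ _ _ _).trans ?_
  linarith [dist_le_pi_dist x y i, dist_le_pi_dist x y j]

theorem exists_bound_vortexField (hΓ : ContDiff ℝ 2 fun z => Γ (toTorus z))
    (c : ℝ) (ξ : Fin N → ℝ) : ∃ C : ℝ≥0, ∀ x, ‖vortexField c ξ Γ x‖ ≤ C := by
  obtain ⟨C, hC⟩ := exists_bound_of_periodic (contDiff_perpGrad hΓ).continuous fun y l => by
    rw [toTorus_add_intCast]
  have h0 : 0 ≤ |c| * ∑ j, |ξ j| * C := by positivity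
  refine ⟨⟨_, h0⟩, fun x => (pi_norm_le_iff_of_nonneg h0).2 fun i => ?_⟩
  simp only [vortexField, ← toTorus_sub]
  rw [norm_smul, Real.norm_eq_abs]
  gcongr
  refine norm_sum_le_of_le _ fun j _ => ?_
  rw [norm_smul, Real.norm_eq_abs]
  gcongr
  exact hC _

theorem hasFDerivAt_vortexField (hΓ : ContDiff ℝ 2 fun z => Γ (toTorus z))
    (c : ℝ) (ξ : Fin N → ℝ) (x : Fin N → Fin 2 → ℝ) :
    HasFDerivAt (vortexField c ξ Γ) (ContinuousLinearMap.pi fun i => c • ∑ j, ξ j •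
      (fderiv ℝ (fun z => perpGrad Γ (toTorus z)) (x i - x j)).comp
        (ContinuousLinearMap.proj (R := ℝ) (φ := fun _ : Fin N => Fin 2 → ℝ) i -
          ContinuousLinearMap.proj (R := ℝ) (φ := fun _ : Fin N => Fin 2 → ℝ) j)) x := by
  refine hasFDerivAt_pi.2 fun i => ?_
  simp only [vortexField, ← toTorus_sub]
  refine (HasFDerivAt.fun_sum fun j _ => ?_).const_smul c
  refine HasFDerivAt.const_smul ?_ (ξ j)
  have h1 := ((contDiff_perpGrad hΓ).differentiable (by norm_num) (x i - x j)).hasFDerivAt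
  exact h1.comp x (f := fun x : Fin N → Fin 2 → ℝ => x i - x j)
    ((hasFDerivAt_apply i x).sub (hasFDerivAt_apply j x))

/-- The standard basis of `(ℝ²)^N`. -/
def stdBasis (N : ℕ) : Module.Basis (Σ _ : Fin N, Fin 2) ℝ (Fin N → Fin 2 → ℝ) :=
  Pi.basis fun _ => Pi.basisFun ℝ (Fin 2)

/-- Only the diagonal blocks enter the trace. In the block of vortex `i`, each `j ≠ i` contributes a
multiple of the divergence of `∇^⊥Γ`, and `j = i` contributes nothing because `x i - x i` is
constant. -/
theorem trace_fderiv_vortexField (hΓ : ContDiff ℝ 2 fun z => Γ (toTorus z))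
    (c : ℝ) (ξ : Fin N → ℝ) (x : Fin N → Fin 2 → ℝ) :
    LinearMap.trace ℝ (Fin N → Fin 2 → ℝ) (fderiv ℝ (vortexField c ξ Γ) x) = 0 := by
  classical
  rw [LinearMap.trace_eq_matrix_trace ℝ (stdBasis N), (hasFDerivAt_vortexField hΓ c ξ x).fderiv,
    Matrix.trace, Fintype.sum_sigma]
  refine Finset.sum_eq_zero fun i _ => ?_
  have h : ∀ k : Fin 2, Matrix.diag (LinearMap.toMatrix (stdBasis N) (stdBasis N)
      ((ContinuousLinearMap.pi fun i => c • ∑ j, ξ j •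
      (fderiv ℝ (fun z => perpGrad Γ (toTorus z)) (x i - x j)).comp
        (ContinuousLinearMap.proj (R := ℝ) (φ := fun _ : Fin N => Fin 2 → ℝ) i -
          ContinuousLinearMap.proj (R := ℝ) (φ := fun _ : Fin N => Fin 2 → ℝ) j) :
          (Fin N → Fin 2 → ℝ) →L[ℝ] (Fin N → Fin 2 → ℝ)) : _ →ₗ[ℝ] _)) ⟨i, k⟩ =
      c * ∑ j, ξ j * if j = i then 0 else
        fderiv ℝ (fun z => perpGrad Γ (toTorus z)) (x i - x j) (Pi.single k 1) k := by
    intro k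
    rw [Matrix.diag, LinearMap.toMatrix_apply]
    simp only [stdBasis, Pi.basis_repr, Pi.basis_apply, Pi.basisFun_apply, Pi.basisFun_repr,
      ContinuousLinearMap.coe_coe, ContinuousLinearMap.coe_pi', _root_.smul_apply,
      _root_.sum_apply, Pi.smul_apply, Finset.sum_apply, smul_eq_mul]
    congr 1
    refine Finset.sum_congr rfl fun j _ => ?_
    congr 1
    simp only [ContinuousLinearMap.comp_apply, _root_.sub_apply, ContinuousLinearMap.proj_apply]
    split_ifs with hj
    · rw [hj, sub_self, sub_self, map_zero]; rfl
    · rw [Pi.single_eq_same, Pi.single_eq_of_ne hj, sub_zero]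
  simp only [h]
  rw [← Finset.mul_sum, Finset.sum_comm]
  have h2 : ∀ j, ∑ k : Fin 2, ξ j * (if j = i then 0 else
        fderiv ℝ (fun z => perpGrad Γ (toTorus z)) (x i - x j) (Pi.single k 1) k) = 0 := by
    intro j
    rw [← Finset.mul_sum]
    split_ifs with hj
    · simp
    · rw [div_perpGrad hΓ, mul_zero]
  rw [Finset.sum_eq_zero fun j _ => h2 j, mul_zero]

/-- Covering map `(ℝ²)^N → (𝕋²)^N`. -/
def toTorusPi (x : Fin N → Fin 2 → ℝ) : Fin N → Torus := fun i => toTorus (x i)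

theorem toTorusPi_add_of_mem_span (x : Fin N → Fin 2 → ℝ) {l : Fin N → Fin 2 → ℝ}
    (hl : l ∈ Submodule.span ℤ (range (stdBasis N))) : toTorusPi (x + l) = toTorusPi x := by
  rw [Module.Basis.mem_span_iff_repr_mem] at hl
  choose n hn using hl
  funext i
  have : (x + l) i = x i + fun k => ((n ⟨i, k⟩ : ℤ) : ℝ) := by
    funext k
    have := hn ⟨i, k⟩
    simp only [stdBasis, Pi.basis_repr, Pi.basisFun_repr] at this
    simp only [Pi.add_apply, ← this]
    simp
  simp only [toTorusPi, this, toTorus_add_intCast]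

end Field

/-! ### Lebesgue measure on the torus and independence of differences -/

section TorusMeasure

instance : IsProbabilityMeasure (volume : Measure UnitAddCircle) := ⟨UnitAddCircle.measure_univ⟩

instance : (volume : Measure Torus).IsAddHaarMeasure :=
  inferInstanceAs ((volume : Measure (Fin 2 → UnitAddCircle)).IsAddHaarMeasure)

instance : IsProbabilityMeasure (volume : Measure Torus) :=
  inferInstanceAs (IsProbabilityMeasure (volume : Measure (Fin 2 → UnitAddCircle)))

instance : SecondCountableTopology Torus :=
  inferInstanceAs (SecondCountableTopology (∀ _ : Fin 2, UnitAddCircle))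

instance (N : ℕ) : BorelSpace (Fin N → Torus) :=
  inferInstanceAs (BorelSpace (∀ _ : Fin N, Torus))

instance (N : ℕ) : IsProbabilityMeasure (volume : Measure (Fin N → Torus)) :=
  inferInstance

instance (N : ℕ) : (volume : Measure (Fin N → Torus)).IsAddHaarMeasure :=
  Measure.pi.isAddHaarMeasure (fun _ : Fin N => (volume : Measure Torus))

theorem measurePreserving_toTorus :
    MeasurePreserving toTorus (volume.restrict (univ.pi fun _ : Fin 2 => Ico (0 : ℝ) 1)) volume := by
  rw [volume_pi, Measure.restrict_pi_pi]
  have h : MeasurePreserving ((↑) : ℝ → UnitAddCircle) (volume.restrict (Ico (0 : ℝ) 1)) volume := by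
    have := UnitAddCircle.measurePreserving_mk 0
    rwa [zero_add, ← Measure.restrict_congr_set Ico_ae_eq_Ioc] at this
  exact measurePreserving_pi _ _ fun _ => h

/-- Pulled back to the unit square, the point 0 becomes part of a countable lattice. -/
theorem ae_ne_zero : ∀ᵐ x : Torus, x ≠ 0 := by
  have h := measurePreserving_toTorus.map_eq
  rw [← h]
  refine (ae_map_iff measurePreserving_toTorus.aemeasurable
    (measurableSet_singleton (0 : Torus)).compl).2 ?_
  refine ae_restrict_of_ae ?_
  have hc : {y : Fin 2 → ℝ | toTorus y = 0} ⊆ range fun l : Fin 2 → ℤ => fun i => (l i : ℝ) := by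
    intro y hy
    obtain ⟨l, hl⟩ := toTorus_eq_iff.1 ((show toTorus y = 0 from hy).trans toTorus_zero.symm)
    exact ⟨l, by rw [hl, zero_add]⟩
  have := ((countable_range _).mono hc).ae_notMem (volume : Measure (Fin 2 → ℝ))
  exact this

theorem fundamentalDomain_stdBasis (N : ℕ) : ZSpan.fundamentalDomain (stdBasis N) =
    univ.pi fun _ : Fin N => univ.pi fun _ : Fin 2 => Ico (0 : ℝ) 1 := by
  ext x
  simp only [ZSpan.mem_fundamentalDomain, stdBasis, Pi.basis_repr, Pi.basisFun_repr, Set.mem_pi,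
    mem_univ, true_implies, Sigma.forall]

theorem measurePreserving_toTorusPi (N : ℕ) : MeasurePreserving (toTorusPi (N := N))
    (volume.restrict (ZSpan.fundamentalDomain (stdBasis N))) volume := by
  rw [fundamentalDomain_stdBasis, volume_pi, Measure.restrict_pi_pi]
  exact measurePreserving_pi _ _ fun _ => measurePreserving_toTorus

instance (N : ℕ) : IsProbabilityMeasure
    ((volume : Measure (Fin N → Fin 2 → ℝ)).restrict (ZSpan.fundamentalDomain (stdBasis N))) := by
  refine ⟨?_⟩
  have := (measurePreserving_toTorusPi N).measure_preimage nullMeasurableSet_univ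
  rw [preimage_univ] at this
  exact this.trans measure_univ

/-- The measurable section `σ` carries the torus measure to Lebesgue measure on the cell. Pulling
the statement back along `σ` needs no measurability of `P`, which is not available for existence and
uniqueness of solutions. -/
theorem ae_of_ae_toTorusPi {N : ℕ} {P : (Fin N → Torus) → Prop}
    (h : ∀ᵐ x ∂(volume.restrict (ZSpan.fundamentalDomain (stdBasis N))), P (toTorusPi x)) :
    ∀ᵐ x, P x := by
  set σ : (Fin N → Torus) → Fin N → Fin 2 → ℝ := fun x i k =>
    (AddCircle.measurableEquivIco 1 0 (x i k) : ℝ) with hσ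
  have hm : Measurable σ := measurable_pi_iff.2 fun i => measurable_pi_iff.2 fun k =>
    measurable_subtype_coe.comp ((AddCircle.measurableEquivIco 1 0).measurable.comp
      ((measurable_pi_apply k).comp (measurable_pi_apply i)))
  have h1 : ∀ x, toTorusPi (σ x) = x := fun x => by
    funext i k
    exact (AddCircle.equivIco 1 0).symm_apply_apply (x i k)
  have h2 : ∀ x ∈ ZSpan.fundamentalDomain (stdBasis N), σ (toTorusPi x) = x := by
    intro x hx
    rw [fundamentalDomain_stdBasis] at hx
    funext i k
    have hik : x i k ∈ Ico (0 : ℝ) (0 + 1) := by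
      rw [zero_add]; exact hx i trivial k trivial
    exact congrArg Subtype.val ((AddCircle.equivIco 1 0).apply_symm_apply ⟨x i k, hik⟩)
  have hmap : (volume : Measure (Fin N → Torus)).map σ =
      volume.restrict (ZSpan.fundamentalDomain (stdBasis N)) := by
    rw [← (measurePreserving_toTorusPi N).map_eq,
      Measure.map_map hm (measurePreserving_toTorusPi N).measurable]
    conv_rhs => rw [← Measure.map_id (μ := volume.restrict (ZSpan.fundamentalDomain (stdBasis N)))]
    refine Measure.map_congr ?_
    filter_upwards [ae_restrict_mem (ZSpan.fundamentalDomain_measurableSet (stdBasis N))] with x hx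
    exact h2 x hx
  rw [← hmap] at h
  filter_upwards [ae_of_ae_map hm.aemeasurable h] with x hx
  rwa [h1] at hx

variable {N : ℕ}

/-- A continuous surjective homomorphism between compact groups carries normalised Haar measure to
normalised Haar measure. -/
theorem measurePreserving_sub {i j : Fin N} (hij : i ≠ j) :
    MeasurePreserving (fun x : Fin N → Torus => x i - x j) volume volume := by
  classical
  let f : (Fin N → Torus) →+ Torus :=
    Pi.evalAddMonoidHom (fun _ => Torus) i - Pi.evalAddMonoidHom (fun _ => Torus) j
  have hc : Continuous f := (continuous_apply i).sub (continuous_apply j)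
  have hs : Function.Surjective f := fun y => ⟨Pi.single i y, by
    change (Pi.single i y : Fin N → Torus) i - (Pi.single i y : Fin N → Torus) j = y
    rw [Pi.single_eq_same, Pi.single_eq_of_ne hij.symm, sub_zero]⟩
  exact AddMonoidHom.measurePreserving hc hs (by rw [measure_univ, measure_univ])

instance : ((volume : Measure Torus).prod (volume : Measure Torus)).IsAddHaarMeasure :=
  Measure.prod.instIsAddHaarMeasure _ _

/-- The two differences are independent and uniform because `x l` occurs only in the second one. The
index `k` may equal `i` or `j`, which is the case used for triples. -/
theorem measurePreserving_sub_prod {i j k l : Fin N} (hij : i ≠ j) (hli : l ≠ i) (hlj : l ≠ j)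
    (hlk : l ≠ k) :
    MeasurePreserving (fun x : Fin N → Torus => (x i - x j, x k - x l)) volume
      (volume.prod volume) := by
  classical
  let f : (Fin N → Torus) →+ Torus × Torus :=
    (Pi.evalAddMonoidHom (fun _ => Torus) i - Pi.evalAddMonoidHom (fun _ => Torus) j).prod
      (Pi.evalAddMonoidHom (fun _ => Torus) k - Pi.evalAddMonoidHom (fun _ => Torus) l)
  have hc : Continuous f := ((continuous_apply i).sub (continuous_apply j)).prodMk
    ((continuous_apply k).sub (continuous_apply l))
  have hs : Function.Surjective f := by
    rintro ⟨y, z⟩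
    set x : Fin N → Torus := Pi.single i y with hx
    -- Coordinate `i` fixes the first difference; moving coordinate `l` then fixes the second
    -- without disturbing the first.
    refine ⟨Function.update x l (x k - z), ?_⟩
    change (Function.update x l (x k - z) i - Function.update x l (x k - z) j,
      Function.update x l (x k - z) k - Function.update x l (x k - z) l) = (y, z)
    rw [Function.update_of_ne hli.symm, Function.update_of_ne hlj.symm,
      Function.update_of_ne hlk.symm, Function.update_self, hx, Pi.single_eq_same,
      Pi.single_eq_of_ne hij.symm]
    simp
  exact AddMonoidHom.measurePreserving hc hs (by rw [measure_univ, measure_univ])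

theorem integrable_comp_sub {n : Torus → ℝ} (hn : Integrable n) {i j : Fin N} (hij : i ≠ j) :
    Integrable fun x : Fin N → Torus => n (x i - x j) :=
  (measurePreserving_sub hij).integrable_comp_of_integrable hn

theorem integrable_mul_comp_sub {n : Torus → ℝ} (hn : Integrable n) {i j k l : Fin N} (hij : i ≠ j)
    (hli : l ≠ i) (hlj : l ≠ j) (hlk : l ≠ k) :
    Integrable fun x : Fin N → Torus => n (x i - x j) * n (x k - x l) :=
  (measurePreserving_sub_prod hij hli hlj hlk).integrable_comp_of_integrable (hn.mul_prod hn)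

end TorusMeasure

/-! ### Bounded Lipschitz observables -/

section BoundedLipschitz

/-- Bounded Lipschitz real functions. -/
structure IsBddLipschitz {E : Type*} [PseudoMetricSpace E] (f : E → ℝ) : Prop where
  lip : ∃ K : ℝ≥0, LipschitzWith K f
  bdd : ∃ C : ℝ≥0, ∀ x, ‖f x‖ ≤ C

namespace IsBddLipschitz

variable {E : Type*} [PseudoMetricSpace E] {f g : E → ℝ}

theorem const (c : ℝ) : IsBddLipschitz fun _ : E => c :=
  ⟨⟨0, LipschitzWith.const c⟩, ⟨‖c‖₊, fun _ => le_rfl⟩⟩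

theorem add (hf : IsBddLipschitz f) (hg : IsBddLipschitz g) :
    IsBddLipschitz fun x => f x + g x := by
  obtain ⟨⟨K, hK⟩, C, hC⟩ := hf
  obtain ⟨⟨L, hL⟩, D, hD⟩ := hg
  exact ⟨⟨_, hK.add hL⟩, ⟨C + D, fun x => (norm_add_le _ _).trans (add_le_add (hC x) (hD x))⟩⟩

theorem abs (hf : IsBddLipschitz f) : IsBddLipschitz fun x => |f x| := by
  obtain ⟨⟨K, hK⟩, C, hC⟩ := hf
  refine ⟨⟨K, LipschitzWith.of_dist_le_mul fun x y => ?_⟩, ⟨C, fun x => by simpa using hC x⟩⟩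
  exact (abs_abs_sub_abs_le (f x) (f y)).trans (hK.dist_le_mul x y)

theorem mul (hf : IsBddLipschitz f) (hg : IsBddLipschitz g) :
    IsBddLipschitz fun x => f x * g x := by
  obtain ⟨⟨K, hK⟩, C, hC⟩ := hf
  obtain ⟨⟨L, hL⟩, D, hD⟩ := hg
  refine ⟨⟨C * L + K * D, LipschitzWith.of_dist_le_mul fun x y => ?_⟩, ⟨C * D, fun x => ?_⟩⟩
  · have e : f x * g x - f y * g y = f x * (g x - g y) + (f x - f y) * g y := by ring
    have h1 := hK.dist_le_mul x y
    have h2 := hL.dist_le_mul x y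
    rw [dist_eq_norm] at h1 h2
    rw [dist_eq_norm, e]
    refine (norm_add_le _ _).trans ?_
    rw [norm_mul, norm_mul]
    push_cast
    calc ‖f x‖ * ‖g x - g y‖ + ‖f x - f y‖ * ‖g y‖
        ≤ C * (L * dist x y) + K * dist x y * D := by
          gcongr
          · exact hC x
          · exact hD y
      _ = _ := by ring
  · rw [norm_mul]
    exact mul_le_mul (hC x) (hD x) (norm_nonneg _) C.2

theorem sum {ι : Type*} {s : Finset ι} {F : ι → E → ℝ} (hF : ∀ i ∈ s, IsBddLipschitz (F i)) :
    IsBddLipschitz fun x => ∑ i ∈ s, F i x := by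
  classical
  induction s using Finset.induction_on with
  | empty => simpa using const 0
  | insert a s ha ih =>
    simp only [Finset.sum_insert ha]
    exact (hF a (Finset.mem_insert_self a s)).add
      (ih fun i hi => hF i (Finset.mem_insert_of_mem hi))

theorem comp {E' : Type*} [PseudoMetricSpace E'] (hf : IsBddLipschitz f) {h : E' → E} {K : ℝ≥0}
    (hh : LipschitzWith K h) : IsBddLipschitz fun x => f (h x) := by
  obtain ⟨⟨L, hL⟩, C, hC⟩ := hf
  exact ⟨⟨_, hL.comp hh⟩, ⟨C, fun x => hC _⟩⟩

theorem continuous (hf : IsBddLipschitz f) : Continuous f := hf.lip.choose_spec.continuous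

end IsBddLipschitz

end BoundedLipschitz

/-! ### The pair energy and its rate of change -/

section Energy

variable {N : ℕ}

/-- The size `|∂₁Γ| + |∂₂Γ|` of the gradient of `Γ`. -/
def gradSize (Γ : Torus → ℝ) (x : Torus) : ℝ := |partialDeriv Γ 0 x| + |partialDeriv Γ 1 x|

theorem gradSize_nonneg (Γ : Torus → ℝ) (x : Torus) : 0 ≤ gradSize Γ x := by
  unfold gradSize; positivity

/-- The interaction energy of a configuration, each pair being shifted by the constant `C`. -/
def energy (C : ℝ) (Γ : Torus → ℝ) (x : Fin N → Torus) : ℝ :=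
  ∑ i, ∑ j, if i = j then 0 else Γ (x i - x j) + C

/-- A bound for the rate of change of the energy under the vortex dynamics: by orthogonality of
`∇Γ` and `∇^⊥Γ`, only triples of distinct vortices contribute. -/
def energyRate (c : ℝ) (ξ : Fin N → ℝ) (Γ : Torus → ℝ) (x : Fin N → Torus) : ℝ :=
  ∑ i, ∑ j, ∑ l, if i = j ∨ l = i ∨ l = j then 0 else
    |c| * |ξ l| * (gradSize Γ (x i - x j) * gradSize Γ (x i - x l) +
      gradSize Γ (x i - x j) * gradSize Γ (x j - x l))

theorem energyRate_nonneg (c : ℝ) (ξ : Fin N → ℝ) (Γ : Torus → ℝ) (x : Fin N → Torus) :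
    0 ≤ energyRate c ξ Γ x := by
  refine Finset.sum_nonneg fun i _ => Finset.sum_nonneg fun j _ => Finset.sum_nonneg fun l _ => ?_
  have h := gradSize_nonneg Γ
  split_ifs
  · exact le_rfl
  · have h1 := h (x i - x j)
    have h2 := h (x i - x l)
    have h3 := h (x j - x l)
    positivity

variable {Γ : Torus → ℝ}

theorem isBddLipschitz_gradSize (hΓ : ContDiff ℝ 2 fun z => Γ (toTorus z)) :
    IsBddLipschitz fun y => gradSize Γ (toTorus y) := by
  have h : ∀ i, IsBddLipschitz fun y => partialDeriv Γ i (toTorus y) := fun i =>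
    ⟨exists_lipschitz_of_periodic (contDiff_partialDeriv hΓ i) fun y l => by
      rw [toTorus_add_intCast],
    exists_bound_of_periodic (contDiff_partialDeriv hΓ i).continuous fun y l => by
      rw [toTorus_add_intCast]⟩
  exact (h 0).abs.add (h 1).abs

/-- The absolute values make the rate merely Lipschitz, which is why Liouville's theorem is stated
for Lipschitz observables. -/
theorem isBddLipschitz_energyRate (hΓ : ContDiff ℝ 2 fun z => Γ (toTorus z)) (c : ℝ)
    (ξ : Fin N → ℝ) : IsBddLipschitz fun x => energyRate c ξ Γ (toTorusPi x) := by
  have h : ∀ i j : Fin N, IsBddLipschitz fun x : Fin N → Fin 2 → ℝ =>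
      gradSize Γ (toTorusPi x i - toTorusPi x j) := fun i j =>
    (isBddLipschitz_gradSize hΓ).comp (h := fun x : Fin N → Fin 2 → ℝ => x i - x j)
      ((LipschitzWith.eval i).sub (LipschitzWith.eval j))
  refine IsBddLipschitz.sum fun i _ => IsBddLipschitz.sum fun j _ => IsBddLipschitz.sum fun l _ => ?_
  split_ifs
  · exact IsBddLipschitz.const 0
  · exact (IsBddLipschitz.const _).mul (((h i j).mul (h i l)).add ((h i j).mul (h j l)))

theorem continuous_energy (hΓ : ContDiff ℝ 2 fun z => Γ (toTorus z)) (C : ℝ) :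
    Continuous fun x : Fin N → Fin 2 → ℝ => energy C Γ (toTorusPi x) := by
  refine continuous_finsetSum _ fun i _ => continuous_finsetSum _ fun j _ => ?_
  split_ifs
  · exact continuous_const
  · exact (hΓ.continuous.comp ((continuous_apply i).sub (continuous_apply j))).add continuous_const

theorem energy_le_bound (hΓ : ContDiff ℝ 2 fun z => Γ (toTorus z)) (C : ℝ) :
    ∃ A : ℝ, ∀ x : Fin N → Fin 2 → ℝ, ‖energy C Γ (toTorusPi x)‖ ≤ A := by
  obtain ⟨B, hB⟩ := exists_bound_of_periodic hΓ.continuous fun y l => by rw [toTorus_add_intCast]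
  refine ⟨∑ _ : Fin N, ∑ _ : Fin N, (B + |C|), fun x => ?_⟩
  refine norm_sum_le_of_le _ fun i _ => norm_sum_le_of_le _ fun j _ => ?_
  split_ifs
  · rw [norm_zero]; positivity
  · exact (norm_add_le _ _).trans (add_le_add (hB (x i - x j)) le_rfl)

theorem hasDerivWithinAt_energy (hΓ : ContDiff ℝ 2 fun z => Γ (toTorus z)) (C : ℝ)
    {α : ℝ → Fin N → Fin 2 → ℝ} {v : Fin N → Fin 2 → ℝ} {s : Set ℝ} {t : ℝ}
    (hα : HasDerivWithinAt α v s t) :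
    HasDerivWithinAt (fun τ => energy C Γ (toTorusPi (α τ)))
      (∑ i, ∑ j, if i = j then 0 else
        fderiv ℝ (fun z => Γ (toTorus z)) (α t i - α t j) (v i - v j)) s t := by
  refine HasDerivWithinAt.fun_sum fun i _ => HasDerivWithinAt.fun_sum fun j _ => ?_
  split_ifs
  · exact hasDerivWithinAt_const _ _ _
  · have h1 := (hΓ.differentiable (by norm_num) (α t i - α t j)).hasFDerivAt
    have h2 := hasDerivWithinAt_pi.1 hα
    exact (h1.comp_hasDerivWithinAt t (f := fun τ => α τ i - α τ j) ((h2 i).sub (h2 j))).add_const C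

theorem fderiv_eq_partialDeriv (hΓ : ContDiff ℝ 2 fun z => Γ (toTorus z)) (y v : Fin 2 → ℝ) :
    fderiv ℝ (fun z => Γ (toTorus z)) y v =
      v 0 * partialDeriv Γ 0 (toTorus y) + v 1 * partialDeriv Γ 1 (toTorus y) := by
  rw [partialDeriv_toTorus' hΓ, partialDeriv_toTorus' hΓ]
  have hv : v = v 0 • Pi.single 0 (1 : ℝ) + v 1 • Pi.single 1 (1 : ℝ) := by
    funext k
    fin_cases k <;> simp
  conv_lhs => rw [hv, map_add, map_smul, map_smul]
  rfl

/-- Orthogonality of `∇Γ` and `∇^⊥Γ` removes the term of size `|∇Γ|²`, the one with no integrable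
bound as the truncation is lifted. -/
theorem fderiv_perpGrad_self (hΓ : ContDiff ℝ 2 fun z => Γ (toTorus z)) (y : Fin 2 → ℝ) :
    fderiv ℝ (fun z => Γ (toTorus z)) y (perpGrad Γ (toTorus y)) = 0 := by
  rw [fderiv_eq_partialDeriv hΓ]
  simp [perpGrad]
  ring

theorem abs_fderiv_perpGrad_le (hΓ : ContDiff ℝ 2 fun z => Γ (toTorus z)) (y : Fin 2 → ℝ)
    (z : Torus) : |fderiv ℝ (fun z => Γ (toTorus z)) y (perpGrad Γ z)| ≤
      gradSize Γ (toTorus y) * gradSize Γ z := by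
  rw [fderiv_eq_partialDeriv hΓ]
  simp only [perpGrad, gradSize, Matrix.cons_val_zero, Matrix.cons_val_one]
  refine (abs_add_le _ _).trans ?_
  rw [abs_mul, abs_mul, abs_neg]
  nlinarith [abs_nonneg (partialDeriv Γ 0 z), abs_nonneg (partialDeriv Γ 1 z),
    abs_nonneg (partialDeriv Γ 0 (toTorus y)), abs_nonneg (partialDeriv Γ 1 (toTorus y)),
    mul_nonneg (abs_nonneg (partialDeriv Γ 0 z)) (abs_nonneg (partialDeriv Γ 0 (toTorus y))),
    mul_nonneg (abs_nonneg (partialDeriv Γ 1 z)) (abs_nonneg (partialDeriv Γ 1 (toTorus y)))]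

/-- In the derivative of the pair `(i, j)`, the sources `l = i` and `l = j` drop out: one velocity
is the self-interaction, which is zero, and the other is orthogonal to the gradient, up to a sign
given by oddness. -/
theorem energy_deriv_le (hΓ : ContDiff ℝ 2 fun z => Γ (toTorus z)) (he : ∀ x, Γ (-x) = Γ x)
    (c : ℝ) (ξ : Fin N → ℝ) (x : Fin N → Fin 2 → ℝ) :
    (∑ i, ∑ j, if i = j then 0 else fderiv ℝ (fun z => Γ (toTorus z)) (x i - x j)
      (vortexField c ξ Γ x i - vortexField c ξ Γ x j)) ≤ energyRate c ξ Γ (toTorusPi x) := by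
  refine Finset.sum_le_sum fun i _ => Finset.sum_le_sum fun j _ => ?_
  by_cases hij : i = j
  · simp [hij]
  rw [if_neg hij]
  simp only [vortexField]
  rw [← smul_sub, ← Finset.sum_sub_distrib, map_smul, map_sum, Finset.smul_sum]
  refine Finset.sum_le_sum fun l _ => ?_
  rw [← smul_sub, map_smul, map_sub]
  have hz := perpGrad_zero he
  simp only [← toTorus_sub]
  by_cases hli : l = i
  · subst hli
    have e : x j - x l = -(x l - x j) := by abel
    rw [sub_self, toTorus_zero, hz, map_zero, e, toTorus_neg, perpGrad_neg he, map_neg,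
      fderiv_perpGrad_self hΓ]
    simp
  by_cases hlj : l = j
  · subst hlj
    rw [sub_self, toTorus_zero, hz, map_zero, fderiv_perpGrad_self hΓ]
    simp
  rw [if_neg (by tauto)]
  refine (le_abs_self _).trans ?_
  simp only [smul_eq_mul, abs_mul, mul_assoc]
  gcongr
  refine (abs_sub _ _).trans ?_
  exact add_le_add (abs_fderiv_perpGrad_le hΓ _ _) (abs_fderiv_perpGrad_le hΓ _ _)

end Energy

/-! ### Energy bound uniform in the truncation level -/

section Estimate

variable {N : ℕ} {Γ G : Torus → ℝ}

/-- The rate is nonnegative, so its integral may be extended from `t` to `T`. The right side then no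
longer depends on `t` and controls the supremum over the time interval. -/
theorem energy_le_add_integral (hΓ : ContDiff ℝ 2 fun z => Γ (toTorus z))
    (he : ∀ x, Γ (-x) = Γ x) (c : ℝ) (ξ : Fin N → ℝ) (C : ℝ)
    {φ : ℝ → (Fin N → Fin 2 → ℝ) → Fin N → Fin 2 → ℝ} (hφ : IsSemiflow (vortexField c ξ Γ) φ)
    {T t : ℝ} (ht : t ∈ Icc 0 T) (x : Fin N → Fin 2 → ℝ) :
    energy C Γ (toTorusPi (φ t x)) ≤ energy C Γ (toTorusPi x) +
      ∫ s in (0 : ℝ)..T, energyRate c ξ Γ (toTorusPi (φ (max s 0) x)) := by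
  -- The flow is controlled only for nonnegative times; `max s 0` extends the integrand continuously
  -- to the line.
  set r : ℝ → ℝ := fun s => energyRate c ξ Γ (toTorusPi (φ (max s 0) x)) with hr
  have hrc : Continuous r := by
    refine (isBddLipschitz_energyRate hΓ c ξ).continuous.comp ?_
    exact (hφ.continuousOn x).comp_continuous (continuous_id.max continuous_const)
      fun s => mem_Ici.2 (le_max_right _ _)
  have hB : ∀ s, HasDerivAt (fun t => energy C Γ (toTorusPi x) + ∫ s in (0 : ℝ)..t, r s) (r s) s :=
    fun s => (intervalIntegral.integral_hasDerivAt_right (hrc.intervalIntegrable _ _)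
      (hrc.stronglyMeasurableAtFilter _ _) hrc.continuousAt).const_add _
  have key := image_le_of_deriv_right_le_deriv_boundary (a := 0) (b := T)
    (f := fun t => energy C Γ (toTorusPi (φ t x)))
    (((continuous_energy hΓ C).comp_continuousOn (hφ.continuousOn x)).mono Icc_subset_Ici_self)
    (fun s hs => hasDerivWithinAt_energy hΓ C (hφ.deriv_right x hs.1))
    (B := fun t => energy C Γ (toTorusPi x) + ∫ s in (0 : ℝ)..t, r s) (B' := r)
    (by simp [hφ.zero]) (fun s _ => (hB s).continuousAt.continuousWithinAt)
    (fun s _ => (hB s).hasDerivWithinAt)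
    (fun s hs => by
      refine (energy_deriv_le hΓ he c ξ (φ s x)).trans_eq ?_
      simp only [hr, max_eq_left hs.1]) ht
  refine key.trans ?_
  have h1 : ∫ s in (0 : ℝ)..t, r s ≤ ∫ s in (0 : ℝ)..T, r s :=
    intervalIntegral.integral_mono_interval le_rfl ht.1 ht.2
      (Eventually.of_forall fun s => energyRate_nonneg _ _ _ _) (hrc.intervalIntegrable _ _)
  simpa using h1

theorem energy_nonneg {C : ℝ} (hC : ∀ x, -C ≤ Γ x) (x : Fin N → Torus) : 0 ≤ energy C Γ x := by
  refine Finset.sum_nonneg fun i _ => Finset.sum_nonneg fun j _ => ?_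
  split_ifs
  · exact le_rfl
  · linarith [hC (x i - x j)]

/-- Markov's inequality applied to the initial energy plus the integrated rate. This
time-independent majorant also avoids any measurability question about the supremum. -/
theorem measure_energy_ge_le (hΓ : ContDiff ℝ 2 fun z => Γ (toTorus z))
    (he : ∀ x, Γ (-x) = Γ x) (c : ℝ) (ξ : Fin N → ℝ) {C : ℝ} (hC : ∀ x, -C ≤ Γ x)
    {φ : ℝ → (Fin N → Fin 2 → ℝ) → Fin N → Fin 2 → ℝ} (hφ : IsSemiflow (vortexField c ξ Γ) φ)
    {T M : ℝ} (hT : 0 ≤ T) (hM : 0 < M) :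
    (volume.restrict (ZSpan.fundamentalDomain (stdBasis N))).real
      {x | ¬∀ t ∈ Icc 0 T, energy C Γ (toTorusPi (φ t x)) < M} ≤
    ((∫ x in ZSpan.fundamentalDomain (stdBasis N), energy C Γ (toTorusPi x)) +
      T * ∫ x in ZSpan.fundamentalDomain (stdBasis N), energyRate c ξ Γ (toTorusPi x)) / M := by
  set μ := (volume : Measure (Fin N → Fin 2 → ℝ)).restrict (ZSpan.fundamentalDomain (stdBasis N))
    with hμ
  obtain ⟨K, hK⟩ := exists_lipschitz_vortexField hΓ c ξ
  obtain ⟨B, hB⟩ := exists_bound_vortexField hΓ c ξ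
  obtain ⟨⟨Kr, hKr⟩, Cr, hCr⟩ := isBddLipschitz_energyRate hΓ c ξ
  set R : ℝ → (Fin N → Fin 2 → ℝ) → ℝ := fun s x => energyRate c ξ Γ (toTorusPi (φ (max s 0) x))
    with hR
  have hRc : Continuous (Function.uncurry R) := by
    refine hKr.continuous.comp ?_
    exact (hφ.continuousOn_uncurry hK hB).comp_continuous
      (f := fun p : ℝ × (Fin N → Fin 2 → ℝ) => (max p.1 0, p.2)) (by fun_prop)
      fun p => ⟨mem_Ici.2 (le_max_right _ _), trivial⟩
  have hRi : Integrable (Function.uncurry R) ((volume.restrict (uIoc 0 T)).prod μ) := by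
    have : IsFiniteMeasure (volume.restrict (uIoc 0 T)) := by
      rw [uIoc_of_le hT]; infer_instance
    exact Integrable.of_bound hRc.aestronglyMeasurable Cr (ae_of_all _ fun p => hCr _)
  have hper : ∀ l ∈ Submodule.span ℤ (range (stdBasis N)), ∀ x,
      vortexField c ξ Γ (x + l) = vortexField c ξ Γ x := fun l hl x => by
    have h : ∀ i, toTorus ((x + l) i) = toTorus (x i) :=
      congrFun (toTorusPi_add_of_mem_span x hl)
    funext i
    simp only [vortexField, h]
  -- Liouville's theorem: the mean rate at any time is the mean rate initially, so after Fubini the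
  -- time integral is just a factor `T`.
  have hL : ∀ s, ∫ x, R s x ∂μ = ∫ x, energyRate c ξ Γ (toTorusPi x) ∂μ := fun s =>
    hφ.setIntegral_comp volume (stdBasis N) hK hB
      (fun x => (hasFDerivAt_vortexField hΓ c ξ x).differentiableAt)
      (trace_fderiv_vortexField hΓ c ξ) hper hKr hCr
      (fun l hl x => by rw [toTorusPi_add_of_mem_span x hl]) (le_max_right s 0)
  have hswap := intervalIntegral_integral_swap hRi
  simp only [hL] at hswap
  rw [intervalIntegral.integral_const, sub_zero, smul_eq_mul] at hswap
  obtain ⟨A, hA⟩ := energy_le_bound (N := N) hΓ C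
  have hEi : Integrable (fun x => energy C Γ (toTorusPi x)) μ :=
    Integrable.of_bound (continuous_energy hΓ C).aestronglyMeasurable A (ae_of_all _ hA)
  have hIi : Integrable (fun x => ∫ s in (0 : ℝ)..T, R s x) μ := by
    have := hRi.integral_prod_right
    simpa only [intervalIntegral.integral_of_le hT, uIoc_of_le hT] using! this
  have hS := mul_meas_ge_le_integral_of_nonneg (μ := μ)
    (f := fun x => energy C Γ (toTorusPi x) + ∫ s in (0 : ℝ)..T, R s x)
    (ae_of_all _ fun x => add_nonneg (energy_nonneg hC _)
      (intervalIntegral.integral_nonneg hT fun s _ => energyRate_nonneg _ _ _ _))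
    (hEi.add hIi) M
  rw [integral_add hEi hIi, ← hswap] at hS
  rw [le_div_iff₀ hM, mul_comm]
  refine le_trans ?_ hS
  refine mul_le_mul_of_nonneg_left (measureReal_mono (fun x hx => ?_) (measure_ne_top _ _)) hM.le
  simp only [mem_ofPred_eq, not_forall, not_lt] at hx ⊢
  obtain ⟨t, ht, h⟩ := hx
  exact h.trans (energy_le_add_integral hΓ he c ξ C hφ ht x)

theorem integrable_energy (hG : IsGreenLike G) (C : ℝ) :
    Integrable fun x : Fin N → Torus => energy C G x := by
  refine integrable_finsetSum _ fun i _ => integrable_finsetSum _ fun j _ => ?_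
  split_ifs with h
  · exact integrable_zero _ _ _
  · exact (integrable_comp_sub hG.integrable h).add (integrable_const C)

theorem integrable_energyRate (hG : IsGreenLike G) (c : ℝ) (ξ : Fin N → ℝ) :
    Integrable fun x : Fin N → Torus => energyRate c ξ G x := by
  have hn : Integrable (gradSize G) := (hG.integrable_deriv 0).abs.add (hG.integrable_deriv 1).abs
  refine integrable_finsetSum _ fun i _ => integrable_finsetSum _ fun j _ =>
    integrable_finsetSum _ fun l _ => ?_
  split_ifs with h
  · exact integrable_zero _ _ _
  · push Not at h
    exact ((integrable_mul_comp_sub hn h.1 h.2.1 h.2.2 h.2.1).add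
      (integrable_mul_comp_sub hn h.1 h.2.1 h.2.2 h.2.2)).const_mul _

theorem exists_measure_truncate_ge_le (hG : IsGreenLike G) (c : ℝ) (ξ : Fin N → ℝ) {T : ℝ}
    (hT : 0 ≤ T) : ∃ A : ℝ, ∀ M : ℝ, 0 < M →
      ∀ φ : ℝ → (Fin N → Fin 2 → ℝ) → Fin N → Fin 2 → ℝ,
      IsSemiflow (vortexField c ξ (truncate G M)) φ →
      (volume.restrict (ZSpan.fundamentalDomain (stdBasis N))).real
        {x | ¬∀ t ∈ Icc 0 T, ∀ i j, i ≠ j → truncate G M (toTorus (φ t x i - φ t x j)) < M} ≤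
      A / M := by
  obtain ⟨C, hC⟩ := hG.bddBelow
  -- Nonnegativity gives `-C' ≤ M` for every positive `M`, and makes each pair value at most its
  -- shifted energy term.
  set C' := max C 0 with hC'
  have hGC : ∀ x, -C' ≤ G x := fun x => (neg_le_neg (le_max_left _ _)).trans (hC x)
  have hC'0 : 0 ≤ C' := le_max_right _ _
  set D := ZSpan.fundamentalDomain (stdBasis N) with hD
  refine ⟨(∫ x in D, energy C' G (toTorusPi x)) +
    T * ∫ x in D, energyRate c ξ G (toTorusPi x), fun M hM φ hφ => ?_⟩
  have hMC : -C' ≤ M := by linarith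
  have hΓC : ∀ x, -C' ≤ truncate G M x := fun x => le_truncate (hGC x) hMC
  have h1 := measure_energy_ge_le hG.contDiff_truncate hG.truncate_even c ξ hΓC hφ hT hM
  have hmp := measurePreserving_toTorusPi N
  have i1 : ∫ x in D, energy C' (truncate G M) (toTorusPi x) ≤
      ∫ x in D, energy C' G (toTorusPi x) := by
    refine integral_mono_of_nonneg (ae_of_all _ fun x => energy_nonneg hΓC _)
      (hmp.integrable_comp_of_integrable (integrable_energy hG C')) ?_
    -- The comparison of the truncation with `G` is available only off the origin, so collisions are
    -- discarded as a null set.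
    have hne : ∀ᵐ x : Fin N → Torus, ∀ i j, i ≠ j → x i - x j ≠ 0 := by
      refine ae_all_iff.2 fun i => ae_all_iff.2 fun j => ?_
      by_cases hij : i = j
      · exact ae_of_all _ fun x h => absurd hij h
      · filter_upwards [(measurePreserving_sub hij).quasiMeasurePreserving.ae ae_ne_zero] with x hx _
        exact hx
    filter_upwards [hmp.quasiMeasurePreserving.ae hne] with x hx
    refine Finset.sum_le_sum fun i _ => Finset.sum_le_sum fun j _ => ?_
    split_ifs with h
    · exact le_rfl
    · exact add_le_add_left (truncate_le (hx i j h)) _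
  have i2 : ∫ x in D, energyRate c ξ (truncate G M) (toTorusPi x) ≤
      ∫ x in D, energyRate c ξ G (toTorusPi x) := by
    refine integral_mono_of_nonneg (ae_of_all _ fun x => energyRate_nonneg _ _ _ _)
      (hmp.integrable_comp_of_integrable (integrable_energyRate hG c ξ)) (ae_of_all _ fun x => ?_)
    have hle : ∀ y, gradSize (truncate G M) y ≤ gradSize G y := fun y =>
      add_le_add (hG.abs_partialDeriv_truncate_le 0 y) (hG.abs_partialDeriv_truncate_le 1 y)
    have h0 := gradSize_nonneg (truncate G M)
    have h0' := gradSize_nonneg G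
    refine Finset.sum_le_sum fun i _ => Finset.sum_le_sum fun j _ =>
      Finset.sum_le_sum fun l _ => ?_
    split_ifs with h
    · exact le_rfl
    · refine mul_le_mul_of_nonneg_left (add_le_add ?_ ?_) (by positivity) <;>
      exact mul_le_mul (hle _) (hle _) (h0 _) (h0' _)
  refine le_trans ?_ (h1.trans (by gcongr))
  refine measureReal_mono ?_ (measure_ne_top _ _)
  intro x hx
  simp only [mem_ofPred_eq] at hx ⊢
  contrapose! hx
  intro t ht i j hij
  refine lt_of_le_of_lt ?_ (hx t ht)
  have hnn : ∀ i j, 0 ≤ if i = j then 0 else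
      truncate G M (toTorusPi (φ t x) i - toTorusPi (φ t x) j) + C' := fun i j => by
    split_ifs
    · exact le_rfl
    · linarith [hΓC (toTorusPi (φ t x) i - toTorusPi (φ t x) j)]
  have e1 := Finset.single_le_sum (f := fun i => ∑ j, if i = j then 0 else
      truncate G M (toTorusPi (φ t x) i - toTorusPi (φ t x) j) + C')
    (fun i _ => Finset.sum_nonneg fun j _ => hnn i j) (Finset.mem_univ i)
  have e2 := Finset.single_le_sum (f := fun j => if i = j then 0 else
      truncate G M (toTorusPi (φ t x) i - toTorusPi (φ t x) j) + C')
    (fun j _ => hnn i j) (Finset.mem_univ j)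
  simp only [if_neg hij] at e2
  have e3 := e2.trans e1
  have e4 : truncate G M (toTorus (φ t x i - φ t x j)) =
    truncate G M (toTorusPi (φ t x) i - toTorusPi (φ t x) j) := rfl
  unfold energy
  linarith

end Estimate

/-! ### From the truncated flow to the vortex system -/

section Dynamics

variable {N : ℕ} {ε : ℝ}

theorem kernel_zero : kernel ε 0 = 0 := if_pos rfl

/-- Being below level `M` is an open condition, so the truncation and `G` agree near the point and
have the same derivatives there. -/
theorem kernel_eq_perpGrad (hG : IsGreenLike (greenFunction ε)) {M : ℝ} {x : Torus}
    (hx : truncate (greenFunction ε) M x < M) :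
    kernel ε x = perpGrad (truncate (greenFunction ε) M) x := by
  obtain ⟨y, rfl⟩ := toTorus_surjective x
  have hy := (truncate_eq_of_lt hx).1
  have hc : Continuous fun z => truncate (greenFunction ε) M (toTorus z) :=
    hG.contDiff_truncate.continuous
  have h1 : (fun z => truncate (greenFunction ε) M (toTorus z)) =ᶠ[𝓝 y]
      fun z => greenFunction ε (toTorus z) := by
    filter_upwards [hc.continuousAt.eventually_lt_const hx] with z hz
    exact (truncate_eq_of_lt hz).2
  have h2 : ∀ i, partialDeriv (truncate (greenFunction ε) M) i (toTorus y) =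
      partialDeriv (greenFunction ε) i (toTorus y) := fun i => by
    rw [partialDeriv_toTorus' hG.contDiff_truncate,
      partialDeriv_toTorus ((hG.contDiffAt y hy).differentiableAt (by norm_num)), h1.fderiv_eq]
  rw [kernel, if_neg hy, perpGrad, h2, h2]

/-- The velocity field of the vortex system on the covering space. -/
def velocity (ε c : ℝ) (ξ : Fin N → ℝ) (x : Fin N → Fin 2 → ℝ) : Fin N → Fin 2 → ℝ :=
  fun i => c • ∑ j, ξ j • kernel ε (toTorus (x i) - toTorus (x j))

/-- The configurations for which all pair interaction energies are below `M`. -/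
def lowEnergy (N : ℕ) (ε M : ℝ) : Set (Fin N → Fin 2 → ℝ) :=
  {x | ∀ i j, i ≠ j → truncate (greenFunction ε) M (toTorus (x i - x j)) < M}

theorem isOpen_lowEnergy (hG : IsGreenLike (greenFunction ε)) (M : ℝ) :
    IsOpen (lowEnergy N ε M) := by
  have e : lowEnergy N ε M = ⋂ i, ⋂ j, {x | i ≠ j →
      truncate (greenFunction ε) M (toTorus (x i - x j)) < M} := by
    ext x
    simp only [lowEnergy, mem_ofPred_eq, mem_iInter]
  rw [e]
  refine isOpen_iInter_of_finite fun i => isOpen_iInter_of_finite fun j => ?_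
  by_cases hij : i = j
  · simp [hij]
  · simp only [ne_eq, hij, not_false_eq_true, true_implies]
    have hc : Continuous fun z => truncate (greenFunction ε) M (toTorus z) :=
      hG.contDiff_truncate.continuous
    exact isOpen_lt (hc.comp ((continuous_apply i).sub (continuous_apply j))) continuous_const

theorem velocity_eq_vortexField (hG : IsGreenLike (greenFunction ε)) {M : ℝ} (c : ℝ) (ξ : Fin N → ℝ)
    {x : Fin N → Fin 2 → ℝ} (hx : x ∈ lowEnergy N ε M) :
    velocity ε c ξ x = vortexField c ξ (truncate (greenFunction ε) M) x := by
  funext i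
  simp only [velocity, vortexField]
  congr 1
  refine Finset.sum_congr rfl fun j _ => ?_
  congr 1
  by_cases hij : i = j
  · rw [hij, sub_self, kernel_zero, perpGrad_zero hG.truncate_even]
  · exact kernel_eq_perpGrad hG (hx i j hij)

/-- Only `α` is assumed to stay at low energy; `β` might a priori collide. The agreement set is
closed. At an agreement time `β` lies in the open low-energy region and stays there briefly, and
both curves then solve the same Lipschitz equation. -/
theorem eqOn_of_lowEnergy (hG : IsGreenLike (greenFunction ε)) {M c T : ℝ} {ξ : Fin N → ℝ}
    {α β : ℝ → Fin N → Fin 2 → ℝ}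
    (hα : ∀ t ∈ Icc 0 T, HasDerivWithinAt α (velocity ε c ξ (α t)) (Icc 0 T) t)
    (hlow : ∀ t ∈ Icc 0 T, α t ∈ lowEnergy N ε M)
    (hβ : ∀ t ∈ Icc 0 T, HasDerivWithinAt β (velocity ε c ξ (β t)) (Icc 0 T) t)
    (h0 : β 0 = α 0) : EqOn β α (Icc 0 T) := by
  obtain ⟨K, hK⟩ := exists_lipschitz_vortexField (hG.contDiff_truncate (M := M)) c ξ
  have hαc : ContinuousOn α (Icc 0 T) := fun t ht => (hα t ht).continuousWithinAt
  have hβc : ContinuousOn β (Icc 0 T) := fun t ht => (hβ t ht).continuousWithinAt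
  have hcl : IsClosed ({t | β t = α t} ∩ Icc 0 T) := by
    have := (hβc.prodMk hαc).preimage_isClosed_of_isClosed isClosed_Icc
      (isClosed_diagonal (X := Fin N → Fin 2 → ℝ))
    rw [inter_comm] at this
    exact this
  refine hcl.Icc_subset_of_forall_exists_gt h0 ?_
  rintro t ⟨hteq, ht⟩ y hy
  have hteq : β t = α t := hteq
  have hty : t < y := hy
  have htI : t ∈ Icc 0 T := Ico_subset_Icc_self ht
  have hev : ∀ᶠ τ in 𝓝[Icc 0 T] t, β τ ∈ lowEnergy N ε M :=
    (hβc t htI).eventually ((isOpen_lowEnergy hG M).mem_nhds (hteq ▸ hlow t htI))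
  rw [eventually_nhdsWithin_iff] at hev
  obtain ⟨δ, hδ, hball⟩ := Metric.eventually_nhds_iff.1 hev
  -- The endpoint keeps `β` inside the low-energy window, does not pass the target `y`, and stays in
  -- the time interval.
  set r := min (t + δ / 2) (min y T) with hr
  have htr : t < r := lt_min (by linarith) (lt_min hty ht.2)
  have hrT : r ≤ T := (min_le_right _ _).trans (min_le_right _ _)
  have hry : r ≤ y := (min_le_right _ _).trans (min_le_left _ _)
  have hrδ : r ≤ t + δ / 2 := min_le_left _ _
  have hsub : Icc t r ⊆ Icc 0 T := Icc_subset_Icc ht.1 hrT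
  have hβlow : ∀ τ ∈ Ico t r, β τ ∈ lowEnergy N ε M := fun τ hτ => by
    refine hball ?_ (hsub (Ico_subset_Icc_self hτ))
    rw [Real.dist_eq, abs_of_nonneg (by linarith [hτ.1])]
    linarith [hτ.2]
  have hright : ∀ γ : ℝ → Fin N → Fin 2 → ℝ,
      (∀ t ∈ Icc 0 T, HasDerivWithinAt γ (velocity ε c ξ (γ t)) (Icc 0 T) t) →
      (∀ τ ∈ Ico t r, γ τ ∈ lowEnergy N ε M) → ∀ τ ∈ Ico t r, HasDerivWithinAt γ
        (vortexField c ξ (truncate (greenFunction ε) M) (γ τ)) (Ici τ) τ := by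
    intro γ hγ hγl τ hτ
    have h1 := hγ τ (hsub (Ico_subset_Icc_self hτ))
    rw [velocity_eq_vortexField hG c ξ (hγl τ hτ)] at h1
    refine h1.mono_of_mem_nhdsWithin ?_
    filter_upwards [self_mem_nhdsWithin, mem_nhdsWithin_of_mem_nhds (Iio_mem_nhds hτ.2)]
      with z h2 h3
    exact hsub ⟨hτ.1.trans h2, le_of_lt h3⟩
  have huniq := ODE_solution_unique_of_mem_Icc_right
    (v := fun _ => vortexField c ξ (truncate (greenFunction ε) M)) (s := fun _ => univ)
    (fun _ _ => hK.lipschitzOnWith) (hβc.mono hsub) (hright β hβ hβlow) (fun _ _ => trivial)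
    (hαc.mono hsub)
    (hright α hα fun τ hτ => hlow τ (hsub (Ico_subset_Icc_self hτ))) (fun _ _ => trivial) hteq
  exact ⟨r, huniq ⟨htr.le, le_rfl⟩, htr, hry⟩

/-- For a fixed horizon, initial data that fail at every level `M` lie in each set of measure at
most `A / M`, hence in a null set. The level may depend on both the point and the horizon. -/
theorem ae_exists_lowEnergy (hG : IsGreenLike (greenFunction ε)) (c : ℝ) (ξ : Fin N → ℝ) :
    ∀ᵐ x ∂(volume.restrict (ZSpan.fundamentalDomain (stdBasis N))), ∀ n : ℕ,
      ∃ (M : ℝ) (α : ℝ → Fin N → Fin 2 → ℝ), α 0 = x ∧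
        (∀ t ∈ Icc (0 : ℝ) n, HasDerivWithinAt α (velocity ε c ξ (α t)) (Icc (0 : ℝ) n) t) ∧
        ∀ t ∈ Icc (0 : ℝ) n, α t ∈ lowEnergy N ε M := by
  have hflow : ∀ M : ℝ, ∃ φ, IsSemiflow (vortexField c ξ (truncate (greenFunction ε) M)) φ :=
    fun M => by
      obtain ⟨K, hK⟩ := exists_lipschitz_vortexField (hG.contDiff_truncate (M := M)) c ξ
      obtain ⟨B, hB⟩ := exists_bound_vortexField (hG.contDiff_truncate (M := M)) c ξ
      exact exists_isSemiflow hK hB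
  choose φ hφ using hflow
  refine ae_all_iff.2 fun n => ?_
  obtain ⟨A, hA⟩ := exists_measure_truncate_ge_le hG c ξ (Nat.cast_nonneg (α := ℝ) n)
  set μ := (volume : Measure (Fin N → Fin 2 → ℝ)).restrict (ZSpan.fundamentalDomain (stdBasis N))
  have hae : ∀ᵐ x ∂μ, ∃ M : ℝ, ∀ t ∈ Icc (0 : ℝ) n, φ M t x ∈ lowEnergy N ε M := by
    rw [ae_iff, ← measureReal_eq_zero_iff]
    refine le_antisymm ?_ measureReal_nonneg
    have hlim : Tendsto (fun M : ℝ => A / M) atTop (𝓝 0) := tendsto_const_nhds.div_atTop tendsto_id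
    refine ge_of_tendsto hlim ?_
    filter_upwards [eventually_gt_atTop 0] with M hM
    refine le_trans (measureReal_mono ?_ (measure_ne_top _ _)) (hA M hM (φ M) (hφ M))
    intro x hx
    simp only [mem_ofPred_eq, not_exists] at hx ⊢
    exact hx M
  filter_upwards [hae] with x hx
  obtain ⟨M, hM⟩ := hx
  refine ⟨M, fun t => φ M t x, (hφ M).zero x, fun t ht => ?_, hM⟩
  rw [velocity_eq_vortexField hG c ξ (hM t ht)]
  exact (hφ M).hasDerivWithinAt_Icc x n t ht

theorem ae_exists_vortexSolution (hG : IsGreenLike (greenFunction ε)) (ξ : Fin N → ℝ) :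
    ∀ᵐ x₀ : Fin N → Torus, ∃ X : ℝ → Fin N → Torus, IsVortexSolution ε ξ (Ici 0) X ∧ X 0 = x₀ ∧
        (∀ t, 0 ≤ t → X t ∉ collisionSet N) ∧
        ∀ T : ℝ, 0 < T → ∀ Y : ℝ → Fin N → Torus,
          IsVortexSolution ε ξ (Ico 0 T) Y → Y 0 = x₀ → ∀ t ∈ Ico 0 T, Y t = X t := by
  refine ae_of_ae_toTorusPi ?_
  filter_upwards [ae_exists_lowEnergy hG (Real.sqrt N)⁻¹ ξ] with x hx
  choose M α hα0 hα hlow using hx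
  -- Solutions for different horizons come from different truncations, so their agreement needs
  -- uniqueness for the true system.
  obtain ⟨β, hβα, hβ⟩ := exists_glue α hα fun m n hmn t ht => by
    have hsub : Icc (0 : ℝ) m ⊆ Icc 0 n := Icc_subset_Icc_right (by exact_mod_cast hmn)
    exact (eqOn_of_lowEnergy hG (hα m) (hlow m) (fun s hs => (hα n s (hsub hs)).mono hsub)
      ((hα0 n).trans (hα0 m).symm) ht).symm
  have hβlow : ∀ t : ℝ, 0 ≤ t → ∃ n : ℕ, t ≤ n ∧ β t ∈ lowEnergy N ε (M n) := fun t ht => by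
    obtain ⟨n, hn⟩ := exists_nat_ge t
    exact ⟨n, hn, by rw [hβα n t ⟨ht, hn⟩]; exact hlow n t ⟨ht, hn⟩⟩
  have hβ0 : β 0 = x := by rw [hβα 0 0 (by simp), hα0]
  refine ⟨fun t => toTorusPi (β t), ⟨β, fun _ _ _ _ => rfl, fun t ht i =>
    hasDerivWithinAt_pi.1 (hβ t ht) i⟩, by simp only [hβ0], fun t ht => ?_, ?_⟩
  · rintro ⟨i, j, hij, he⟩
    obtain ⟨n, -, hn⟩ := hβlow t ht
    refine (truncate_eq_of_lt (hn i j hij)).1 ?_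
    rw [toTorus_sub]
    exact sub_eq_zero.2 he
  · rintro T hT Y ⟨y, hyY, hy⟩ hY0 t ht
    have h0 : ∀ i, toTorus (y 0 i) = toTorus (x i) := fun i => by
      have h1 : toTorus (y 0 i) = Y 0 i := funext fun k => hyY 0 ⟨le_rfl, hT⟩ i k
      rw [h1, hY0]; rfl
    -- The lift of the competitor may start at another preimage; subtracting a lattice vector for
    -- each vortex aligns the starting points and keeps the derivatives.
    choose l hl using fun i => toTorus_eq_iff.1 (h0 i)
    set z : ℝ → Fin N → Fin 2 → ℝ := fun τ i => y τ i - fun k => (l i k : ℝ) with hz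
    have hzY : ∀ τ ∈ Ico 0 T, ∀ i, toTorus (z τ i) = Y τ i := fun τ hτ i => by
      simp only [hz]
      rw [toTorus_sub, toTorus_intCast, sub_zero]
      exact funext fun k => hyY τ hτ i k
    obtain ⟨n, hn⟩ := exists_nat_ge t
    have hsub : Icc 0 t ⊆ Ico 0 T := Icc_subset_Ico_right ht.2
    have hsub' : Icc 0 t ⊆ Icc (0 : ℝ) n := Icc_subset_Icc_right hn
    have key := eqOn_of_lowEnergy hG (β := z) (fun s hs => (hα n s (hsub' hs)).mono hsub')
      (fun s hs => hlow n s (hsub' hs)) (fun s hs => hasDerivWithinAt_pi.2 fun i => by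
        have h1 := ((hy s (hsub hs) i).sub_const (fun k => (l i k : ℝ))).mono hsub
        simp only [velocity, hzY s (hsub hs)]
        exact h1) (by
        funext i
        simp only [hz, hα0, hl]
        abel)
    have h2 : z t = β t := by
      rw [hβα n t ⟨ht.1, hn⟩]
      exact key ⟨ht.1, le_rfl⟩
    funext i
    rw [← hzY t ht i, h2]
    rfl

end Dynamics

/-! ### Differentiation under the integral sign -/

section ParametricIntegral

/-- Twice continuous differentiability under the integral sign. -/
theorem contDiffOn_two_integral {A V : Type*} [MeasurableSpace A] {μ : Measure A}
    [NormedAddCommGroup V] [NormedSpace ℝ V] {F : V → A → ℝ} {F1 : V → A → V →L[ℝ] ℝ}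
    {F2 : V → A → V →L[ℝ] V →L[ℝ] ℝ} {U : Set V} {bound : A → ℝ} (hU : IsOpen U)
    (hF : ∀ᵐ a ∂μ, ∀ x ∈ U, HasFDerivAt (fun x => F x a) (F1 x a) x)
    (hF1 : ∀ᵐ a ∂μ, ∀ x ∈ U, HasFDerivAt (fun x => F1 x a) (F2 x a) x)
    (hF2 : ∀ᵐ a ∂μ, ContinuousOn (fun x => F2 x a) U)
    (m0 : ∀ x ∈ U, AEStronglyMeasurable (F x) μ) (m1 : ∀ x ∈ U, AEStronglyMeasurable (F1 x) μ)
    (m2 : ∀ x ∈ U, AEStronglyMeasurable (F2 x) μ) (hb : Integrable bound μ)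
    (b0 : ∀ᵐ a ∂μ, ∀ x ∈ U, ‖F x a‖ ≤ bound a) (b1 : ∀ᵐ a ∂μ, ∀ x ∈ U, ‖F1 x a‖ ≤ bound a)
    (b2 : ∀ᵐ a ∂μ, ∀ x ∈ U, ‖F2 x a‖ ≤ bound a) :
    ContDiffOn ℝ 2 (fun x => ∫ a, F x a ∂μ) U ∧
      ∀ x ∈ U, HasFDerivAt (fun x => ∫ a, F x a ∂μ) (∫ a, F1 x a ∂μ) x := by
  have d0 : ∀ x ∈ U, HasFDerivAt (fun x => ∫ a, F x a ∂μ) (∫ a, F1 x a ∂μ) x := fun x hx =>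
    hasFDerivAt_integral_of_dominated_of_fderiv_le (hU.mem_nhds hx)
      (by filter_upwards [hU.mem_nhds hx] with y hy using m0 y hy)
      (hb.mono' (m0 x hx) (b0.mono fun a h => h x hx)) (m1 x hx) b1 hb hF
  have d1 : ∀ x ∈ U, HasFDerivAt (fun x => ∫ a, F1 x a ∂μ) (∫ a, F2 x a ∂μ) x := fun x hx =>
    hasFDerivAt_integral_of_dominated_of_fderiv_le (hU.mem_nhds hx)
      (by filter_upwards [hU.mem_nhds hx] with y hy using m1 y hy)
      (hb.mono' (m1 x hx) (b1.mono fun a h => h x hx)) (m2 x hx) b2 hb hF1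
  have c2 : ContinuousOn (fun x => ∫ a, F2 x a ∂μ) U :=
    continuousOn_of_dominated m2 (fun x hx => b2.mono fun a h => h x hx) hb hF2
  refine ⟨?_, d0⟩
  have hc1 : ContDiffOn ℝ (0 + 1) (fun x => ∫ a, F1 x a ∂μ) U :=
    (contDiffOn_succ_iff_hasFDerivWithinAt_of_uniqueDiffOn hU.uniqueDiffOn).2
      ⟨by simp, _, contDiffOn_zero.2 c2, fun x hx => (d1 x hx).hasFDerivWithinAt⟩
  have hc2 : ContDiffOn ℝ (1 + 1) (fun x => ∫ a, F x a ∂μ) U :=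
    (contDiffOn_succ_iff_hasFDerivWithinAt_of_uniqueDiffOn hU.uniqueDiffOn).2
      ⟨by simp, _, by simpa using hc1, fun x hx => (d0 x hx).hasFDerivWithinAt⟩
  exact hc2.of_le (by norm_num [one_add_one_eq_two])

end ParametricIntegral

/-! ### The Euclidean form on the plane with the supremum norm -/

section Quadratic

/-- The Euclidean scalar product on `ℝ²` as a continuous bilinear form. -/
def dotL : (Fin 2 → ℝ) →L[ℝ] (Fin 2 → ℝ) →L[ℝ] ℝ :=
  ∑ i, (ContinuousLinearMap.proj (R := ℝ) (φ := fun _ : Fin 2 => ℝ) i).smulRight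
    (ContinuousLinearMap.proj (R := ℝ) (φ := fun _ : Fin 2 => ℝ) i)

theorem dotL_apply (y v : Fin 2 → ℝ) : dotL y v = ∑ i, y i * v i := by
  simp [dotL]

/-- The squared Euclidean length. -/
def sqLen (y : Fin 2 → ℝ) : ℝ := ∑ i, y i ^ 2

theorem sqLen_nonneg (y : Fin 2 → ℝ) : 0 ≤ sqLen y := by unfold sqLen; positivity

theorem sq_norm_le_sqLen (y : Fin 2 → ℝ) : ‖y‖ ^ 2 ≤ sqLen y := by
  have h : ‖y‖ ≤ Real.sqrt (sqLen y) := by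
    refine (pi_norm_le_iff_of_nonneg (Real.sqrt_nonneg _)).2 fun i => Real.le_sqrt_of_sq_le ?_
    rw [Real.norm_eq_abs, sq_abs]
    exact Finset.single_le_sum (f := fun i => y i ^ 2) (fun _ _ => sq_nonneg _) (Finset.mem_univ i)
  calc ‖y‖ ^ 2 ≤ Real.sqrt (sqLen y) ^ 2 := by gcongr
    _ = sqLen y := Real.sq_sqrt (sqLen_nonneg y)

theorem sqLen_le (y : Fin 2 → ℝ) : sqLen y ≤ 2 * ‖y‖ ^ 2 := by
  have h : ∀ i, y i ^ 2 ≤ ‖y‖ ^ 2 := fun i => by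
    rw [← sq_abs, ← Real.norm_eq_abs]
    gcongr
    exact norm_le_pi_norm y i
  rw [sqLen, Fin.sum_univ_two]
  linarith [h 0, h 1]

theorem norm_dotL_apply_le (y : Fin 2 → ℝ) : ‖dotL y‖ ≤ 2 * ‖y‖ := by
  refine ContinuousLinearMap.opNorm_le_bound _ (by positivity) fun v => ?_
  rw [dotL_apply]
  refine (norm_sum_le_of_le (f := fun i => y i * v i) (n := fun _ => ‖y‖ * ‖v‖)
    Finset.univ fun i _ => ?_).trans_eq ?_
  · rw [norm_mul]
    exact mul_le_mul (norm_le_pi_norm y i) (norm_le_pi_norm v i) (norm_nonneg _) (norm_nonneg _)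
  · simp; ring

theorem norm_dotL_le : ‖dotL‖ ≤ 2 :=
  ContinuousLinearMap.opNorm_le_bound _ (by positivity) norm_dotL_apply_le

theorem hasFDerivAt_sqLen (y : Fin 2 → ℝ) : HasFDerivAt sqLen ((2 : ℝ) • dotL y) y := by
  have h : HasFDerivAt sqLen (∑ i, (2 * y i ^ (2 - 1)) •
      ContinuousLinearMap.proj (R := ℝ) (φ := fun _ : Fin 2 => ℝ) i) y :=
    HasFDerivAt.fun_sum fun i _ => by
      have := (hasFDerivAt_apply (𝕜 := ℝ) i y).pow 2
      simpa using this
  refine h.congr_fderiv (ContinuousLinearMap.ext fun v => ?_)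
  simp [dotL_apply]
  ring

end Quadratic

/-! ### The heat kernel as a lattice sum of Gaussians -/

section Gaussian

/-- A lattice point as a vector. -/
def latticeVec (m : Fin 2 → ℤ) : Fin 2 → ℝ := fun i => (m i : ℝ)

/-- This is Poisson summation, in the form of the functional equation relating `evenKernel` and
`cosKernel`. -/
theorem hasSum_gaussian_one {t : ℝ} (ht : 0 < t) (a : ℝ) :
    HasSum (fun m : ℤ => (Real.sqrt (4 * Real.pi * t))⁻¹ * Real.exp (-((a - m) ^ 2 / (4 * t))))
      (HurwitzZeta.cosKernel (a : UnitAddCircle) (4 * Real.pi * t)) := by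
  have hpi := Real.pi_pos
  have h := HurwitzZeta.hasSum_int_evenKernel a (t := (4 * Real.pi * t)⁻¹) (by positivity)
  rw [HurwitzZeta.evenKernel_functional_equation, ← Real.sqrt_eq_rpow, one_div, one_div,
    Real.sqrt_inv, inv_inv, inv_inv] at h
  have h2 := ((Equiv.neg ℤ).hasSum_iff.2 h).mul_left (Real.sqrt (4 * Real.pi * t))⁻¹
  rw [inv_mul_cancel_left₀ (by positivity)] at h2
  refine h2.congr_fun fun m => ?_
  simp only [Function.comp, Equiv.neg_apply, Int.cast_neg]
  congr 2
  field_simp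
  ring

/-- The heat kernel as a periodised Gaussian. -/
theorem hasSum_gaussian {t : ℝ} (ht : 0 < t) (y : Fin 2 → ℝ) :
    HasSum (fun m : Fin 2 → ℤ =>
      (4 * Real.pi * t)⁻¹ * Real.exp (-(sqLen (y - latticeVec m) / (4 * t))))
      (heatKernel t (toTorus y)) := by
  have h0 := hasSum_gaussian_one ht (y 0)
  have h1 := hasSum_gaussian_one ht (y 1)
  have hs := summable_mul_of_summable_norm h0.summable.norm h1.summable.norm
  have h' := (Equiv.hasSum_iff (finTwoArrowEquiv ℤ)).2 (h0.mul h1 hs)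
  rw [heatKernel_eq ht]
  refine h'.congr_fun fun m => ?_
  have e3 : finTwoArrowEquiv ℤ m = (m 0, m 1) := rfl
  have hpi := Real.pi_pos
  simp only [Function.comp, e3]
  rw [mul_mul_mul_comm, ← Real.exp_add, ← mul_inv, Real.mul_self_sqrt (by positivity)]
  congr 2
  rw [sqLen, Fin.sum_univ_two]
  simp only [Pi.sub_apply, latticeVec]
  ring

end Gaussian

/-! ### Pointwise bounds for Gaussian terms and their derivatives -/

section GaussianPart

/-- The index measure of the sum over the lattice and the integral over short times. -/
def shortMeasure : Measure (ℝ × (Fin 2 → ℤ)) := (volume.restrict (Ioc 0 1)).prod Measure.count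

theorem ae_shortMeasure : ∀ᵐ a ∂shortMeasure, a.1 ∈ Ioc (0 : ℝ) 1 :=
  Measure.quasiMeasurePreserving_fst.ae (ae_restrict_mem measurableSet_Ioc)

/-- A short-time Gaussian term of the Green function, with its first two derivatives. -/
def gaussTerm (s : ℝ) (x : Fin 2 → ℝ) (a : ℝ × (Fin 2 → ℤ)) : ℝ :=
  a.1 ^ (s - 2) / (4 * Real.pi) * Real.exp (-(sqLen (x - latticeVec a.2) / (4 * a.1)))

/-- A derivative of `gaussTerm`. -/
def gaussTerm₁ (s : ℝ) (x : Fin 2 → ℝ) (a : ℝ × (Fin 2 → ℤ)) : (Fin 2 → ℝ) →L[ℝ] ℝ :=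
  (-(gaussTerm s x a / (2 * a.1))) • dotL (x - latticeVec a.2)

/-- A derivative of `gaussTerm`. -/
def gaussTerm₂ (s : ℝ) (x : Fin 2 → ℝ) (a : ℝ × (Fin 2 → ℤ)) :
    (Fin 2 → ℝ) →L[ℝ] (Fin 2 → ℝ) →L[ℝ] ℝ :=
  (-(gaussTerm s x a / (2 * a.1))) • dotL + (gaussTerm s x a / (4 * a.1 ^ 2)) •
    (dotL (x - latticeVec a.2)).smulRight (dotL (x - latticeVec a.2))

theorem hasFDerivAt_gaussTerm (s : ℝ) (x : Fin 2 → ℝ) (a : ℝ × (Fin 2 → ℤ)) :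
    HasFDerivAt (fun x => gaussTerm s x a) (gaussTerm₁ s x a) x := by
  have h1 := ((hasFDerivAt_sqLen (x - latticeVec a.2)).comp x
    (f := fun x => x - latticeVec a.2) ((hasFDerivAt_id x).sub_const _)).mul_const (4 * a.1)⁻¹
  have h2 := (h1.neg.exp).const_mul (a.1 ^ (s - 2) / (4 * Real.pi))
  simp only [Function.comp, ← div_eq_mul_inv] at h2
  refine h2.congr_fderiv (ContinuousLinearMap.ext fun v => ?_)
  simp [gaussTerm₁, gaussTerm]
  ring

theorem hasFDerivAt_gaussTerm₁ (s : ℝ) (x : Fin 2 → ℝ) (a : ℝ × (Fin 2 → ℤ)) :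
    HasFDerivAt (fun x => gaussTerm₁ s x a) (gaussTerm₂ s x a) x := by
  have h1 := (((hasFDerivAt_gaussTerm s x a).mul_const (2 * a.1)⁻¹).neg).smul
    ((dotL.hasFDerivAt (x := x - latticeVec a.2)).comp x
      (f := fun x => x - latticeVec a.2) ((hasFDerivAt_id x).sub_const _))
  simp only [Function.comp, ← div_eq_mul_inv] at h1
  refine h1.congr_fderiv (ContinuousLinearMap.ext fun v => ContinuousLinearMap.ext fun w => ?_)
  simp [gaussTerm₂, gaussTerm₁]
  ring

theorem continuous_gaussTerm₂ (s : ℝ) (a : ℝ × (Fin 2 → ℤ)) :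
    Continuous fun x => gaussTerm₂ s x a := by
  have h0 : Continuous fun x => gaussTerm s x a :=
    continuous_iff_continuousAt.2 fun x => (hasFDerivAt_gaussTerm s x a).continuousAt
  have h1 : Continuous fun x => dotL (x - latticeVec a.2) :=
    dotL.continuous.comp (continuous_id.sub continuous_const)
  have h2 : Continuous fun x => ContinuousLinearMap.smulRightL ℝ (Fin 2 → ℝ) ((Fin 2 → ℝ) →L[ℝ] ℝ)
      (dotL (x - latticeVec a.2)) (dotL (x - latticeVec a.2)) :=
    ((ContinuousLinearMap.smulRightL ℝ (Fin 2 → ℝ) ((Fin 2 → ℝ) →L[ℝ] ℝ)).continuous.comp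
      h1).clm_apply h1
  exact ((h0.div_const _).neg.smul continuous_const).add ((h0.div_const _).smul h2)

theorem measurable_sqLen_sub (x : Fin 2 → ℝ) :
    Measurable fun a : ℝ × (Fin 2 → ℤ) => sqLen (x - latticeVec a.2) :=
  (measurable_of_countable fun m : Fin 2 → ℤ => sqLen (x - latticeVec m)).comp measurable_snd

theorem measurable_gaussTerm (s : ℝ) (x : Fin 2 → ℝ) : Measurable (gaussTerm s x) := by
  have := measurable_sqLen_sub x
  unfold gaussTerm
  fun_prop

theorem stronglyMeasurable_comp_snd {W : Type*} [TopologicalSpace W] (f : (Fin 2 → ℤ) → W) :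
    StronglyMeasurable fun a : ℝ × (Fin 2 → ℤ) => f a.2 :=
  (StronglyMeasurable.of_discrete (f := f)).comp_measurable measurable_snd

theorem stronglyMeasurable_gaussTerm₁ (s : ℝ) (x : Fin 2 → ℝ) :
    StronglyMeasurable (gaussTerm₁ s x) := by
  have h := measurable_gaussTerm s x
  have h1 : Measurable fun a : ℝ × (Fin 2 → ℤ) => -(gaussTerm s x a / (2 * a.1)) := by fun_prop
  exact h1.stronglyMeasurable.smul (stronglyMeasurable_comp_snd fun m => dotL (x - latticeVec m))

theorem stronglyMeasurable_smul_add_smul {α W : Type*} [MeasurableSpace α] [NormedAddCommGroup W]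
    [NormedSpace ℝ W] {c d : α → ℝ} {f g : α → W} (hc : Measurable c) (hd : Measurable d)
    (hf : StronglyMeasurable f) (hg : StronglyMeasurable g) :
    StronglyMeasurable fun a => c a • f a + d a • g a :=
  (hc.stronglyMeasurable.smul hf).add (hd.stronglyMeasurable.smul hg)

theorem stronglyMeasurable_gaussTerm₂ (s : ℝ) (x : Fin 2 → ℝ) :
    StronglyMeasurable (gaussTerm₂ s x) := by
  have h := measurable_gaussTerm s x
  have h1 : Measurable fun a : ℝ × (Fin 2 → ℤ) => -(gaussTerm s x a / (2 * a.1)) := by fun_prop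
  have h2 : Measurable fun a : ℝ × (Fin 2 → ℤ) => gaussTerm s x a / (4 * a.1 ^ 2) := by fun_prop
  have h3 := stronglyMeasurable_comp_snd fun m : Fin 2 → ℤ =>
    (dotL (x - latticeVec m)).smulRight (dotL (x - latticeVec m))
  exact stronglyMeasurable_smul_add_smul (W := (Fin 2 → ℝ) →L[ℝ] (Fin 2 → ℝ) →L[ℝ] ℝ) h1 h2
    stronglyMeasurable_const h3

/-- A majorant of the first derivative of the Gaussian terms, in terms of Gaussians at time `2t`. -/
def gaussMajorant (s : ℝ) (x : Fin 2 → ℝ) (a : ℝ × (Fin 2 → ℤ)) : ℝ :=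
  a.1 ^ (s - 3 / 2) * ((4 * Real.pi * (2 * a.1))⁻¹ *
    Real.exp (-(sqLen (x - latticeVec a.2) / (4 * (2 * a.1)))))

/-- Half of the Gaussian decay pays for the linear factor; what remains is a Gaussian at twice the
time. -/
theorem exp_neg_div_four_mul_le (u : ℝ) :
    (1 + u) * Real.exp (-(u / 4)) ≤ 8 * Real.exp (-(u / 8)) := by
  have h1 : 1 + u ≤ 8 * Real.exp (u / 8) := by linarith [Real.add_one_le_exp (u / 8)]
  calc (1 + u) * Real.exp (-(u / 4)) ≤ 8 * Real.exp (u / 8) * Real.exp (-(u / 4)) := by gcongr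
    _ = 8 * Real.exp (-(u / 8)) := by rw [mul_assoc, ← Real.exp_add]; congr 2; ring

variable {s : ℝ} {x : Fin 2 → ℝ} {a : ℝ × (Fin 2 → ℤ)}

theorem gaussTerm_nonneg (ha : a.1 ∈ Ioc (0 : ℝ) 1) : 0 ≤ gaussTerm s x a := by
  have := ha.1
  have := Real.pi_pos
  unfold gaussTerm; positivity

theorem one_add_mul_gaussTerm_le (ha : a.1 ∈ Ioc (0 : ℝ) 1) :
    (1 + sqLen (x - latticeVec a.2) / a.1) * gaussTerm s x a ≤
      16 * Real.sqrt a.1 * gaussMajorant s x a := by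
  obtain ⟨t, m⟩ := a
  have ht : 0 < t := ha.1
  have hpi := Real.pi_pos
  have hR := sqLen_nonneg (x - latticeVec m)
  have h := exp_neg_div_four_mul_le (sqLen (x - latticeVec m) / t)
  have e1 : sqLen (x - latticeVec m) / (4 * t) = sqLen (x - latticeVec m) / t / 4 := by
    field_simp
  have e2 : sqLen (x - latticeVec m) / (4 * (2 * t)) = sqLen (x - latticeVec m) / t / 8 := by
    field_simp; ring
  have e3 : Real.sqrt t * t ^ (s - 3 / 2) = t ^ (s - 2) * t := by
    rw [Real.sqrt_eq_rpow, ← Real.rpow_add ht, ← Real.rpow_add_one ht.ne']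
    congr 1; ring
  simp only [gaussTerm, gaussMajorant]
  rw [e1, e2]
  set u := sqLen (x - latticeVec m) / t
  calc (1 + u) * (t ^ (s - 2) / (4 * Real.pi) * Real.exp (-(u / 4)))
      = t ^ (s - 2) / (4 * Real.pi) * ((1 + u) * Real.exp (-(u / 4))) := by ring
    _ ≤ t ^ (s - 2) / (4 * Real.pi) * (8 * Real.exp (-(u / 8))) := by gcongr
    _ = 16 * (t ^ (s - 2) * t) * ((4 * Real.pi * (2 * t))⁻¹ * Real.exp (-(u / 8))) := by
        field_simp; ring
    _ = _ := by rw [← e3]; ring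

/-- Differentiating brings down `|x - m| / t`, and `|x - m| / √t ≤ 1 + |x - m|² / t` is absorbed
into the Gaussian at time `2t`. The net cost is one factor `t^(-1/2)`, whence the exponent `s - 3/2`
in the majorant. -/
theorem norm_gaussTerm₁_le (ha : a.1 ∈ Ioc (0 : ℝ) 1) :
    ‖gaussTerm₁ s x a‖ ≤ 16 * gaussMajorant s x a := by
  have ht : 0 < a.1 := ha.1
  have hW := gaussTerm_nonneg (s := s) (x := x) ha
  have hM := one_add_mul_gaussTerm_le (s := s) (x := x) ha
  set R := sqLen (x - latticeVec a.2) with hR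
  have hR0 : 0 ≤ R := sqLen_nonneg _
  set q := Real.sqrt a.1 with hq
  have hq0 : 0 < q := Real.sqrt_pos.2 ht
  have hqq : q * q = a.1 := Real.mul_self_sqrt ht.le
  set n := ‖x - latticeVec a.2‖ with hn
  have hn0 : 0 ≤ n := norm_nonneg _
  have hnR : n ^ 2 ≤ R := sq_norm_le_sqLen _
  have h1 : n / q ≤ 1 + R / a.1 := by
    have h2 : (n / q) ^ 2 ≤ R / a.1 := by
      rw [div_pow, sq q, hqq]; gcongr
    nlinarith [sq_nonneg (n / q - 1), div_nonneg hn0 hq0.le]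
  rw [gaussTerm₁, norm_smul, norm_neg, Real.norm_eq_abs, abs_of_nonneg (by positivity)]
  calc gaussTerm s x a / (2 * a.1) * ‖dotL (x - latticeVec a.2)‖
      ≤ gaussTerm s x a / (2 * a.1) * (2 * n) := by gcongr; exact norm_dotL_apply_le _
    _ = (n / q * gaussTerm s x a) / q := by rw [← hqq]; field_simp
    _ ≤ ((1 + R / a.1) * gaussTerm s x a) / q := by gcongr
    _ ≤ (16 * q * gaussMajorant s x a) / q := by gcongr
    _ = 16 * gaussMajorant s x a := by field_simp

/-- The common bound of the Gaussian terms and their derivatives. -/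
theorem gaussTerm_bounds (hs : 0 ≤ s) (ha : a.1 ∈ Ioc (0 : ℝ) 1) :
    ‖gaussTerm s x a‖ ≤ (a.1⁻¹) ^ 3 * Real.exp (-(sqLen (x - latticeVec a.2) / (8 * a.1))) ∧
    ‖gaussTerm₁ s x a‖ ≤ (a.1⁻¹) ^ 3 * Real.exp (-(sqLen (x - latticeVec a.2) / (8 * a.1))) ∧
    ‖gaussTerm₂ s x a‖ ≤ (a.1⁻¹) ^ 3 * Real.exp (-(sqLen (x - latticeVec a.2) / (8 * a.1))) ∧
    16 * gaussMajorant s x a ≤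
      (a.1⁻¹) ^ 3 * Real.exp (-(sqLen (x - latticeVec a.2) / (8 * a.1))) := by
  have ht : 0 < a.1 := ha.1
  have hpi := Real.pi_gt_three
  set R := sqLen (x - latticeVec a.2) with hR
  have hR0 : 0 ≤ R := sqLen_nonneg _
  set q := Real.sqrt a.1 with hq
  have hq0 : 0 < q := Real.sqrt_pos.2 ht
  have hq1 : q ≤ 1 := Real.sqrt_le_one.2 ha.2
  have hqq : q * q = a.1 := Real.mul_self_sqrt ht.le
  have hW := gaussTerm_nonneg (s := s) (x := x) ha
  have hM := one_add_mul_gaussTerm_le (s := s) (x := x) ha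
  rw [← hR, ← hq] at hM
  -- The spare factor `q = √t` is kept on purpose: with the one in `hM` it forms `t`, which cancels
  -- the extra `t⁻¹` of the second derivative.
  have key : 16 * gaussMajorant s x a ≤ q * ((a.1⁻¹) ^ 3 * Real.exp (-(R / (8 * a.1)))) := by
    rw [gaussMajorant, ← hR]
    have e1 : a.1 ^ (s - 3 / 2) ≤ q * (a.1⁻¹) ^ 2 := by
      have : q * (a.1⁻¹) ^ 2 = a.1 ^ ((1 : ℝ) / 2 - 2) := by
        rw [hq, Real.sqrt_eq_rpow, Real.rpow_sub ht, inv_pow, Real.rpow_two]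
        exact (div_eq_mul_inv _ _).symm
      rw [this]
      exact Real.rpow_le_rpow_of_exponent_ge ht ha.2 (by linarith)
    have e2 : R / (4 * (2 * a.1)) = R / (8 * a.1) := by congr 1; ring
    rw [e2]
    have e3 : 16 * (4 * Real.pi * (2 * a.1))⁻¹ ≤ a.1⁻¹ := by
      rw [mul_inv_le_iff₀ (by positivity)]
      have : a.1⁻¹ * (4 * Real.pi * (2 * a.1)) = 8 * Real.pi := by field_simp; norm_num
      rw [this]; linarith
    calc 16 * (a.1 ^ (s - 3 / 2) * ((4 * Real.pi * (2 * a.1))⁻¹ * Real.exp (-(R / (8 * a.1)))))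
        = a.1 ^ (s - 3 / 2) * (16 * (4 * Real.pi * (2 * a.1))⁻¹) * Real.exp (-(R / (8 * a.1))) := by
          ring
      _ ≤ (q * (a.1⁻¹) ^ 2) * a.1⁻¹ * Real.exp (-(R / (8 * a.1))) := by gcongr
      _ = _ := by ring
  have hE : 0 ≤ (a.1⁻¹) ^ 3 * Real.exp (-(R / (8 * a.1))) := by positivity
  have hMaj : 16 * gaussMajorant s x a ≤ (a.1⁻¹) ^ 3 * Real.exp (-(R / (8 * a.1))) :=
    key.trans (mul_le_of_le_one_left hE hq1)
  have hMaj0 : 0 ≤ gaussMajorant s x a := by unfold gaussMajorant; positivity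
  refine ⟨?_, (norm_gaussTerm₁_le ha).trans hMaj, ?_, hMaj⟩
  · rw [Real.norm_eq_abs, abs_of_nonneg hW]
    have h1 : gaussTerm s x a ≤ (1 + R / a.1) * gaussTerm s x a :=
      le_mul_of_one_le_left hW (by linarith [div_nonneg hR0 ht.le])
    have h2 : 16 * q * gaussMajorant s x a ≤ 16 * gaussMajorant s x a := by
      nlinarith [mul_le_of_le_one_left hMaj0 hq1]
    linarith
  · have hd := norm_dotL_apply_le (x - latticeVec a.2)
    have hn := sq_norm_le_sqLen (x - latticeVec a.2)
    rw [← hR] at hn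
    have h1 : ‖gaussTerm₂ s x a‖ ≤ gaussTerm s x a / (2 * a.1) * 2 +
        gaussTerm s x a / (4 * a.1 ^ 2) * (4 * R) := by
      rw [gaussTerm₂]
      refine (ContinuousLinearMap.opNorm_add_le _ _).trans (add_le_add ?_ ?_)
      · rw [norm_smul, norm_neg, Real.norm_eq_abs, abs_of_nonneg (by positivity)]
        gcongr
        exact norm_dotL_le
      · rw [norm_smul, Real.norm_eq_abs, abs_of_nonneg (by positivity),
          ContinuousLinearMap.norm_smulRight_apply]
        refine mul_le_mul_of_nonneg_left ?_ (by positivity)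
        nlinarith [norm_nonneg (dotL (x - latticeVec a.2)), norm_nonneg (x - latticeVec a.2)]
    have h2 : gaussTerm s x a / (2 * a.1) * 2 + gaussTerm s x a / (4 * a.1 ^ 2) * (4 * R) =
        ((1 + R / a.1) * gaussTerm s x a) * a.1⁻¹ := by
      field_simp
    have h3 : 16 * q * gaussMajorant s x a * a.1⁻¹ ≤
        (q * (q * ((a.1⁻¹) ^ 3 * Real.exp (-(R / (8 * a.1)))))) * a.1⁻¹ := by
      rw [mul_comm 16 q, mul_assoc q 16]
      gcongr
    have h4 : (q * (q * ((a.1⁻¹) ^ 3 * Real.exp (-(R / (8 * a.1)))))) * a.1⁻¹ =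
        (a.1⁻¹) ^ 3 * Real.exp (-(R / (8 * a.1))) := by
      rw [← mul_assoc q q, hqq]; field_simp
    calc ‖gaussTerm₂ s x a‖ ≤ ((1 + R / a.1) * gaussTerm s x a) * a.1⁻¹ := h1.trans_eq h2
      _ ≤ (16 * q * gaussMajorant s x a) * a.1⁻¹ := by gcongr
      _ ≤ _ := h3.trans_eq h4

end GaussianPart

/-! ### The short-time part of the Green function -/

section ShortTime

theorem toTorus_latticeVec (m : Fin 2 → ℤ) : toTorus (latticeVec m) = 0 := toTorus_intCast m

theorem freqSq_le_sqLen_sub (x : Fin 2 → ℝ) (m : Fin 2 → ℤ) :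
    freqSq m / 2 - sqLen x ≤ sqLen (x - latticeVec m) := by
  simp only [freqSq, sqLen, Fin.sum_univ_two, Pi.sub_apply, latticeVec]
  nlinarith [sq_nonneg ((m 0 : ℝ) - 2 * x 0), sq_nonneg ((m 1 : ℝ) - 2 * x 1)]

/-- The exponent is split in two. One half, using the distance `ρ` from the lattice, absorbs `t⁻³`
through `v³/6 ≤ exp v`; the other, using `t ≤ 1` and `R ≥ f/2 - B`, leaves decay summable over the
lattice. -/
theorem inv_pow_three_mul_exp_le {t ρ R f B : ℝ} (ht : t ∈ Ioc (0 : ℝ) 1) (hρ : 0 < ρ)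
    (hR : ρ ≤ R) (hB : f / 2 - B ≤ R) :
    (t⁻¹) ^ 3 * Real.exp (-(R / (8 * t))) ≤
      6 * (16 / ρ) ^ 3 * Real.exp (B / 16) * Real.exp (-(f / 32)) := by
  have ht0 : 0 < t := ht.1
  have ht1 : 1 ≤ t⁻¹ := (one_le_inv₀ ht0).2 ht.2
  set v := ρ * t⁻¹ / 16 with hv
  have hv0 : 0 ≤ v := by positivity
  have h1 : v ^ 3 / 6 ≤ Real.exp v := by
    have := Real.pow_div_factorial_le_exp v hv0 3
    norm_num [Nat.factorial] at this
    exact this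
  have h2 : (t⁻¹) ^ 3 ≤ 6 * (16 / ρ) ^ 3 * Real.exp v := by
    have : t⁻¹ ^ 3 = 6 * (16 / ρ) ^ 3 * (v ^ 3 / 6) := by rw [hv]; field_simp
    rw [this]; gcongr
  have h3 : Real.exp (-(R / (8 * t))) ≤ Real.exp (-v + B / 16 - f / 32) := by
    refine Real.exp_le_exp.2 ?_
    have e : R / (8 * t) = R * t⁻¹ / 16 + R * t⁻¹ / 16 := by field_simp; ring
    have h4 : R * 1 ≤ R * t⁻¹ := by gcongr; linarith
    have h5 : ρ * t⁻¹ ≤ R * t⁻¹ := by gcongr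
    rw [e, hv]; linarith
  calc (t⁻¹) ^ 3 * Real.exp (-(R / (8 * t)))
      ≤ (6 * (16 / ρ) ^ 3 * Real.exp v) * Real.exp (-v + B / 16 - f / 32) := by gcongr
    _ = 6 * (16 / ρ) ^ 3 * (Real.exp v * Real.exp (-v + B / 16 - f / 32)) := by ring
    _ = 6 * (16 / ρ) ^ 3 * (Real.exp (B / 16) * Real.exp (-(f / 32))) := by
        rw [← Real.exp_add, ← Real.exp_add]; congr 2; ring
    _ = _ := by ring

theorem summable_exp_neg_freqSq {c : ℝ} (hc : 0 < c) :
    Summable fun m : Fin 2 → ℤ => Real.exp (-(c * freqSq m)) := by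
  have hpi := Real.pi_pos
  refine (summable_heat (t := c / (4 * Real.pi ^ 2)) (by positivity)).congr fun m => ?_
  congr 2
  field_simp

theorem exists_integrable_bound {y₀ : Fin 2 → ℝ} (hy : toTorus y₀ ≠ 0) :
    ∃ U, IsOpen U ∧ y₀ ∈ U ∧ ∃ bound : ℝ × (Fin 2 → ℤ) → ℝ, Integrable bound shortMeasure ∧
      ∀ a : ℝ × (Fin 2 → ℤ), a.1 ∈ Ioc (0 : ℝ) 1 → ∀ x ∈ U,
        (a.1⁻¹) ^ 3 * Real.exp (-(sqLen (x - latticeVec a.2) / (8 * a.1))) ≤ bound a := by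
  obtain ⟨δ, hδ, hball⟩ := Metric.eventually_nhds_iff_ball.1
    (continuous_toTorus.continuousAt.eventually_ne hy)
  set B := 2 * (‖y₀‖ + δ) ^ 2 with hB
  set C := 6 * (16 / (δ / 2) ^ 2) ^ 3 * Real.exp (B / 16) with hC
  -- The ball of radius `δ` contains no lattice point, so points of the half ball stay at distance
  -- at least `δ / 2` from all of them.
  refine ⟨Metric.ball y₀ (δ / 2), Metric.isOpen_ball, Metric.mem_ball_self (by positivity),
    fun a => C * Real.exp (-(freqSq a.2 / 32)), ?_, fun a ha x hx => ?_⟩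
  · have hs : Integrable (fun m : Fin 2 → ℤ => Real.exp (-(freqSq m / 32))) Measure.count := by
      refine integrable_count_iff.2 ((summable_exp_neg_freqSq (c := 1 / 32) (by norm_num)).congr
        fun m => ?_)
      rw [Real.norm_eq_abs, Real.abs_exp]
      congr 2; ring
    exact (hs.comp_snd (volume.restrict (Ioc (0 : ℝ) 1))).const_mul C
  · rw [Metric.mem_ball] at hx
    refine inv_pow_three_mul_exp_le ha (by positivity) ?_ ((sub_le_sub_left ?_ _).trans
      (freqSq_le_sqLen_sub x a.2))
    · refine le_trans ?_ (sq_norm_le_sqLen _)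
      have h1 : δ / 2 ≤ ‖x - latticeVec a.2‖ := by
        by_contra! h
        refine hball (latticeVec a.2) ?_ (toTorus_latticeVec _)
        rw [Metric.mem_ball]
        have h2 := dist_triangle (latticeVec a.2) x y₀
        rw [dist_comm _ x, dist_eq_norm x (latticeVec a.2)] at h2
        linarith
      gcongr
    · refine (sqLen_le x).trans ?_
      have : ‖x‖ ≤ ‖y₀‖ + δ := by
        have h2 := norm_le_norm_add_norm_sub' x y₀
        rw [dist_eq_norm] at hx
        linarith
      rw [hB]
      gcongr

/-- The part of the Green function coming from the times in `(0, 1]`. -/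
def shortPart (s : ℝ) (x : Fin 2 → ℝ) : ℝ := ∫ a, gaussTerm s x a ∂shortMeasure

variable {s : ℝ} {y : Fin 2 → ℝ}

theorem shortPart_smooth (hs : 0 ≤ s) (hy : toTorus y ≠ 0) :
    ContDiffAt ℝ 2 (shortPart s) y ∧
      HasFDerivAt (shortPart s) (∫ a, gaussTerm₁ s y a ∂shortMeasure) y := by
  obtain ⟨U, hU, hyU, bound, hb, hbound⟩ := exists_integrable_bound hy
  have h := contDiffOn_two_integral (μ := shortMeasure) (F := gaussTerm s) (F1 := gaussTerm₁ s)
    (F2 := gaussTerm₂ s) hU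
    (.of_forall fun a x _ => hasFDerivAt_gaussTerm s x a)
    (.of_forall fun a x _ => hasFDerivAt_gaussTerm₁ s x a)
    (.of_forall fun a => (continuous_gaussTerm₂ s a).continuousOn)
    (fun x _ => (measurable_gaussTerm s x).aestronglyMeasurable)
    (fun x _ => (stronglyMeasurable_gaussTerm₁ s x).aestronglyMeasurable)
    (fun x _ => (stronglyMeasurable_gaussTerm₂ s x).aestronglyMeasurable) hb
    (ae_shortMeasure.mono fun a ha x hx => (gaussTerm_bounds hs ha).1.trans (hbound a ha x hx))
    (ae_shortMeasure.mono fun a ha x hx => (gaussTerm_bounds hs ha).2.1.trans (hbound a ha x hx))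
    (ae_shortMeasure.mono fun a ha x hx => (gaussTerm_bounds hs ha).2.2.1.trans (hbound a ha x hx))
  exact ⟨h.1.contDiffAt (hU.mem_nhds hyU), h.2 y hyU⟩

theorem integrable_gaussTerm (hs : 0 ≤ s) (hy : toTorus y ≠ 0) :
    Integrable (gaussTerm s y) shortMeasure := by
  obtain ⟨U, hU, hyU, bound, hb, hbound⟩ := exists_integrable_bound hy
  exact hb.mono' (measurable_gaussTerm s y).aestronglyMeasurable
    (ae_shortMeasure.mono fun a ha => (gaussTerm_bounds hs ha).1.trans (hbound a ha y hyU))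

theorem measurable_gaussMajorant (s : ℝ) (x : Fin 2 → ℝ) : Measurable (gaussMajorant s x) := by
  have := measurable_sqLen_sub x
  unfold gaussMajorant
  fun_prop

theorem gaussMajorant_nonneg {a : ℝ × (Fin 2 → ℤ)} (ha : a.1 ∈ Ioc (0 : ℝ) 1) :
    0 ≤ gaussMajorant s y a := by
  have := ha.1
  have := Real.pi_pos
  unfold gaussMajorant; positivity

theorem integrable_gaussMajorant (hs : 0 ≤ s) (hy : toTorus y ≠ 0) :
    Integrable (gaussMajorant s y) shortMeasure := by
  obtain ⟨U, hU, hyU, bound, hb, hbound⟩ := exists_integrable_bound hy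
  refine hb.mono' (measurable_gaussMajorant s y).aestronglyMeasurable
    (ae_shortMeasure.mono fun a ha => ?_)
  have h := (gaussTerm_bounds (x := y) hs ha).2.2.2.trans (hbound a ha y hyU)
  rw [Real.norm_eq_abs, abs_of_nonneg (gaussMajorant_nonneg ha)]
  linarith [gaussMajorant_nonneg (s := s) (y := y) ha]

theorem integral_count_eq_of_hasSum {f : (Fin 2 → ℤ) → ℝ} {c : ℝ} (h : HasSum f c) :
    ∫ m, f m ∂Measure.count = c := by
  rw [integral_countable (integrable_count_iff.2 h.summable.norm)]
  simpa [measureReal_def] using h.tsum_eq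

theorem integral_gaussTerm_snd {t : ℝ} (ht : 0 < t) :
    ∫ m, gaussTerm s y (t, m) ∂Measure.count = t ^ (s - 1) * heatKernel t (toTorus y) := by
  refine integral_count_eq_of_hasSum (((hasSum_gaussian ht y).mul_left (t ^ (s - 1))).congr_fun
    fun m => ?_)
  have hpi := Real.pi_pos
  have e : t ^ (s - 1) = t ^ (s - 2) * t := by
    rw [← Real.rpow_add_one ht.ne']; congr 1; ring
  simp only [gaussTerm]
  rw [e]
  field_simp

theorem integral_gaussMajorant_snd {t : ℝ} (ht : 0 < t) :
    ∫ m, gaussMajorant s y (t, m) ∂Measure.count =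
      t ^ (s - 3 / 2) * heatKernel (2 * t) (toTorus y) :=
  integral_count_eq_of_hasSum
    ((hasSum_gaussian (by positivity : 0 < 2 * t) y).mul_left (t ^ (s - 3 / 2)))

theorem shortPart_eq (hs : 0 ≤ s) (hy : toTorus y ≠ 0) :
    IntegrableOn (fun t => t ^ (s - 1) * heatKernel t (toTorus y)) (Ioc 0 1) ∧
      shortPart s y = ∫ t in Ioc (0 : ℝ) 1, t ^ (s - 1) * heatKernel t (toTorus y) := by
  have hi := integrable_gaussTerm hs hy
  have e : ∀ t ∈ Ioc (0 : ℝ) 1, ∫ m, gaussTerm s y (t, m) ∂Measure.count =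
      t ^ (s - 1) * heatKernel t (toTorus y) := fun t ht => integral_gaussTerm_snd ht.1
  refine ⟨(integrableOn_congr_fun e measurableSet_Ioc).1 hi.integral_prod_left, ?_⟩
  rw [← setIntegral_congr_fun measurableSet_Ioc e]
  exact integral_prod _ hi

theorem norm_integral_gaussTerm₁_le (hs : 0 ≤ s) (hy : toTorus y ≠ 0) :
    ‖∫ a, gaussTerm₁ s y a ∂shortMeasure‖ ≤
      16 * ∫ t in Ioc (0 : ℝ) 1, t ^ (s - 3 / 2) * heatKernel (2 * t) (toTorus y) := by
  have hi := integrable_gaussMajorant hs hy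
  have e : ∀ t ∈ Ioc (0 : ℝ) 1, ∫ m, gaussMajorant s y (t, m) ∂Measure.count =
      t ^ (s - 3 / 2) * heatKernel (2 * t) (toTorus y) := fun t ht =>
    integral_gaussMajorant_snd ht.1
  rw [← setIntegral_congr_fun measurableSet_Ioc e, ← integral_prod (gaussMajorant s y) hi,
    ← integral_const_mul]
  exact norm_integral_le_of_norm_le (hi.const_mul 16)
    (ae_shortMeasure.mono fun a ha => norm_gaussTerm₁_le ha)

end ShortTime

/-! ### The long-time part of the Green function -/

section LongTime

/-- The index measure of the sum over the frequencies and the integral over long times. -/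
def longMeasure : Measure (ℝ × (Fin 2 → ℤ)) := (volume.restrict (Ioi 1)).prod Measure.count

theorem ae_longMeasure : ∀ᵐ a ∂longMeasure, a.1 ∈ Ioi (1 : ℝ) :=
  Measure.quasiMeasurePreserving_fst.ae (ae_restrict_mem measurableSet_Ioi)

/-- The coefficient of a frequency in the long-time part of the Green function. -/
def waveCoeff (s : ℝ) (a : ℝ × (Fin 2 → ℤ)) : ℝ :=
  if a.2 = 0 then 0 else a.1 ^ (s - 1) * Real.exp (-(4 * Real.pi ^ 2 * freqSq a.2 * a.1))

/-- The phase of a plane wave. -/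
def phase (m : Fin 2 → ℤ) : (Fin 2 → ℝ) →L[ℝ] ℝ := (2 * Real.pi) • dotL (latticeVec m)

/-- A plane wave in the long-time part of the Green function, with its first two derivatives. -/
def waveTerm (s : ℝ) (x : Fin 2 → ℝ) (a : ℝ × (Fin 2 → ℤ)) : ℝ :=
  waveCoeff s a * Real.cos (phase a.2 x)

/-- A derivative of `waveTerm`. -/
def waveTerm₁ (s : ℝ) (x : Fin 2 → ℝ) (a : ℝ × (Fin 2 → ℤ)) : (Fin 2 → ℝ) →L[ℝ] ℝ :=
  (-(waveCoeff s a * Real.sin (phase a.2 x))) • phase a.2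

/-- A derivative of `waveTerm`. -/
def waveTerm₂ (s : ℝ) (x : Fin 2 → ℝ) (a : ℝ × (Fin 2 → ℤ)) :
    (Fin 2 → ℝ) →L[ℝ] (Fin 2 → ℝ) →L[ℝ] ℝ :=
  (-(waveCoeff s a * Real.cos (phase a.2 x))) • (phase a.2).smulRight (phase a.2)

theorem hasFDerivAt_waveTerm (s : ℝ) (x : Fin 2 → ℝ) (a : ℝ × (Fin 2 → ℤ)) :
    HasFDerivAt (fun x => waveTerm s x a) (waveTerm₁ s x a) x := by
  refine (((phase a.2).hasFDerivAt (x := x)).cos.const_mul (waveCoeff s a)).congr_fderiv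
    (ContinuousLinearMap.ext fun v => ?_)
  simp [waveTerm₁]
  ring

theorem hasFDerivAt_waveTerm₁ (s : ℝ) (x : Fin 2 → ℝ) (a : ℝ × (Fin 2 → ℤ)) :
    HasFDerivAt (fun x => waveTerm₁ s x a) (waveTerm₂ s x a) x := by
  refine (((((phase a.2).hasFDerivAt (x := x)).sin.const_mul (waveCoeff s a)).neg).smul_const
    (phase a.2)).congr_fderiv (ContinuousLinearMap.ext fun v => ContinuousLinearMap.ext fun w => ?_)
  simp [waveTerm₂]
  ring

theorem continuous_waveTerm₂ (s : ℝ) (a : ℝ × (Fin 2 → ℤ)) :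
    Continuous fun x => waveTerm₂ s x a := by
  have h : Continuous fun x => -(waveCoeff s a * Real.cos (phase a.2 x)) := by fun_prop
  exact h.smul continuous_const

theorem measurable_waveCoeff (s : ℝ) : Measurable (waveCoeff s) := by
  have h : Measurable fun a : ℝ × (Fin 2 → ℤ) => freqSq a.2 :=
    (measurable_of_countable freqSq).comp measurable_snd
  unfold waveCoeff
  refine Measurable.ite ?_ measurable_const (by fun_prop)
  exact measurable_snd (measurableSet_singleton (0 : Fin 2 → ℤ))

theorem measurable_phase (x : Fin 2 → ℝ) :
    Measurable fun a : ℝ × (Fin 2 → ℤ) => phase a.2 x :=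
  (measurable_of_countable fun m : Fin 2 → ℤ => phase m x).comp measurable_snd

theorem measurable_waveTerm (s : ℝ) (x : Fin 2 → ℝ) : Measurable (waveTerm s x) :=
  (measurable_waveCoeff s).mul (Real.measurable_cos.comp (measurable_phase x))

theorem stronglyMeasurable_waveTerm₁ (s : ℝ) (x : Fin 2 → ℝ) :
    StronglyMeasurable (waveTerm₁ s x) :=
  ((measurable_waveCoeff s).mul
    (Real.measurable_sin.comp (measurable_phase x))).neg.stronglyMeasurable.smul
    (stronglyMeasurable_comp_snd phase)

theorem stronglyMeasurable_waveTerm₂ (s : ℝ) (x : Fin 2 → ℝ) :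
    StronglyMeasurable (waveTerm₂ s x) := by
  have h := stronglyMeasurable_comp_snd fun m : Fin 2 → ℤ => (phase m).smulRight (phase m)
  exact (measurable_waveTerm s x).neg.stronglyMeasurable.smul h

theorem norm_phase_le (m : Fin 2 → ℤ) : ‖phase m‖ ^ 2 ≤ 256 * freqSq m := by
  have hpi := Real.pi_pos
  have hpi4 := Real.pi_le_four
  have h1 : ‖phase m‖ ≤ 16 * ‖latticeVec m‖ := by
    rw [phase, norm_smul, Real.norm_eq_abs, abs_of_pos (by positivity)]
    have h2 := norm_dotL_apply_le (latticeVec m)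
    calc 2 * Real.pi * ‖dotL (latticeVec m)‖ ≤ 2 * 4 * (2 * ‖latticeVec m‖) := by gcongr
      _ = 16 * ‖latticeVec m‖ := by ring
  have h3 : ‖latticeVec m‖ ^ 2 ≤ freqSq m := sq_norm_le_sqLen (latticeVec m)
  calc ‖phase m‖ ^ 2 ≤ (16 * ‖latticeVec m‖) ^ 2 := by gcongr
    _ = 256 * ‖latticeVec m‖ ^ 2 := by ring
    _ ≤ _ := by gcongr

/-- The common bound of the plane waves and their derivatives. -/
def waveBound (a : ℝ × (Fin 2 → ℤ)) : ℝ := Real.exp (-a.1) * (256 * Real.exp (-freqSq a.2))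

theorem integrable_waveBound : Integrable waveBound longMeasure := by
  have hs : Integrable (fun m : Fin 2 → ℤ => Real.exp (-freqSq m)) Measure.count := by
    refine integrable_count_iff.2 ((summable_exp_neg_freqSq one_pos).congr fun m => ?_)
    rw [Real.norm_eq_abs, Real.abs_exp, one_mul]
  exact (integrableOn_exp_neg_Ioi 1).mul_prod (hs.const_mul 256)

variable {s : ℝ} {x : Fin 2 → ℝ} {a : ℝ × (Fin 2 → ℤ)}

/-- For `t` and `|m|²` at least one, `4π²|m|²t ≥ t + 2|m|²`. One factor `exp(-|m|²)` absorbs the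
quadratic growth of `p` and the other leaves a summable series. -/
theorem abs_waveCoeff_mul_le (hs : s ≤ 1) (ha : 1 < a.1) {p : ℝ} (hp0 : 0 ≤ p)
    (hp : a.2 ≠ 0 → p ≤ 256 * freqSq a.2) :
    |waveCoeff s a| * p ≤ waveBound a := by
  unfold waveCoeff waveBound
  split_ifs with h
  · simp; positivity
  · have hf := one_le_freqSq h
    have hp := hp h
    have hpi := Real.pi_gt_three
    have h1 : a.1 ^ (s - 1) ≤ 1 := Real.rpow_le_one_of_one_le_of_nonpos ha.le (by linarith)
    have h2 : Real.exp (-(4 * Real.pi ^ 2 * freqSq a.2 * a.1)) ≤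
        Real.exp (-a.1 + (-freqSq a.2 + -freqSq a.2)) := by
      refine Real.exp_le_exp.2 ?_
      have h3 : 3 * (freqSq a.2 * a.1) ≤ 4 * Real.pi ^ 2 * (freqSq a.2 * a.1) := by
        gcongr; nlinarith
      nlinarith [mul_nonneg (sub_nonneg.2 hf) (sub_nonneg.2 ha.le)]
    have h4 : freqSq a.2 * Real.exp (-freqSq a.2) ≤ 1 := by
      rw [Real.exp_neg, ← div_eq_mul_inv, div_le_one (Real.exp_pos _)]
      linarith [Real.add_one_le_exp (freqSq a.2)]
    rw [abs_of_nonneg (by have := ha; positivity)]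
    calc a.1 ^ (s - 1) * Real.exp (-(4 * Real.pi ^ 2 * freqSq a.2 * a.1)) * p
        ≤ 1 * Real.exp (-a.1 + (-freqSq a.2 + -freqSq a.2)) * (256 * freqSq a.2) := by gcongr
      _ = Real.exp (-a.1) * (256 * Real.exp (-freqSq a.2)) *
          (freqSq a.2 * Real.exp (-freqSq a.2)) := by rw [Real.exp_add, Real.exp_add]; ring
      _ ≤ Real.exp (-a.1) * (256 * Real.exp (-freqSq a.2)) * 1 := by gcongr
      _ = _ := mul_one _

theorem waveTerm_bounds (hs : s ≤ 1) (ha : 1 < a.1) :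
    ‖waveTerm s x a‖ ≤ waveBound a ∧ ‖waveTerm₁ s x a‖ ≤ waveBound a ∧
      ‖waveTerm₂ s x a‖ ≤ waveBound a := by
  have hph := norm_phase_le a.2
  have hcos := Real.abs_cos_le_one (phase a.2 x)
  have hsin := Real.abs_sin_le_one (phase a.2 x)
  refine ⟨?_, ?_, ?_⟩
  · rw [waveTerm, Real.norm_eq_abs, abs_mul]
    exact abs_waveCoeff_mul_le hs ha (abs_nonneg _) fun h => by linarith [one_le_freqSq h]
  · rw [waveTerm₁, norm_smul, norm_neg, Real.norm_eq_abs, abs_mul, mul_assoc]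
    refine abs_waveCoeff_mul_le hs ha (by positivity) fun h => ?_
    refine (mul_le_of_le_one_left (norm_nonneg _) hsin).trans ?_
    nlinarith [sq_nonneg (‖phase a.2‖ - 1), one_le_freqSq h]
  · refine (ContinuousLinearMap.opNorm_smul_le _ _).trans ?_
    rw [norm_neg, Real.norm_eq_abs, abs_mul, mul_assoc, ContinuousLinearMap.norm_smulRight_apply]
    refine abs_waveCoeff_mul_le hs ha (by positivity) fun h => ?_
    refine (mul_le_of_le_one_left (by positivity) hcos).trans ?_
    rwa [← sq]

/-- The part of the Green function coming from the times larger than `1`. -/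
def longPart (s : ℝ) (x : Fin 2 → ℝ) : ℝ := ∫ a, waveTerm s x a ∂longMeasure

theorem longPart_smooth (hs : s ≤ 1) (y : Fin 2 → ℝ) :
    ContDiffAt ℝ 2 (longPart s) y ∧
      HasFDerivAt (longPart s) (∫ a, waveTerm₁ s y a ∂longMeasure) y := by
  have h := contDiffOn_two_integral (μ := longMeasure) (F := waveTerm s) (F1 := waveTerm₁ s)
    (F2 := waveTerm₂ s) isOpen_univ
    (.of_forall fun a x _ => hasFDerivAt_waveTerm s x a)
    (.of_forall fun a x _ => hasFDerivAt_waveTerm₁ s x a)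
    (.of_forall fun a => (continuous_waveTerm₂ s a).continuousOn)
    (fun x _ => (measurable_waveTerm s x).aestronglyMeasurable)
    (fun x _ => (stronglyMeasurable_waveTerm₁ s x).aestronglyMeasurable)
    (fun x _ => (stronglyMeasurable_waveTerm₂ s x).aestronglyMeasurable) integrable_waveBound
    (ae_longMeasure.mono fun a ha x _ => (waveTerm_bounds hs ha).1)
    (ae_longMeasure.mono fun a ha x _ => (waveTerm_bounds hs ha).2.1)
    (ae_longMeasure.mono fun a ha x _ => (waveTerm_bounds hs ha).2.2)
  exact ⟨h.1.contDiffAt univ_mem, h.2 y (mem_univ y)⟩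

theorem integrable_waveTerm (hs : s ≤ 1) (y : Fin 2 → ℝ) :
    Integrable (waveTerm s y) longMeasure :=
  integrable_waveBound.mono' (measurable_waveTerm s y).aestronglyMeasurable
    (ae_longMeasure.mono fun _ ha => (waveTerm_bounds hs ha).1)

theorem abs_longPart_le (hs : s ≤ 1) (y : Fin 2 → ℝ) :
    |longPart s y| ≤ ∫ a, waveBound a ∂longMeasure :=
  norm_integral_le_of_norm_le integrable_waveBound
    (ae_longMeasure.mono fun _ ha => (waveTerm_bounds hs ha).1)

theorem norm_integral_waveTerm₁_le (hs : s ≤ 1) (y : Fin 2 → ℝ) :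
    ‖∫ a, waveTerm₁ s y a ∂longMeasure‖ ≤ ∫ a, waveBound a ∂longMeasure :=
  norm_integral_le_of_norm_le integrable_waveBound
    (ae_longMeasure.mono fun _ ha => (waveTerm_bounds hs ha).2.1)

theorem mFourier_toTorus_re (m : Fin 2 → ℤ) (y : Fin 2 → ℝ) :
    (UnitAddTorus.mFourier m (toTorus y)).re = Real.cos (phase m y) := by
  have h : UnitAddTorus.mFourier m (toTorus y) =
      Complex.exp ((phase m y : ℝ) * Complex.I) := by
    simp only [UnitAddTorus.mFourier, ContinuousMap.coe_mk, toTorus, fourier_coe_apply,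
      Fin.prod_univ_two, ← Complex.exp_add]
    congr 1
    simp [phase, dotL_apply, latticeVec]
    ring
  rw [h, Complex.exp_ofReal_mul_I_re]

theorem integral_waveTerm_snd {t : ℝ} (ht : 0 < t) (y : Fin 2 → ℝ) :
    ∫ m, waveTerm s y (t, m) ∂Measure.count = t ^ (s - 1) * (heatKernel t (toTorus y) - 1) := by
  have h1 := Complex.hasSum_re (hasSum_heatKernel ht (toTorus y))
  simp only [Complex.re_ofReal_mul, Complex.ofReal_re, mFourier_toTorus_re] at h1
  have h2 := (h1.sub (hasSum_ite_eq (0 : Fin 2 → ℤ) (1 : ℝ))).mul_left (t ^ (s - 1))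
  refine integral_count_eq_of_hasSum (h2.congr_fun fun m => ?_)
  simp only [waveTerm, waveCoeff]
  split_ifs with h
  · subst h
    simp [phase, latticeVec, freqSq, dotL_apply]
  · ring

theorem longPart_eq (hs : s ≤ 1) (y : Fin 2 → ℝ) :
    IntegrableOn (fun t => t ^ (s - 1) * (heatKernel t (toTorus y) - 1)) (Ioi 1) ∧
      longPart s y = ∫ t in Ioi (1 : ℝ), t ^ (s - 1) * (heatKernel t (toTorus y) - 1) := by
  have hi := integrable_waveTerm hs y
  have e : ∀ t ∈ Ioi (1 : ℝ), ∫ m, waveTerm s y (t, m) ∂Measure.count =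
      t ^ (s - 1) * (heatKernel t (toTorus y) - 1) := fun t ht =>
    integral_waveTerm_snd (one_pos.trans ht) y
  refine ⟨(integrableOn_congr_fun e measurableSet_Ioi).1 hi.integral_prod_left, ?_⟩
  rw [← setIntegral_congr_fun measurableSet_Ioi e]
  exact integral_prod _ hi

end LongTime

/-! ### Verification of the required properties of the Green function -/

section Green

theorem isOpenMap_toTorus : IsOpenMap toTorus :=
  IsOpenMap.piMap (fun _ => QuotientAddGroup.isOpenMap_coe) (by simp)

theorem heatKernel_neg (t : ℝ) (x : Torus) : heatKernel t (-x) = heatKernel t x := by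
  obtain ⟨y, rfl⟩ := toTorus_surjective x
  simp only [heatKernel, ← toTorus_neg, mFourier_toTorus_re, map_neg, Real.cos_neg]

variable {s : ℝ} {y : Fin 2 → ℝ}

/-- The subtracted constant mode is handled differently in the two ranges: for short times it is
integrated separately and gives `-1 / s`, for long times it cancels the zero frequency. -/
theorem integral_heat_eq (hs0 : 0 < s) (hs1 : s ≤ 1) (hy : toTorus y ≠ 0) :
    ∫ t in Ioi (0 : ℝ), t ^ (s - 1) * (heatKernel t (toTorus y) - 1) =
      shortPart s y - 1 / s + longPart s y := by
  obtain ⟨i1, e1⟩ := shortPart_eq hs0.le hy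
  obtain ⟨i2, e2⟩ := longPart_eq hs1 y
  have hi : IntervalIntegrable (fun t : ℝ => t ^ (s - 1)) volume 0 1 :=
    intervalIntegral.intervalIntegrable_rpow' (by linarith)
  have i3 : IntegrableOn (fun t : ℝ => t ^ (s - 1)) (Ioc 0 1) :=
    (intervalIntegrable_iff_integrableOn_Ioc_of_le zero_le_one).1 hi
  have e3 : ∫ t in Ioc (0 : ℝ) 1, t ^ (s - 1) = 1 / s := by
    rw [← intervalIntegral.integral_of_le zero_le_one, integral_rpow (Or.inl (by linarith)),
      sub_add_cancel, Real.one_rpow, Real.zero_rpow hs0.ne', sub_zero]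
  have i4 : IntegrableOn (fun t => t ^ (s - 1) * (heatKernel t (toTorus y) - 1)) (Ioc 0 1) := by
    simp only [mul_sub, mul_one]
    exact i1.sub i3
  rw [← Ioc_union_Ioi_eq_Ioi zero_le_one, setIntegral_union Ioc_disjoint_Ioi_same
    measurableSet_Ioi i4 i2, e2, e1, ← e3, ← integral_sub i1 i3]
  simp only [mul_sub, mul_one]

theorem shortPart_nonneg (s : ℝ) (y : Fin 2 → ℝ) : 0 ≤ shortPart s y :=
  integral_nonneg_of_ae (ae_shortMeasure.mono fun _ ha => gaussTerm_nonneg ha)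

/-- By positivity it suffices to keep the lattice point 0 and the times between `|y|²` and `2|y|²`,
where the Gaussian factor is at least `exp(-1/4)`. -/
theorem le_shortPart (hs0 : 0 ≤ s) (hs1 : s ≤ 1) (hy : toTorus y ≠ 0) (hR : 0 < sqLen y)
    (hR1 : 2 * sqLen y ≤ 1) :
    (2 * sqLen y) ^ (s - 1) * ((8 * Real.pi)⁻¹ * Real.exp (-(1 / 4))) ≤ shortPart s y := by
  obtain ⟨i1, e1⟩ := shortPart_eq hs0 hy
  have hpi := Real.pi_pos
  set R := sqLen y with hRdef
  have hsub : Ioc R (2 * R) ⊆ Ioc 0 1 := fun t ht => ⟨hR.trans ht.1, ht.2.trans hR1⟩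
  rw [e1]
  have h1 : ∀ t ∈ Ioc R (2 * R),
      (2 * R) ^ (s - 1) * ((4 * Real.pi * (2 * R))⁻¹ * Real.exp (-(1 / 4))) ≤
        t ^ (s - 1) * heatKernel t (toTorus y) := by
    intro t ht
    have ht0 : 0 < t := hR.trans ht.1
    have h2 := le_hasSum (hasSum_gaussian ht0 y) 0 fun m _ => by positivity
    have h3 : latticeVec 0 = 0 := by funext i; simp [latticeVec]
    rw [h3, sub_zero, ← hRdef] at h2
    have h4 : (2 * R) ^ (s - 1) ≤ t ^ (s - 1) :=
      Real.rpow_le_rpow_of_nonpos ht0 ht.2 (by linarith)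
    have h5 : R / (4 * t) ≤ 1 / 4 := by
      rw [div_le_div_iff₀ (by positivity) (by norm_num)]
      linarith [ht.1]
    refine mul_le_mul h4 (le_trans ?_ h2) (by positivity) (by positivity)
    gcongr
    exact ht.2
  have h6 := setIntegral_ge_of_const_le_real measurableSet_Ioc (by simp) h1 (i1.mono_set hsub)
  have h7 : ∫ t in Ioc R (2 * R), t ^ (s - 1) * heatKernel t (toTorus y) ≤
      ∫ t in Ioc (0 : ℝ) 1, t ^ (s - 1) * heatKernel t (toTorus y) :=
    setIntegral_mono_set i1 ((ae_restrict_mem measurableSet_Ioc).mono fun t ht =>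
      mul_nonneg (Real.rpow_nonneg ht.1.le _) (heatKernel_nonneg ht.1 _)) hsub.eventuallyLE
  refine le_trans (le_of_eq ?_) (h6.trans h7)
  rw [measureReal_def, Real.volume_Ioc, ENNReal.toReal_ofReal (by linarith)]
  field_simp
  ring

variable {ε : ℝ}

theorem greenFunction_toTorus (hε : ε ∈ Ioo (0 : ℝ) 1) (hy : toTorus y ≠ 0) :
    greenFunction ε (toTorus y) = (Real.Gamma ((1 + ε) / 2))⁻¹ *
      (shortPart ((1 + ε) / 2) y - 1 / ((1 + ε) / 2) + longPart ((1 + ε) / 2) y) := by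
  rw [greenFunction, integral_heat_eq (by linarith [hε.1]) (by linarith [hε.2]) hy]

theorem greenFunction_eventuallyEq (hε : ε ∈ Ioo (0 : ℝ) 1) (hy : toTorus y ≠ 0) :
    (fun z => greenFunction ε (toTorus z)) =ᶠ[𝓝 y] fun z => (Real.Gamma ((1 + ε) / 2))⁻¹ *
      (shortPart ((1 + ε) / 2) z - 1 / ((1 + ε) / 2) + longPart ((1 + ε) / 2) z) :=
  (continuous_toTorus.continuousAt.eventually_ne hy).mono fun _ hz => greenFunction_toTorus hε hz

theorem greenFunction_neg (x : Torus) : greenFunction ε (-x) = greenFunction ε x := by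
  simp only [greenFunction, heatKernel_neg]

theorem contDiffAt_greenFunction (hε : ε ∈ Ioo (0 : ℝ) 1) (hy : toTorus y ≠ 0) :
    ContDiffAt ℝ 2 (fun z => greenFunction ε (toTorus z)) y :=
  (contDiffAt_const.mul (((shortPart_smooth (by linarith [hε.1]) hy).1.sub contDiffAt_const).add
    (longPart_smooth (by linarith [hε.2]) y).1)).congr_of_eventuallyEq
      (greenFunction_eventuallyEq hε hy)

theorem inv_Gamma_pos (hε : ε ∈ Ioo (0 : ℝ) 1) : 0 < (Real.Gamma ((1 + ε) / 2))⁻¹ :=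
  inv_pos.2 (Real.Gamma_pos_of_pos (by linarith [hε.1]))

theorem exists_neg_le_greenFunction (hε : ε ∈ Ioo (0 : ℝ) 1) :
    ∃ C, ∀ x, -C ≤ greenFunction ε x := by
  set W := ∫ a, waveBound a ∂longMeasure with hW
  -- The representation holds only off the origin, so the value assigned at 0 is bounded by its own
  -- absolute value.
  refine ⟨max |greenFunction ε 0| ((Real.Gamma ((1 + ε) / 2))⁻¹ * (1 / ((1 + ε) / 2) + W)),
    fun x => ?_⟩
  by_cases hx : x = 0
  · subst hx
    linarith [le_max_left |greenFunction ε 0|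
      ((Real.Gamma ((1 + ε) / 2))⁻¹ * (1 / ((1 + ε) / 2) + W)), neg_abs_le (greenFunction ε 0)]
  · obtain ⟨y, rfl⟩ := toTorus_surjective x
    refine (neg_le_neg (le_max_right _ _)).trans ?_
    rw [greenFunction_toTorus hε hx, ← mul_neg]
    refine mul_le_mul_of_nonneg_left ?_ (inv_Gamma_pos hε).le
    have h1 := (abs_le.1 (abs_longPart_le (s := (1 + ε) / 2) (by linarith [hε.2]) y)).1
    linarith [shortPart_nonneg ((1 + ε) / 2) y]

/-- The lower bound `|y|^(2(s-1))`, up to constants, diverges because `s < 1`; the remaining terms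
are bounded. -/
theorem tendsto_greenFunction (hε : ε ∈ Ioo (0 : ℝ) 1) :
    Tendsto (greenFunction ε) (𝓝[≠] 0) atTop := by
  set s := (1 + ε) / 2 with hs
  have hs0 : 0 < s := by linarith [hε.1]
  have hs1 : s < 1 := by linarith [hε.2]
  have hpi := Real.pi_pos
  have hΓ := inv_Gamma_pos hε
  rw [← hs] at hΓ
  set W := ∫ a, waveBound a ∂longMeasure with hW
  set c := (8 * Real.pi)⁻¹ * Real.exp (-(1 / 4)) with hc
  have hc0 : 0 < c := by positivity
  have hlim : Tendsto (fun r : ℝ => (Real.Gamma s)⁻¹ * (r ^ (s - 1) * c - 1 / s - W))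
      (𝓝[>] 0) atTop := by
    have h1 := (tendsto_rpow_neg_nhdsGT_zero (y := s - 1) (by linarith)).atTop_mul_const hc0
    have h2 := tendsto_atTop_add_const_right _ (-(1 / s) - W) h1
    refine (h2.const_mul_atTop hΓ).congr fun r => ?_
    ring
  refine tendsto_atTop.2 fun M => ?_
  rw [eventually_nhdsWithin_iff]
  -- The covering map is open, so neighbourhoods of 0 in the plane project onto neighbourhoods of 0
  -- in the torus.
  suffices h : ∀ᶠ y in 𝓝 (0 : Fin 2 → ℝ), toTorus y ≠ 0 → M ≤ greenFunction ε (toTorus y) by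
    have h' := isOpenMap_toTorus.nhds_le 0
    rw [toTorus_zero] at h'
    exact h' h
  have hsq : Tendsto (fun y => 2 * sqLen y) (𝓝 (0 : Fin 2 → ℝ)) (𝓝 0) := by
    have := (hasFDerivAt_sqLen 0).continuousAt.tendsto.const_mul 2
    simpa [sqLen] using this
  have hM := hlim.eventually_ge_atTop M
  rw [eventually_nhdsWithin_iff] at hM
  filter_upwards [hsq.eventually hM, hsq.eventually_le_const one_pos] with y h1 h2 hy
  have hR : 0 < sqLen y := by
    have hy0 : y ≠ 0 := by
      rintro rfl
      exact hy toTorus_zero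
    exact (pow_pos (norm_pos_iff.2 hy0) 2).trans_le (sq_norm_le_sqLen y)
  refine (h1 (show 0 < 2 * sqLen y by positivity)).trans ?_
  rw [greenFunction_toTorus hε hy, ← hs]
  have h3 := le_shortPart hs0.le hs1.le hy hR h2
  have h4 := (abs_le.1 (abs_longPart_le hs1.le y)).1
  refine mul_le_mul_of_nonneg_left ?_ hΓ.le
  linarith

/-- An integrable majorant of the gradient of the Green function. -/
def gradMajorant (s : ℝ) (x : Torus) : ℝ :=
  (Real.Gamma s)⁻¹ * (16 * (∫ t in Ioc (0 : ℝ) 1, t ^ (s - 3 / 2) * heatKernel (2 * t) x) +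
    ∫ a, waveBound a ∂longMeasure)

theorem abs_partialDeriv_greenFunction_le (hε : ε ∈ Ioo (0 : ℝ) 1) {x : Torus} (hx : x ≠ 0)
    (i : Fin 2) : |partialDeriv (greenFunction ε) i x| ≤ gradMajorant ((1 + ε) / 2) x := by
  obtain ⟨y, rfl⟩ := toTorus_surjective x
  have hs0 : 0 ≤ (1 + ε) / 2 := by linarith [hε.1]
  have hs1 : (1 + ε) / 2 ≤ 1 := by linarith [hε.2]
  have h := (((((shortPart_smooth hs0 hx).2.sub_const (1 / ((1 + ε) / 2))).add
    (longPart_smooth hs1 y).2).const_mul (Real.Gamma ((1 + ε) / 2))⁻¹).congr_of_eventuallyEq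
      (greenFunction_eventuallyEq hε hx))
  rw [partialDeriv_toTorus h.differentiableAt, h.fderiv, ← Real.norm_eq_abs]
  refine (ContinuousLinearMap.le_opNorm _ _).trans ?_
  rw [Pi.norm_single, norm_one, mul_one, norm_smul, Real.norm_eq_abs,
    abs_of_pos (inv_Gamma_pos hε)]
  refine mul_le_mul_of_nonneg_left ?_ (inv_Gamma_pos hε).le
  exact (norm_add_le _ _).trans
    (add_le_add (norm_integral_gaussTerm₁_le hs0 hx) (norm_integral_waveTerm₁_le hs1 y))

/-- The heat kernel is nonnegative with integral one, so each time slice has norm `t^(s-3/2)`,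
integrable at 0 because `s > 1/2`. -/
theorem integrable_rpow_mul_heatKernel (hs : 1 / 2 < s) :
    Integrable (fun p : ℝ × Torus => p.1 ^ (s - 3 / 2) * heatKernel (2 * p.1) p.2)
      ((volume.restrict (Ioc 0 1)).prod volume) := by
  have hm : AEStronglyMeasurable
      (fun p : ℝ × Torus => p.1 ^ (s - 3 / 2) * heatKernel (2 * p.1) p.2)
      ((volume.restrict (Ioc 0 1)).prod volume) := by
    have hc : ContinuousOn (fun p : ℝ × Torus => p.1 ^ (s - 3 / 2) * heatKernel (2 * p.1) p.2)
        (Ioc 0 1 ×ˢ univ) := by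
      refine ContinuousOn.mul (continuousOn_fst.rpow_const fun p hp => Or.inl (ne_of_gt hp.1.1)) ?_
      refine continuousOn_heatKernel.comp (f := fun p : ℝ × Torus => (2 * p.1, p.2))
        (by fun_prop) fun p hp => ⟨?_, trivial⟩
      have : 0 < p.1 := hp.1.1
      exact (by positivity : 0 < 2 * p.1)
    have := hc.aestronglyMeasurable (μ := (volume : Measure ℝ).prod (volume : Measure Torus))
      (measurableSet_Ioc.prod MeasurableSet.univ)
    rwa [← Measure.prod_restrict, Measure.restrict_univ] at this
  have hin : ∀ t ∈ Ioc (0 : ℝ) 1, ∫ x : Torus, ‖t ^ (s - 3 / 2) * heatKernel (2 * t) x‖ =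
      t ^ (s - 3 / 2) := by
    intro t ht
    have ht0 : 0 < 2 * t := by linarith [ht.1]
    have h1 : ∀ x : Torus, ‖t ^ (s - 3 / 2) * heatKernel (2 * t) x‖ =
        t ^ (s - 3 / 2) * heatKernel (2 * t) x := fun x => by
      rw [Real.norm_eq_abs, abs_of_nonneg
        (mul_nonneg (Real.rpow_nonneg ht.1.le _) (heatKernel_nonneg ht0 x))]
    simp only [h1]
    rw [integral_const_mul, integral_heatKernel ht0, mul_one]
  refine (integrable_prod_iff hm).2 ⟨?_, ?_⟩
  · refine (ae_restrict_mem measurableSet_Ioc).mono fun t ht => ?_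
    have hc' : Continuous fun x : Torus => t ^ (s - 3 / 2) * heatKernel (2 * t) x :=
      continuous_const.mul (continuous_heatKernel (by linarith [ht.1]))
    exact hc'.integrable_of_hasCompactSupport (HasCompactSupport.of_compactSpace _)
  · have hi : IntervalIntegrable (fun t : ℝ => t ^ (s - 3 / 2)) volume 0 1 :=
      intervalIntegral.intervalIntegrable_rpow' (by linarith)
    exact (integrableOn_congr_fun hin measurableSet_Ioc).2
      ((intervalIntegrable_iff_integrableOn_Ioc_of_le zero_le_one).1 hi)

theorem integrable_gradMajorant (hs : 1 / 2 < s) : Integrable (gradMajorant s) :=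
  (((integrable_rpow_mul_heatKernel hs).integral_prod_right.const_mul 16).add
    (integrable_const _)).const_mul _

/-- The Fréchet derivative of any real function on the plane, evaluated at a fixed vector, is
measurable; composing with a measurable section of the covering gives a representative. -/
theorem aestronglyMeasurable_partialDeriv {G : Torus → ℝ}
    (hG : ∀ y, toTorus y ≠ 0 → DifferentiableAt ℝ (fun z => G (toTorus z)) y) (i : Fin 2) :
    AEStronglyMeasurable (partialDeriv G i) := by
  set σ : Torus → Fin 2 → ℝ := fun x k => (AddCircle.measurableEquivIco 1 0 (x k) : ℝ) with hσ
  have hm : Measurable σ := measurable_pi_iff.2 fun k =>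
    measurable_subtype_coe.comp ((AddCircle.measurableEquivIco 1 0).measurable.comp
      (measurable_pi_apply k))
  have h1 : ∀ x, toTorus (σ x) = x := fun x => by
    funext k
    exact (AddCircle.equivIco 1 0).symm_apply_apply (x k)
  have h2 : Measurable fun x : Torus =>
      fderiv ℝ (fun z => G (toTorus z)) (σ x) (Pi.single i 1) :=
    (measurable_fderiv_apply_const ℝ _ _).comp hm
  refine ⟨_, h2.stronglyMeasurable, ?_⟩
  filter_upwards [ae_ne_zero] with x hx
  have h3 := partialDeriv_toTorus (hG (σ x) (by rwa [h1])) i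
  rwa [h1] at h3

theorem isGreenLike_greenFunction (hε : ε ∈ Ioo (0 : ℝ) 1) : IsGreenLike (greenFunction ε) where
  contDiffAt _ hy := contDiffAt_greenFunction hε hy
  even := greenFunction_neg
  tendsto := tendsto_greenFunction hε
  bddBelow := exists_neg_le_greenFunction hε
  integrable := (greenFunction_fourier (by linarith [hε.1])).1
  integrable_deriv i := by
    refine (integrable_gradMajorant (s := (1 + ε) / 2) (by linarith [hε.1])).mono'
      (aestronglyMeasurable_partialDeriv (fun y hy =>
        (contDiffAt_greenFunction hε hy).differentiableAt (by norm_num)) i) ?_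
    filter_upwards [ae_ne_zero] with x hx
    exact abs_partialDeriv_greenFunction_le hε hx i

end Green

end MSQG

end

theorem mainTheorem3 (ε : ℝ) (hε : ε ∈ Ioo (0 : ℝ) 1) (N : ℕ) (ξ : Fin N → ℝ) :
    ∀ᵐ x₀ : Fin N → MSQG.Torus ∂volume, x₀ ∉ MSQG.collisionSet N →
      ∃ X : ℝ → Fin N → MSQG.Torus,
        MSQG.IsVortexSolution ε ξ (Ici 0) X ∧ X 0 = x₀ ∧
        (∀ t, 0 ≤ t → X t ∉ MSQG.collisionSet N) ∧
        ∀ T : ℝ, 0 < T → ∀ Y : ℝ → Fin N → MSQG.Torus,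
          MSQG.IsVortexSolution ε ξ (Ico 0 T) Y → Y 0 = x₀ → ∀ t ∈ Ico 0 T, Y t = X t := by
  filter_upwards [MSQG.ae_exists_vortexSolution (MSQG.isGreenLike_greenFunction hε) ξ] with x₀ h _
  exact h
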